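/- **Theorem.** Let $d\ge 0$ and $s\ge 2$ be integers, let $g\in\mathbb R$ and $T>0$. Write $C^s_b(U)$ for the functions that are $C^s$ on an open set $U$ with bounded derivatives of all orders $0,\dots,s$; such functions are identified, below, with their continuous extensions to the boundary parts where they are evaluated. Let $z_b\in C^s_b(\mathbb R^d)$, and let $(\eta,u,w)$, with values in $\mathbb R\times\mathbb R^d\times\mathbb R$, be a solution of the free-surface hydrostatic Euler system with zero atmospheric pressure $$\begin{cases}\partial_t\eta+u|_{z=\eta}\cdot\nabla\eta-w|_{z=\eta}=0,\qquad u|_{z=z_b}\cdot\nabla z_b-w|_{z=z_b}=0 & \text{in }(0,T)\times\mathbb R^d,\\ \partial_tu+u\cdot\nabla u+w\,\partial_zu+g\nabla\eta=0,\qquad \nabla\cdot u+\partial_zw=0 & \text{in }\Omega=\{(t,x,z):0<t<T,\ z_b(x)<z<\eta(t,x)\},\\ \eta|_{t=0}=\eta_0,\qquad u|_{t=0}=u_0,\end{cases}$$ where $\nabla$ acts in $x$ only, with $\eta\in C^s_b((0,T)\times\mathbb R^d)$, $u\in C_b^s(\Omega)^d$, $w\in C^s_b(\Omega)$. Let $\phi_0\in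 C^s_b(\mathbb R^d\times(0,1))$ satisfy $\phi_0(x,0)=z_b(x)$, $\phi_0(x,1)=\eta_0(x)$ and $\inf_{\mathbb R^d\times(0,1)}\partial_\lambda\phi_0>0$. For $T^*\in(0,T]$, consider the Cauchy problem $$\partial_t\phi+u(t,x,\phi)\cdot\nabla\phi=w(t,x,\phi)\ \text{ in }(0,T^*)\times\mathbb R^d\times(0,1),\qquad \phi(0,x,\lambda)=\phi_0(x,\lambda),\tag{1}$$ where a solution is required to satisfy $z_b(x)<\phi(t,x,\lambda)<\eta(t,x)$ (so that the equation makes sense), to be continuous on $[0,T^*)\times\mathbb R^d\times(0,1)$ and $C^s$ on $(0,T^*)\times\mathbb R^d\times(0,1)$. Then there is some $T^*\in(0,T]$ for which (1) has a solution $\phi$. Moreover, for every $T^*\in(0,T]$ and every solution $\phi$ of (1), the functions $$H(t,x,\lambda)=\partial_\lambda\phi(t,x,\lambda),\qquad \tilde u(t,x,\lambda)=u(t,x,\phi(t,x,\lambda))$$ are of class $C^{s-1}$ and $C^s$, respectively, on $(0,T^*)\times\mathbb R^d\times(0,1)$, are continuous on $[0,T^*)\times\mathbb R^d\times(0,1)$,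 $H(t,x,\cdot)$ is integrable on $(0,1)$ with $\int_0^1H\,d\lambda$ differentiable in $x$, and they solve $$\begin{cases}\partial_tH+\nabla\cdot(H\tilde u)=0 & \text{in }(0,T^*)\times\mathbb R^d\times(0,1),\\ \partial_t\tilde u+\tilde u\cdot\nabla\tilde u+g\nabla\int_0^1H\,d\lambda=-g\nabla z_b & \text{in }(0,T^*)\times\mathbb R^d\times(0,1),\\ H(0,x,\lambda)=\partial_\lambda\phi_0(x,\lambda),\qquad \tilde u(0,x,\lambda)=u(0,x,\phi_0(x,\lambda)) & \text{in }\mathbb R^d\times(0,1).\end{cases}$$ -/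

import Mathlib

noncomputable section

namespace HydroEuler

/-- The horizontal space `ℝ^d` with its Euclidean structure. -/
abbrev Space (d : ℕ) : Type := EuclideanSpace ℝ (Fin d)

/-- `f` belongs to `C_b^s(U)`: it is `C^s` on `U` (an open set in all uses) and its derivatives of
order `0, …, s` are bounded on `U`. -/
def IsCb {X Y : Type*} [NormedAddCommGroup X] [NormedSpace ℝ X] [NormedAddCommGroup Y]
    [NormedSpace ℝ Y] (s : ℕ) (U : Set X) (f : X → Y) : Prop :=
  ContDiffOn ℝ s f U ∧ ∀ k ≤ s, ∃ C : ℝ, ∀ p ∈ U, ‖iteratedFDerivWithin ℝ k f U p‖ ≤ C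

/-- The horizontal divergence `∑ i, ∂_i v_i` of a vector field on `ℝ^d`. -/
def div {d : ℕ} (v : Space d → Space d) (x : Space d) : ℝ :=
  ∑ i : Fin d, (fderiv ℝ v x (EuclideanSpace.single i (1 : ℝ))) i

/-- The space-time fluid domain `(0,T) × Ω_t`, with `Ω_t = {(x,z) : z_b(x) < z < η(t,x)}`. -/
def fluidDomain {d : ℕ} (T : ℝ) (zb : Space d → ℝ) (η : ℝ → Space d → ℝ) :
    Set (ℝ × Space d × ℝ) :=
  {p | 0 < p.1 ∧ p.1 < T ∧ zb p.2.1 < p.2.2 ∧ p.2.2 < η p.1 p.2.1}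

/-- The fluid domain together with its bottom, its free surface and the initial time. -/
def fluidDomainBar {d : ℕ} (T : ℝ) (zb : Space d → ℝ) (η : ℝ → Space d → ℝ) :
    Set (ℝ × Space d × ℝ) :=
  {p | 0 ≤ p.1 ∧ p.1 < T ∧ zb p.2.1 ≤ p.2.2 ∧ p.2.2 ≤ η p.1 p.2.1}

/-- The fixed domain `(0,T) × ℝ^d × (0,1)`. -/
def strip (d : ℕ) (T : ℝ) : Set (ℝ × Space d × ℝ) :=
  {p | 0 < p.1 ∧ p.1 < T ∧ 0 < p.2.2 ∧ p.2.2 < 1}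

/-- The fixed domain together with the initial time, `[0,T) × ℝ^d × (0,1)`. -/
def stripBar (d : ℕ) (T : ℝ) : Set (ℝ × Space d × ℝ) :=
  {p | 0 ≤ p.1 ∧ p.1 < T ∧ 0 < p.2.2 ∧ p.2.2 < 1}

/-- `(η, u, w)` is a solution on `(0,T)` of the free-surface hydrostatic Euler system with zero
atmospheric pressure, gravity `g`, bottom `zb` and initial data `(η₀, u₀)`, of class `C_b^s`.
A `C_b^s` function (`s ≥ 1`) on the open fluid domain extends continuously to the bottom, to the
free surface and to time zero; the values of `η, u, w` there are those of this extension. -/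
structure IsEulerSolution {d : ℕ} (s : ℕ) (g T : ℝ) (zb η₀ : Space d → ℝ)
    (u₀ : Space d → ℝ → Space d) (η : ℝ → Space d → ℝ) (u : ℝ → Space d → ℝ → Space d)
    (w : ℝ → Space d → ℝ → ℝ) : Prop where
  eta_Cb : IsCb s {p : ℝ × Space d | 0 < p.1 ∧ p.1 < T} (fun p => η p.1 p.2)
  u_Cb : IsCb s (fluidDomain T zb η) (fun p => u p.1 p.2.1 p.2.2)
  w_Cb : IsCb s (fluidDomain T zb η) (fun p => w p.1 p.2.1 p.2.2)
  eta_cont : ContinuousOn (fun p : ℝ × Space d => η p.1 p.2) {p | 0 ≤ p.1 ∧ p.1 < T}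
  u_cont : ContinuousOn (fun p : ℝ × Space d × ℝ => u p.1 p.2.1 p.2.2) (fluidDomainBar T zb η)
  w_cont : ContinuousOn (fun p : ℝ × Space d × ℝ => w p.1 p.2.1 p.2.2) (fluidDomainBar T zb η)
  /-- `∂_t η + u_s · ∇η - w_s = 0` -/
  surface : ∀ t ∈ Set.Ioo 0 T, ∀ x : Space d,
    deriv (fun τ => η τ x) t + fderiv ℝ (fun y => η t y) x (u t x (η t x)) - w t x (η t x) = 0
  /-- `u_b · ∇z_b - w_b = 0` -/
  bottom : ∀ t ∈ Set.Ioo 0 T, ∀ x : Space d,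
    fderiv ℝ zb x (u t x (zb x)) - w t x (zb x) = 0
  /-- `∂_t u + u · ∇u + w ∂_z u + g ∇η = 0` -/
  momentum : ∀ t x z, (t, x, z) ∈ fluidDomain T zb η →
    deriv (fun τ => u τ x z) t + fderiv ℝ (fun y => u t y z) x (u t x z)
      + w t x z • deriv (fun ζ => u t x ζ) z + g • gradient (fun y => η t y) x = 0
  /-- `∇ · u + ∂_z w = 0` -/
  incompressible : ∀ t x z, (t, x, z) ∈ fluidDomain T zb η →
    div (fun y => u t y z) x + deriv (fun ζ => w t x ζ) z = 0
  eta_init : ∀ x, η 0 x = η₀ x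
  u_init : ∀ x z, zb x < z → z < η₀ x → u 0 x z = u₀ x z

/-- `φ` is a solution on `(0,T')` of the Cauchy problem `∂_t φ + u(t,x,φ) · ∇φ = w(t,x,φ)`,
`φ(0,·) = φ₀`, of class `C^s`. As `u(t,·)` and `w(t,·)` live on `Ω_t`, the equation
includes that `(x, φ(t,x,λ))` lies in `Ω_t`; the initial value is attained continuously. -/
structure IsChangeOfVariable {d : ℕ} (s : ℕ) (T' : ℝ) (zb : Space d → ℝ) (η : ℝ → Space d → ℝ)
    (u : ℝ → Space d → ℝ → Space d) (w : ℝ → Space d → ℝ → ℝ) (φ₀ : Space d → ℝ → ℝ)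
    (φ : ℝ → Space d → ℝ → ℝ) : Prop where
  contDiffOn : ContDiffOn ℝ s (fun p : ℝ × Space d × ℝ => φ p.1 p.2.1 p.2.2) (strip d T')
  continuousOn : ContinuousOn (fun p : ℝ × Space d × ℝ => φ p.1 p.2.1 p.2.2) (stripBar d T')
  mem_fluid : ∀ t x l, (t, x, l) ∈ strip d T' → (t, x, φ t x l) ∈ fluidDomain T' zb η
  equation : ∀ t x l, (t, x, l) ∈ strip d T' →
    deriv (fun τ => φ τ x l) t + fderiv ℝ (fun y => φ t y l) x (u t x (φ t x l))
      = w t x (φ t x l)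
  init : ∀ x, ∀ l ∈ Set.Ioo (0 : ℝ) 1, φ 0 x l = φ₀ x l

/-- `(H, v)` solves on `(0,T')` the semi-Lagrangian system with initial data `(H₀, v₀)`.
The integrability and differentiability fields say that the depth `∫₀¹ H dλ` and its gradient
are meaningful; the continuity fields say that the initial data are attained continuously. -/
structure IsSemiLagrangianSolution {d : ℕ} (g T' : ℝ) (zb : Space d → ℝ) (H₀ : Space d → ℝ → ℝ)
    (v₀ : Space d → ℝ → Space d) (H : ℝ → Space d → ℝ → ℝ) (v : ℝ → Space d → ℝ → Space d) :
    Prop where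
  H_cont : ContinuousOn (fun p : ℝ × Space d × ℝ => H p.1 p.2.1 p.2.2) (stripBar d T')
  v_cont : ContinuousOn (fun p : ℝ × Space d × ℝ => v p.1 p.2.1 p.2.2) (stripBar d T')
  H_diff : DifferentiableOn ℝ (fun p : ℝ × Space d × ℝ => H p.1 p.2.1 p.2.2) (strip d T')
  v_diff : DifferentiableOn ℝ (fun p : ℝ × Space d × ℝ => v p.1 p.2.1 p.2.2) (strip d T')
  H_integrable : ∀ t ∈ Set.Ioo 0 T', ∀ x : Space d,
    MeasureTheory.IntegrableOn (fun l => H t x l) (Set.Ioo (0 : ℝ) 1)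
  depth_diff : ∀ t ∈ Set.Ioo 0 T',
    Differentiable ℝ (fun y : Space d => ∫ l in (0 : ℝ)..1, H t y l)
  /-- `∂_t H + ∇ · (H v) = 0` -/
  mass : ∀ t x l, (t, x, l) ∈ strip d T' →
    deriv (fun τ => H τ x l) t + div (fun y => H t y l • v t y l) x = 0
  /-- `∂_t v + v · ∇v + g ∇ ∫₀¹ H dλ = - g ∇z_b` -/
  momentum : ∀ t x l, (t, x, l) ∈ strip d T' →
    deriv (fun τ => v τ x l) t + fderiv ℝ (fun y => v t y l) x (v t x l)
      + g • gradient (fun y => ∫ l' in (0 : ℝ)..1, H t y l') x = -(g • gradient zb x)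
  H_init : ∀ x, ∀ l ∈ Set.Ioo (0 : ℝ) 1, H 0 x l = H₀ x l
  v_init : ∀ x, ∀ l ∈ Set.Ioo (0 : ℝ) 1, v 0 x l = v₀ x l

end HydroEuler

end

/-!
The change of variable follows the particles. If `(X, Z)(t, x, λ)` denotes the position at time `t`
of the particle that starts at `(x, φ₀(x, λ))`, then the transport equation for `φ` says that
`φ(t, X, λ) = Z`. For small times `X` is close to the identity in `x`, uniformly in `x` and `λ`, so
that `φ = Z ∘ (t, X, λ)⁻¹` is a solution; this is `exists_isChangeOfVariable`.

Three points need care. The velocity is only defined in the fluid domain: it is extended by its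
values at the bottom and at the surface (`clampField`), and the kinematic conditions together with
Grönwall's inequality show that the gaps of a trajectory to the bottom and to the surface grow or
decay at most exponentially (`IsFluid.abs_bottom_gap_le`, `IsFluid.abs_surface_gap_le`), so that
particles stay inside. The fluid domain is not convex: two points of a time slice are joined by a
path of comparable length (`IsFluid.hasLipschitzSlices`), whence the velocity is Lipschitz in space.
Finally, the derivatives of the velocity are bounded, but need not extend continuously to time zero,
so that the usual theorem on the smoothness of flows does not apply; `IsFlow.contDiffOn` proves it
in this setting, by comparing the flow on a short initial interval through the derivative bound
only, and by uniform differentiability afterwards.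

For an arbitrary solution `φ`, the particles are followed backward in time: a particle at
`(x, φ(t, x, λ))` was at `(X, φ(τ, X, λ))` at all earlier times `τ`
(`IsChangeOfVariable.exists_trajectory`). With the gap estimates and backward uniqueness this shows
that `φ(t, x, ·)` is injective and tends to the bottom and to the surface as `λ` tends to `0` and
`1`, so that `H = ∂_λ φ` is nonnegative with integral `η - zb`
(`IsChangeOfVariable.integral_deriv`). Comparing the difference quotients of `φ` in `λ` with those
of `φ₀` gives the continuity of `H` at time zero (`IsChangeOfVariable.abs_deriv_sub_le`). The
equations are then the chain rule: `IsChangeOfVariable.mass` differentiates the transport equation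
in `λ` and uses incompressibility, and `IsChangeOfVariable.material_deriv` identifies the material
derivative of the velocity in the new variables.
-/

namespace HydroEuler

open Set Filter Topology

/-! ### Ordinary differential equations on an interval -/

section

/-- A form of Grönwall's inequality in which nothing is assumed about the derivative at the two
end points. -/
theorem norm_le_exp_of_norm_deriv_le {E : Type*} [NormedAddCommGroup E] [NormedSpace ℝ E]
    {f f' : ℝ → E} {K ε a b : ℝ} (hK : 0 ≤ K) (hε : 0 ≤ ε) (hf : ContinuousOn f (Icc a b))
    (hf' : ∀ t ∈ Ioo a b, HasDerivAt f (f' t) t)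
    (bound : ∀ t ∈ Ioo a b, ‖f' t‖ ≤ K * ‖f t‖ + ε) {x : ℝ} (hx : x ∈ Icc a b) :
    ‖f x‖ ≤ (‖f a‖ + ε * (x - a)) * Real.exp (K * (x - a)) := by
  rcases hx.1.eq_or_lt with rfl | hax
  · simp
  -- the inequality started from an interior time `y`, which is then sent to `a`
  have key : ∀ y ∈ Ioo a x, ‖f x‖ ≤ (‖f y‖ + ε * (x - y)) * Real.exp (K * (x - y)) := by
    intro y hy
    have h1 := norm_le_gronwallBound_of_norm_deriv_right_le (f := f) (f' := f') (δ := ‖f y‖)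
      (K := K) (ε := ε) (a := y) (b := x) (hf.mono (Icc_subset_Icc hy.1.le hx.2))
      (fun t ht => (hf' t ⟨hy.1.trans_le ht.1, ht.2.trans_le hx.2⟩).hasDerivWithinAt) le_rfl
      (fun t ht => bound t ⟨hy.1.trans_le ht.1, ht.2.trans_le hx.2⟩) x ⟨hy.2.le, le_rfl⟩
    refine h1.trans ?_
    have hxy : 0 ≤ x - y := sub_nonneg.2 hy.2.le
    rcases hK.eq_or_lt with rfl | hK
    · simp [gronwallBound_K0]
    · rw [gronwallBound_of_K_ne_0 hK.ne', add_mul]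
      have h2 : Real.exp (K * (x - y)) - 1 ≤ K * (x - y) * Real.exp (K * (x - y)) := by
        have h3 := Real.add_one_le_exp (-(K * (x - y)))
        have h4 := Real.exp_pos (K * (x - y))
        have h5 : Real.exp (-(K * (x - y))) * Real.exp (K * (x - y)) = 1 := by
          rw [← Real.exp_add]; simp
        nlinarith
      have h6 : ε / K * (Real.exp (K * (x - y)) - 1)
          ≤ ε / K * (K * (x - y) * Real.exp (K * (x - y))) := by gcongr
      have h7 : ε / K * (K * (x - y) * Real.exp (K * (x - y)))
          = ε * (x - y) * Real.exp (K * (x - y)) := by field_simp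
      linarith
  have hcont : ContinuousWithinAt
      (fun y => (‖f y‖ + ε * (x - y)) * Real.exp (K * (x - y))) (Ioo a x) a := by
    have h1 : ContinuousWithinAt f (Ioo a x) a :=
      (hf a ⟨le_rfl, hx.1.trans hx.2⟩).mono fun y hy => ⟨hy.1.le, hy.2.le.trans hx.2⟩
    have h2 : Continuous fun y : ℝ => ε * (x - y) := by fun_prop
    have h3 : Continuous fun y : ℝ => Real.exp (K * (x - y)) := by fun_prop
    exact (h1.norm.add h2.continuousWithinAt).mul h3.continuousWithinAt
  have : (𝓝[Ioo a x] a).NeBot := by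
    rw [← mem_closure_iff_nhdsWithin_neBot, closure_Ioo hax.ne]
    exact ⟨le_rfl, hax.le⟩
  exact ge_of_tendsto hcont (eventually_mem_nhdsWithin.mono key)

/-- Grönwall's inequality for `‖f'‖ ≤ K ‖f‖`, forward and backward in time. -/
theorem norm_le_exp_abs_of_norm_deriv_le {E : Type*} [NormedAddCommGroup E] [NormedSpace ℝ E]
    {f f' : ℝ → E} {K a b : ℝ} (hK : 0 ≤ K) (hf : ContinuousOn f (Icc a b))
    (hf' : ∀ t ∈ Ioo a b, HasDerivAt f (f' t) t)
    (bound : ∀ t ∈ Ioo a b, ‖f' t‖ ≤ K * ‖f t‖) {x y : ℝ} (hx : x ∈ Icc a b) (hy : y ∈ Icc a b) :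
    ‖f x‖ ≤ ‖f y‖ * Real.exp (K * |x - y|) := by
  rcases le_total y x with h | h
  · have := norm_le_exp_of_norm_deriv_le (f := f) (f' := f') (K := K) (ε := 0) (a := y) (b := b)
      hK le_rfl (hf.mono (Icc_subset_Icc hy.1 le_rfl))
      (fun t ht => hf' t ⟨hy.1.trans_lt ht.1, ht.2⟩)
      (fun t ht => by simpa using bound t ⟨hy.1.trans_lt ht.1, ht.2⟩) ⟨h, hx.2⟩
    simpa [abs_of_nonneg (sub_nonneg.2 h)] using this
  · have hm : ∀ t ∈ Icc (-y) (-a), -t ∈ Icc a b := fun t ht =>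
      ⟨by linarith [ht.2], by linarith [ht.1, hy.2]⟩
    have hm' : ∀ t ∈ Ioo (-y) (-a), -t ∈ Ioo a b := fun t ht =>
      ⟨by linarith [ht.2], by linarith [ht.1, hy.2]⟩
    have := norm_le_exp_of_norm_deriv_le (f := fun t => f (-t)) (f' := fun t => -f' (-t))
      (K := K) (ε := 0) (a := -y) (b := -a) hK le_rfl
      (hf.comp continuous_neg.continuousOn hm)
      (fun t ht => by
        simpa using! (hf' (-t) (hm' t ht)).scomp t (hasDerivAt_neg t))
      (fun t ht => by simpa using bound (-t) (hm' t ht)) (x := -x) ⟨by linarith, by linarith [hx.1]⟩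
    rw [abs_sub_comm, abs_of_nonneg (sub_nonneg.2 h)]
    simpa [neg_add_eq_sub] using this

/-- The mean value inequality on `[a, b]` for a function differentiable on `(a, b)`. -/
theorem norm_sub_le_of_norm_deriv_le {E : Type*} [NormedAddCommGroup E] [NormedSpace ℝ E]
    {f f' : ℝ → E} {ε a b : ℝ} (hε : 0 ≤ ε) (hf : ContinuousOn f (Icc a b))
    (hf' : ∀ t ∈ Ioo a b, HasDerivAt f (f' t) t)
    (bound : ∀ t ∈ Ioo a b, ‖f' t‖ ≤ ε) {x y : ℝ} (hx : x ∈ Icc a b) (hy : y ∈ Icc a b) :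
    ‖f x - f y‖ ≤ ε * |x - y| := by
  wlog h : y ≤ x generalizing x y
  · rw [norm_sub_rev, abs_sub_comm]; exact this hy hx (le_of_not_ge h)
  have := norm_le_exp_of_norm_deriv_le (f := fun t => f t - f y) (f' := f') (K := 0) (ε := ε)
    (a := y) (b := b) le_rfl hε ((hf.mono (Icc_subset_Icc hy.1 le_rfl)).sub continuousOn_const)
    (fun t ht => (hf' t ⟨hy.1.trans_lt ht.1, ht.2⟩).sub_const _)
    (fun t ht => by simpa using bound t ⟨hy.1.trans_lt ht.1, ht.2⟩) ⟨h, hx.2⟩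
  simpa [abs_of_nonneg (sub_nonneg.2 h)] using this

/-- A continuous, bounded and Lipschitz vector field has global solutions, through any point. -/
theorem exists_solution_of_bounded_lipschitz {E : Type*} [NormedAddCommGroup E] [NormedSpace ℝ E]
    [CompleteSpace E] {f : ℝ → E → E} {T M K : ℝ} (hM : 0 ≤ M) (hK : 0 ≤ K)
    (hcont : ∀ y, ContinuousOn (fun t => f t y) (Icc 0 T))
    (hbd : ∀ t ∈ Icc 0 T, ∀ y, ‖f t y‖ ≤ M)
    (hlip : ∀ t ∈ Icc 0 T, ∀ y y', ‖f t y - f t y'‖ ≤ K * ‖y - y'‖)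
    {t₀ : ℝ} (ht₀ : t₀ ∈ Icc 0 T) (y₀ : E) :
    ∃ Y : ℝ → E, Y t₀ = y₀ ∧ ContinuousOn Y (Icc 0 T) ∧
      ∀ t ∈ Ioo 0 T, HasDerivAt Y (f t (Y t)) t := by
  have hT : 0 ≤ T := ht₀.1.trans ht₀.2
  have hP : IsPicardLindelof f (tmin := 0) (tmax := T) ⟨t₀, ht₀⟩ y₀
      (⟨M * T, by positivity⟩) 0 ⟨M, hM⟩ ⟨K, hK⟩ := by
    refine ⟨fun t ht => ?_, fun y _ => hcont y, fun t ht y _ => hbd t ht y, ?_⟩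
    · refine LipschitzOnWith.of_dist_le_mul fun y _ y' _ => ?_
      rw [dist_eq_norm, dist_eq_norm]
      exact hlip t ht y y'
    · have : max (T - t₀) (t₀ - 0) ≤ T :=
        max_le (by linarith [ht₀.1]) (by linarith [ht₀.2])
      have h2 : M * max (T - t₀) (t₀ - 0) ≤ M * T := by gcongr
      change M * max (T - t₀) (t₀ - 0) ≤ M * T - ((0 : NNReal) : ℝ)
      simpa only [NNReal.coe_zero, sub_zero] using h2
  obtain ⟨Y, hY0, hY⟩ := hP.exists_eq_forall_mem_Icc_hasDerivWithinAt₀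
  exact ⟨Y, hY0, fun t ht => (hY t ht).continuousWithinAt,
    fun t ht => (hY t ⟨ht.1.le, ht.2.le⟩).hasDerivAt (Icc_mem_nhds ht.1 ht.2)⟩

/-- Radial cut-off: the identity on the ball of radius `R`, zero outside the ball of radius
`2 * R`. -/
noncomputable def radialCutoff {F : Type*} [NormedAddCommGroup F] [NormedSpace ℝ F] (R : ℝ)
    (a : F) : F :=
  max 0 (min 1 (2 - ‖a‖ / R)) • a

section radialCutoff

variable {F : Type*} [NormedAddCommGroup F] [NormedSpace ℝ F] {R : ℝ}

theorem radialCutoff_eq_self (hR : 0 < R) {a : F} (ha : ‖a‖ ≤ R) : radialCutoff R a = a := by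
  have h1 : ‖a‖ / R ≤ 1 := (div_le_one hR).2 ha
  rw [radialCutoff, min_eq_left (by linarith), max_eq_right zero_le_one, one_smul]

theorem radialCutoff_eq_zero (hR : 0 < R) {a : F} (ha : 2 * R ≤ ‖a‖) : radialCutoff R a = 0 := by
  have h1 : 2 ≤ ‖a‖ / R := (le_div_iff₀ hR).2 ha
  rw [radialCutoff, max_eq_left ((min_le_right _ _).trans (by linarith)), zero_smul]

theorem norm_radialCutoff_le_norm (a : F) : ‖radialCutoff R a‖ ≤ ‖a‖ := by
  rw [radialCutoff, norm_smul, Real.norm_of_nonneg (le_max_left _ _)]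
  exact mul_le_of_le_one_left (norm_nonneg _) (max_le zero_le_one (min_le_left _ _))

theorem norm_radialCutoff_le (hR : 0 < R) (a : F) : ‖radialCutoff R a‖ ≤ 2 * R := by
  rcases le_total ‖a‖ (2 * R) with h | h
  · exact (norm_radialCutoff_le_norm a).trans h
  · rw [radialCutoff_eq_zero hR h, norm_zero]; positivity

theorem norm_radialCutoff_sub_le (hR : 0 < R) (a b : F) :
    ‖radialCutoff R a - radialCutoff R b‖ ≤ 3 * ‖a - b‖ := by
  wlog hab : ‖b‖ ≤ ‖a‖ generalizing a b
  · rw [norm_sub_rev, norm_sub_rev a]; exact this b a (le_of_not_ge hab)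
  rcases le_total (2 * R) ‖b‖ with h | h
  · rw [radialCutoff_eq_zero hR h, radialCutoff_eq_zero hR (h.trans hab)]
    simp
  · set χ : F → ℝ := fun a => max 0 (min 1 (2 - ‖a‖ / R)) with hχ
    have h1 : radialCutoff R a - radialCutoff R b = χ a • (a - b) + (χ a - χ b) • b := by
      simp only [radialCutoff, hχ]; module
    have h2 : |χ a| ≤ 1 := by
      rw [abs_of_nonneg (le_max_left _ _)]; exact max_le zero_le_one (min_le_left _ _)
    have h3 : |χ a - χ b| ≤ ‖a - b‖ / R := by
      refine (abs_max_sub_max_le_max _ _ _ _).trans (max_le (by simp; positivity) ?_)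
      refine (abs_min_sub_min_le_max _ _ _ _).trans (max_le (by simp; positivity) ?_)
      have : 2 - ‖a‖ / R - (2 - ‖b‖ / R) = (‖b‖ - ‖a‖) / R := by ring
      rw [this, abs_div, abs_of_pos hR]
      gcongr
      rw [norm_sub_rev]
      exact abs_norm_sub_norm_le _ _
    calc ‖radialCutoff R a - radialCutoff R b‖
        ≤ |χ a| * ‖a - b‖ + |χ a - χ b| * ‖b‖ := by
          rw [h1]; exact (norm_add_le _ _).trans (by simp [norm_smul])
      _ ≤ 1 * ‖a - b‖ + ‖a - b‖ / R * (2 * R) := by gcongr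
      _ = 3 * ‖a - b‖ := by field_simp; ring

end radialCutoff

/-- The resolvent of a linear equation `S' = B(t) S`. The coefficient is bounded and continuous
for positive times, but need not have a limit at time zero. -/
theorem exists_resolvent {E : Type*} [NormedAddCommGroup E] [NormedSpace ℝ E]
    [CompleteSpace E] {B : ℝ → E →L[ℝ] E} {T C : ℝ} (hT : 0 < T) (hC : 0 ≤ C)
    (hB : ContinuousOn B (Ioc 0 T)) (hBC : ∀ t ∈ Ioc 0 T, ‖B t‖ ≤ C) :
    ∃ S : ℝ → E →L[ℝ] E, S 0 = 1 ∧ ContinuousOn S (Icc 0 T) ∧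
      (∀ t ∈ Ioo 0 T, HasDerivAt S (B t ∘L S t) t) ∧
      ∀ t ∈ Icc 0 T, ‖S t‖ ≤ Real.exp (C * T) := by
  set R : ℝ := Real.exp (C * T) with hR
  have hR0 : 0 < R := Real.exp_pos _
  set T' := Real.sqrt T with hT'
  have hT'0 : 0 < T' := Real.sqrt_pos.2 hT
  have hsq : ∀ τ ∈ Icc 0 T', τ ≠ 0 → τ ^ 2 ∈ Ioc 0 T := fun τ hτ h0 =>
    ⟨by positivity, by
      have := pow_le_pow_left₀ hτ.1 hτ.2 2
      rwa [hT', Real.sq_sqrt hT.le] at this⟩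
  -- in the time `τ` with `t = τ ^ 2` the coefficient `2 τ B(τ ^ 2)` is continuous up to `τ = 0`
  let g : ℝ → (E →L[ℝ] E) → (E →L[ℝ] E) := fun τ a =>
    (2 * τ) • (B (τ ^ 2) ∘L radialCutoff R a)
  have hg : ∀ τ ∈ Icc 0 T', ∀ a b : E →L[ℝ] E,
      ‖(2 * τ) • (B (τ ^ 2) ∘L a) - (2 * τ) • (B (τ ^ 2) ∘L b)‖ ≤ 2 * τ * C * ‖a - b‖ := by
    intro τ hτ a b
    rcases eq_or_ne τ 0 with rfl | h0
    · simp
    · rw [← smul_sub, ← ContinuousLinearMap.comp_sub, norm_smul, mul_assoc,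
        Real.norm_of_nonneg (by linarith [hτ.1])]
      have h1 := hτ.1
      gcongr
      exact (ContinuousLinearMap.opNorm_comp_le _ _).trans
        (by gcongr; exact hBC _ (hsq τ hτ h0))
  obtain ⟨Z, hZ0, hZc, hZd⟩ := exists_solution_of_bounded_lipschitz (f := g) (T := T')
    (M := 2 * T' * C * (2 * R)) (K := 2 * T' * C * 3) (by positivity) (by positivity)
    (by
      intro a τ hτ
      rcases eq_or_ne τ 0 with rfl | h0
      · have h1 : Tendsto (fun τ : ℝ => 2 * τ * C * ‖radialCutoff R a‖) (𝓝[Icc 0 T'] 0)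
            (𝓝 0) := by
          have : Continuous fun τ : ℝ => 2 * τ * C * ‖radialCutoff R a‖ := by fun_prop
          simpa [ContinuousWithinAt] using this.continuousWithinAt (s := Icc 0 T') (x := 0)
        have h2 : Tendsto (fun τ => g τ a) (𝓝[Icc 0 T'] 0) (𝓝 0) :=
          squeeze_zero_norm' (eventually_mem_nhdsWithin.mono fun τ hτ => by
            simpa [g] using hg τ hτ (radialCutoff R a) 0) h1
        simpa [ContinuousWithinAt, g] using h2
      · have h1 : ContinuousAt (fun τ : ℝ => τ ^ 2) τ := by fun_prop
        have hpos : 0 < τ := lt_of_le_of_ne hτ.1 (Ne.symm h0)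
        have h2 : ContinuousWithinAt (fun τ => B (τ ^ 2)) (Ioc 0 T') τ :=
          ContinuousWithinAt.comp (f := fun τ : ℝ => τ ^ 2) (hB _ (hsq τ hτ h0))
            h1.continuousWithinAt
            fun σ hσ => hsq σ ⟨hσ.1.le, hσ.2⟩ hσ.1.ne'
        have h3 : ContinuousWithinAt (fun τ => B (τ ^ 2)) (Icc 0 T') τ := by
          refine h2.mono_of_mem_nhdsWithin ?_
          filter_upwards [self_mem_nhdsWithin, mem_nhdsWithin_of_mem_nhds (Ioi_mem_nhds hpos)]
            with σ h4 h5 using ⟨h5, h4.2⟩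
        exact (continuousWithinAt_const.mul continuousWithinAt_id).smul
          (h3.clm_comp continuousWithinAt_const))
    (by
      intro τ hτ a
      have h1 := hg τ hτ (radialCutoff R a) 0
      have h2 : ‖g τ a‖ ≤ 2 * τ * C * ‖radialCutoff R a‖ := by simpa [g] using h1
      refine h2.trans ?_
      have := hτ.1
      gcongr
      · exact hτ.2
      · exact norm_radialCutoff_le hR0 a)
    (by
      intro τ hτ a b
      refine (hg τ hτ _ _).trans ?_
      rw [mul_assoc (2 * T' * C)]
      have := hτ.1
      gcongr
      · exact hτ.2
      · exact norm_radialCutoff_sub_le hR0 a b)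
    (t₀ := 0) ⟨le_rfl, hT'0.le⟩ (1 : E →L[ℝ] E)
  have hst : ∀ t ∈ Icc 0 T, Real.sqrt t ∈ Icc 0 T' := fun t ht =>
    ⟨Real.sqrt_nonneg _, Real.sqrt_le_sqrt ht.2⟩
  have hst' : ∀ t ∈ Ioo 0 T, Real.sqrt t ∈ Ioo 0 T' := fun t ht =>
    ⟨Real.sqrt_pos.2 ht.1, Real.sqrt_lt_sqrt ht.1.le ht.2⟩
  have hSc : ContinuousOn (fun t => Z (Real.sqrt t)) (Icc 0 T) :=
    hZc.comp Real.continuous_sqrt.continuousOn hst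
  have hSd : ∀ t ∈ Ioo 0 T, HasDerivAt (fun t => Z (Real.sqrt t))
      (B t ∘L radialCutoff R (Z (Real.sqrt t))) t := by
    intro t ht
    have h1 := (hZd _ (hst' t ht)).scomp t (Real.hasDerivAt_sqrt ht.1.ne')
    convert! h1 using 1
    simp only [g]
    rw [Real.sq_sqrt ht.1.le, smul_smul]
    have : 0 < Real.sqrt t := (hst' t ht).1
    rw [show 1 / (2 * Real.sqrt t) * (2 * Real.sqrt t) = 1 by field_simp, one_smul]
  have hSb : ∀ t ∈ Icc 0 T, ‖Z (Real.sqrt t)‖ ≤ R := by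
    intro t ht
    have h1 := norm_le_exp_of_norm_deriv_le (f := fun t => Z (Real.sqrt t)) hC le_rfl hSc hSd
      (fun t ht => by
        rw [add_zero]
        refine (ContinuousLinearMap.opNorm_comp_le _ _).trans ?_
        gcongr
        · exact hBC t ⟨ht.1, ht.2.le⟩
        · exact norm_radialCutoff_le_norm _) ht
    simp only [Real.sqrt_zero, hZ0, zero_mul, add_zero, sub_zero] at h1
    have h2 : ‖(1 : E →L[ℝ] E)‖ ≤ 1 := ContinuousLinearMap.norm_id_le
    refine h1.trans ((mul_le_of_le_one_left (Real.exp_pos _).le h2).trans ?_)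
    rw [hR]
    gcongr
    exact ht.2
  refine ⟨fun t => Z (Real.sqrt t), by simp [hZ0], hSc, fun t ht => ?_, hSb⟩
  have := hSd t ht
  rwa [radialCutoff_eq_self hR0 (hSb t ⟨ht.1.le, ht.2.le⟩)] at this

end

/-! ### Functions with bounded derivatives -/

section HasBddDerivs

variable {X : Type} [NormedAddCommGroup X] [NormedSpace ℝ X]
  {F : Type} [NormedAddCommGroup F] [NormedSpace ℝ F]
  {G : Type} [NormedAddCommGroup G] [NormedSpace ℝ G] {U : Set X} {n : ℕ}

/-- The class `C_b^n(U)`, for `U` open, described by recursion on `n` through the Fréchet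
derivative. The target space changes in the recursion, so that all spaces are kept in one
universe. -/
def HasBddDerivs {X : Type} [NormedAddCommGroup X] [NormedSpace ℝ X] (U : Set X) :
    (n : ℕ) → {F : Type} → [NormedAddCommGroup F] → [NormedSpace ℝ F] → (X → F) → Prop
  | 0, _, _, _, f => (∃ C : ℝ, ∀ p ∈ U, ‖f p‖ ≤ C) ∧ ContinuousOn f U
  | n + 1, _, _, _, f => (∃ C : ℝ, ∀ p ∈ U, ‖f p‖ ≤ C) ∧ (∀ p ∈ U, DifferentiableAt ℝ f p) ∧
      HasBddDerivs U n (fderiv ℝ f)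

namespace HasBddDerivs

theorem bounded {f : X → F} (h : HasBddDerivs U n f) : ∃ C : ℝ, ∀ p ∈ U, ‖f p‖ ≤ C := by
  cases n <;> exact h.1

theorem continuousOn {f : X → F} (h : HasBddDerivs U n f) : ContinuousOn f U := by
  cases n with
  | zero => exact h.2
  | succ n => exact fun p hp => (h.2.1 p hp).continuousAt.continuousWithinAt

theorem of_succ {f : X → F} (h : HasBddDerivs U (n + 1) f) : HasBddDerivs U n f := by
  induction n generalizing F with
  | zero => exact ⟨h.1, h.continuousOn⟩
  | succ n ih => exact ⟨h.1, h.2.1, ih h.2.2⟩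

theorem congr (hU : IsOpen U) {f g : X → F} (h : HasBddDerivs U n f) (hfg : EqOn f g U) :
    HasBddDerivs U n g := by
  have hb : ∃ C : ℝ, ∀ p ∈ U, ‖g p‖ ≤ C :=
    h.bounded.imp fun C hC p hp => hfg hp ▸ hC p hp
  induction n generalizing F with
  | zero => exact ⟨hb, h.2.congr fun p hp => (hfg hp).symm⟩
  | succ n ih =>
    have he : ∀ p ∈ U, f =ᶠ[𝓝 p] g := fun p hp => hfg.eventuallyEq_of_mem (hU.mem_nhds hp)
    have h3 : EqOn (fderiv ℝ f) (fderiv ℝ g) U := fun p hp => (he p hp).fderiv_eq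
    exact ⟨hb, fun p hp => (he p hp).differentiableAt_iff.1 (h.2.1 p hp),
      ih h.2.2 h3 (h.2.2.bounded.imp fun C hC p hp => h3 hp ▸ hC p hp)⟩

theorem contDiffOn (hU : IsOpen U) {f : X → F} (h : HasBddDerivs U n f) : ContDiffOn ℝ n f U := by
  induction n generalizing F with
  | zero => exact contDiffOn_zero.2 h.continuousOn
  | succ n ih =>
    rw [Nat.cast_succ, contDiffOn_succ_iff_fderiv_of_isOpen hU]
    exact ⟨fun p hp => (h.2.1 p hp).differentiableWithinAt, by simp, ih h.2.2⟩

theorem of_isCb (hU : IsOpen U) {f : X → F} (h : IsCb n U f) : HasBddDerivs U n f := by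
  induction n generalizing F with
  | zero =>
    obtain ⟨C, hC⟩ := h.2 0 le_rfl
    exact ⟨⟨C, fun p hp => by simpa using hC p hp⟩, h.1.continuousOn⟩
  | succ n ih =>
    obtain ⟨C, hC⟩ := h.2 0 (Nat.zero_le _)
    have h1 := h.1
    rw [Nat.cast_succ, contDiffOn_succ_iff_fderiv_of_isOpen hU] at h1
    refine ⟨⟨C, fun p hp => by simpa using hC p hp⟩,
      fun p hp => h1.1.differentiableAt (hU.mem_nhds hp), ih ⟨h1.2.2, fun k hk => ?_⟩⟩
    obtain ⟨C, hC⟩ := h.2 (k + 1) (by omega)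
    refine ⟨C, fun p hp => ?_⟩
    have h2 : iteratedFDerivWithin ℝ k (fderiv ℝ f) U p
        = iteratedFDerivWithin ℝ k (fderivWithin ℝ f U) U p :=
      iteratedFDerivWithin_congr (fun q hq => (fderivWithin_of_isOpen hU hq).symm) hp k
    rw [h2, norm_iteratedFDerivWithin_fderivWithin hU.uniqueDiffOn hp]
    exact hC p hp

theorem mono {V : Set X} (hVU : V ⊆ U) {f : X → F} (h : HasBddDerivs U n f) :
    HasBddDerivs V n f := by
  induction n generalizing F with
  | zero => exact ⟨h.1.imp fun C hC p hp => hC p (hVU hp), h.2.mono hVU⟩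
  | succ n ih =>
    exact ⟨h.1.imp fun C hC p hp => hC p (hVU hp), fun p hp => h.2.1 p (hVU hp), ih h.2.2⟩

theorem add (hU : IsOpen U) {f g : X → F} (hf : HasBddDerivs U n f) (hg : HasBddDerivs U n g) :
    HasBddDerivs U n (fun p => f p + g p) := by
  have hb : ∃ C : ℝ, ∀ p ∈ U, ‖f p + g p‖ ≤ C := by
    obtain ⟨C, hC⟩ := hf.bounded
    obtain ⟨D, hD⟩ := hg.bounded
    exact ⟨C + D, fun p hp => (norm_add_le _ _).trans (add_le_add (hC p hp) (hD p hp))⟩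
  induction n generalizing F with
  | zero => exact ⟨hb, hf.2.add hg.2⟩
  | succ n ih =>
    refine ⟨hb, fun p hp => (hf.2.1 p hp).add (hg.2.1 p hp), ?_⟩
    obtain ⟨C, hC⟩ := hf.2.2.bounded
    obtain ⟨D, hD⟩ := hg.2.2.bounded
    exact (ih hf.2.2 hg.2.2 ⟨C + D, fun p hp => (norm_add_le _ _).trans
      (add_le_add (hC p hp) (hD p hp))⟩).congr hU
      fun p hp => (fderiv_add (hf.2.1 p hp) (hg.2.1 p hp)).symm

theorem clm_apply (hU : IsOpen U) {f : X → F} (hf : HasBddDerivs U n f) (L : F →L[ℝ] G) :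
    HasBddDerivs U n (fun p => L (f p)) := by
  have hb : ∃ C : ℝ, ∀ p ∈ U, ‖L (f p)‖ ≤ C := by
    obtain ⟨C, hC⟩ := hf.bounded
    exact ⟨‖L‖ * C, fun p hp => (L.le_opNorm _).trans (by gcongr; exact hC p hp)⟩
  induction n generalizing F G with
  | zero => exact ⟨hb, L.continuous.comp_continuousOn hf.2⟩
  | succ n ih =>
    refine ⟨hb, fun p hp => L.differentiableAt.comp p (hf.2.1 p hp), ?_⟩
    obtain ⟨C, hC⟩ := hf.2.2.bounded
    refine (ih hf.2.2 (ContinuousLinearMap.compL ℝ X F G L) ⟨‖L‖ * C, fun p hp =>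
      (ContinuousLinearMap.opNorm_comp_le _ _).trans (by gcongr; exact hC p hp)⟩).congr hU ?_
    intro p hp
    exact (L.hasFDerivAt.comp p (hf.2.1 p hp).hasFDerivAt).fderiv.symm

theorem comp_clm {X' : Type} [NormedAddCommGroup X'] [NormedSpace ℝ X'] (hU : IsOpen U)
    {f : X → F} (hf : HasBddDerivs U n f) (L : X' →L[ℝ] X) :
    HasBddDerivs (L ⁻¹' U) n (fun p => f (L p)) := by
  induction n generalizing F with
  | zero =>
    exact ⟨hf.1.imp fun C hC p hp => hC _ hp, hf.2.comp L.continuous.continuousOn fun _ h => h⟩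
  | succ n ih =>
    refine ⟨hf.1.imp fun C hC p hp => hC _ hp,
      fun p hp => (hf.2.1 _ hp).comp p L.differentiableAt, ?_⟩
    refine ((ih hf.2.2).clm_apply (hU.preimage L.continuous)
      ((ContinuousLinearMap.compL ℝ X' X F).flip L)).congr (hU.preimage L.continuous) ?_
    intro p hp
    exact ((hf.2.1 _ hp).hasFDerivAt.comp p L.hasFDerivAt).fderiv.symm

theorem bilin {H : Type} [NormedAddCommGroup H] [NormedSpace ℝ H] (hU : IsOpen U)
    (B : F →L[ℝ] G →L[ℝ] H) {f : X → F} {g : X → G} (hf : HasBddDerivs U n f)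
    (hg : HasBddDerivs U n g) : HasBddDerivs U n (fun p => B (f p) (g p)) := by
  have hb : ∃ C : ℝ, ∀ p ∈ U, ‖B (f p) (g p)‖ ≤ C := by
    obtain ⟨C, hC⟩ := hf.bounded
    obtain ⟨D, hD⟩ := hg.bounded
    refine ⟨‖B‖ * C * D, fun p hp => (B.le_opNorm₂ _ _).trans ?_⟩
    have := (norm_nonneg _).trans (hC p hp)
    gcongr
    exacts [hC p hp, hD p hp]
  induction n generalizing F G H with
  | zero => exact ⟨hb, (B.continuous.comp_continuousOn hf.2).clm_apply hg.2⟩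
  | succ n ih =>
    have hd : ∀ p ∈ U, HasFDerivAt (fun p => B (f p) (g p))
        (B.precompR X (f p) (fderiv ℝ g p) + B.precompL X (fderiv ℝ f p) (g p)) p :=
      fun p hp => B.hasFDerivAt_of_bilinear (hf.2.1 p hp).hasFDerivAt (hg.2.1 p hp).hasFDerivAt
    refine ⟨hb, fun p hp => (hd p hp).differentiableAt, ?_⟩
    have aux : ∀ {F G H : Type} [NormedAddCommGroup F] [NormedSpace ℝ F] [NormedAddCommGroup G]
        [NormedSpace ℝ G] [NormedAddCommGroup H] [NormedSpace ℝ H] (B : F →L[ℝ] G →L[ℝ] H)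
        {f : X → F} {g : X → G}, HasBddDerivs U n f → HasBddDerivs U n g →
        HasBddDerivs U n (fun p => B (f p) (g p)) := by
      intro F G H _ _ _ _ _ _ B f g hf hg
      obtain ⟨C, hC⟩ := hf.bounded
      obtain ⟨D, hD⟩ := hg.bounded
      refine ih B hf hg ⟨‖B‖ * C * D, fun p hp => (B.le_opNorm₂ _ _).trans ?_⟩
      have := (norm_nonneg _).trans (hC p hp)
      gcongr
      exacts [hC p hp, hD p hp]
    exact ((aux (B.precompR X) hf.of_succ hg.2.2).add hU
      (aux (B.precompL X) hf.2.2 hg.of_succ)).congr hU fun p hp => (hd p hp).fderiv.symm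

theorem const (hU : IsOpen U) (c : F) : HasBddDerivs U n (fun _ : X => c) := by
  induction n generalizing F with
  | zero => exact ⟨⟨‖c‖, fun _ _ => le_rfl⟩, continuousOn_const⟩
  | succ n ih =>
    exact ⟨⟨‖c‖, fun _ _ => le_rfl⟩, fun p _ => differentiableAt_const c,
      (ih (0 : X →L[ℝ] F)).congr hU fun p _ => by simp⟩

theorem clm (hU : IsOpen U) (L : X →L[ℝ] F) {C : ℝ} (hC : ∀ p ∈ U, ‖L p‖ ≤ C) :
    HasBddDerivs U n (fun p => L p) := by
  cases n with
  | zero => exact ⟨⟨C, hC⟩, L.continuous.continuousOn⟩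
  | succ n =>
    exact ⟨⟨C, hC⟩, fun p _ => L.differentiableAt, (const hU L).congr hU fun p _ => by simp⟩

theorem prodMk (hU : IsOpen U) {f : X → F} {g : X → G} (hf : HasBddDerivs U n f)
    (hg : HasBddDerivs U n g) : HasBddDerivs U n (fun p => (f p, g p)) :=
  ((hf.clm_apply hU (.inl ℝ F G)).add hU (hg.clm_apply hU (.inr ℝ F G))).congr hU
    fun p _ => by simp

end HasBddDerivs

end HasBddDerivs

/-! ### Smooth dependence of flows on parameters -/

section Flow

variable {E : Type} [NormedAddCommGroup E] [NormedSpace ℝ E]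
  {P : Type}

/-- A derivative bound on `W` gives a Lipschitz bound, with a loss of at most the factor `c`, on
each time slice of `W`. This holds with `c = 1` if the slices are convex. -/
def HasLipschitzSlices (W : Set (ℝ × E)) (c : ℝ) : Prop :=
  ∀ (G : Type) [NormedAddCommGroup G] [NormedSpace ℝ G] (g : ℝ × E → G) (C : ℝ), 0 ≤ C →
    (∀ p ∈ W, DifferentiableAt ℝ g p) → (∀ p ∈ W, ‖fderiv ℝ g p‖ ≤ C) →
    ∀ t y y', (t, y) ∈ W → (t, y') ∈ W → ‖g (t, y) - g (t, y')‖ ≤ c * C * ‖y - y'‖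

/-- The derivative of `f(t, y)` in `y`. -/
noncomputable def spaceDeriv (f : ℝ × E → E) (p : ℝ × E) : E →L[ℝ] E :=
  fderiv ℝ f p ∘L .inr ℝ ℝ E

theorem norm_inr_le : ‖ContinuousLinearMap.inr ℝ ℝ E‖ ≤ 1 :=
  ContinuousLinearMap.opNorm_le_bound _ zero_le_one fun y => by simp [Prod.norm_def]

theorem norm_spaceDeriv_le {f : ℝ × E → E} {p : ℝ × E} {C : ℝ} (h : ‖fderiv ℝ f p‖ ≤ C) :
    ‖spaceDeriv f p‖ ≤ C :=
  (ContinuousLinearMap.opNorm_comp_le _ _).trans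
    ((mul_le_of_le_one_right (norm_nonneg _) norm_inr_le).trans h)

theorem hasFDerivAt_slice {f : ℝ × E → E} {t : ℝ} {y : E} (h : DifferentiableAt ℝ f (t, y)) :
    HasFDerivAt (fun y => f (t, y)) (spaceDeriv f (t, y)) y :=
  h.hasFDerivAt.comp y (hasFDerivAt_prodMk_right t y)

/-- A family `Y(·, p)`, `p ∈ Q`, of solutions on `[0, T]` of `y' = f(t, y)`; for positive times
they lie in the domain `W` of `f`. -/
structure IsFlow (T : ℝ) (W : Set (ℝ × E)) (f : ℝ × E → E) (Q : Set P) (Y : ℝ → P → E) :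
    Prop where
  cont : ∀ p ∈ Q, ContinuousOn (fun t => Y t p) (Icc 0 T)
  mem : ∀ p ∈ Q, ∀ t ∈ Ioc 0 T, (t, Y t p) ∈ W
  hasDerivAt : ∀ p ∈ Q, ∀ t ∈ Ioo 0 T, HasDerivAt (fun t => Y t p) (f (t, Y t p)) t

/-- The resolvents of the equation linearized along the solutions `Y(·, p)`. -/
structure IsResolvent (T C : ℝ) (f : ℝ × E → E) (Q : Set P) (Y : ℝ → P → E)
    (S : ℝ → P → E →L[ℝ] E) : Prop where
  zero : ∀ p ∈ Q, S 0 p = 1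
  cont : ∀ p ∈ Q, ContinuousOn (fun t => S t p) (Icc 0 T)
  hasDerivAt : ∀ p ∈ Q, ∀ t ∈ Ioo 0 T,
    HasDerivAt (fun t => S t p) (spaceDeriv f (t, Y t p) ∘L S t p) t
  norm_le : ∀ p ∈ Q, ∀ t ∈ Icc 0 T, ‖S t p‖ ≤ Real.exp (C * T)

theorem continuousOn_uncurry_of_eventually [TopologicalSpace P] {F : Type} [NormedAddCommGroup F]
    {T : ℝ} {Q : Set P}
    {Y : ℝ → P → F} (hc : ∀ p ∈ Q, ContinuousOn (fun t => Y t p) (Icc 0 T))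
    (he : ∀ p ∈ Q, ∀ κ > 0, ∀ᶠ p' in 𝓝 p, ∀ t ∈ Icc 0 T, ‖Y t p' - Y t p‖ ≤ κ) :
    ContinuousOn (fun q : ℝ × P => Y q.1 q.2) (Icc 0 T ×ˢ Q) := by
  rintro ⟨t, p⟩ ⟨ht, hp⟩
  rw [Metric.continuousWithinAt_iff']
  intro ε hε
  have h1 := Metric.continuousWithinAt_iff'.1 (hc p hp t ht) (ε / 2) (half_pos hε)
  have h2 := he p hp (ε / 3) (by positivity)
  rw [nhdsWithin_prod_eq]
  filter_upwards [(h1.prod_mk (mem_nhdsWithin_of_mem_nhds h2) :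
      ∀ᶠ q : ℝ × P in 𝓝[Icc 0 T] t ×ˢ 𝓝[Q] p, _ ∧ _),
    prod_mem_prod (self_mem_nhdsWithin (s := Icc 0 T)) (self_mem_nhdsWithin (s := Q))]
    with q h3 h4
  have h5 := h3.2 q.1 h4.1
  have h6 := h3.1
  rw [← dist_eq_norm] at h5
  calc dist (Y q.1 q.2) (Y t p) ≤ dist (Y q.1 q.2) (Y q.1 p) + dist (Y q.1 p) (Y t p) :=
        dist_triangle _ _ _
    _ < ε := by linarith

namespace IsFlow

variable {T c C : ℝ} {W : Set (ℝ × E)} {f : ℝ × E → E} {Q : Set P} {Y : ℝ → P → E}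

theorem norm_apply_sub_le (hY : IsFlow T W f Q Y) (hL : HasLipschitzSlices W c) (hc : 0 ≤ c)
    (hC : 0 ≤ C) (hfd : ∀ p ∈ W, DifferentiableAt ℝ f p) (hfC : ∀ p ∈ W, ‖fderiv ℝ f p‖ ≤ C)
    {p p' : P} (hp : p ∈ Q) (hp' : p' ∈ Q) {t : ℝ} (ht : t ∈ Icc 0 T) :
    ‖Y t p - Y t p'‖ ≤ ‖Y 0 p - Y 0 p'‖ * Real.exp (c * C * T) := by
  have h1 := norm_le_exp_of_norm_deriv_le (f := fun t => Y t p - Y t p') (K := c * C) (ε := 0)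
    (by positivity) le_rfl ((hY.cont p hp).sub (hY.cont p' hp'))
    (fun t ht => (hY.hasDerivAt p hp t ht).sub (hY.hasDerivAt p' hp' t ht))
    (fun t ht => by
      rw [add_zero]
      exact hL E f C hC hfd hfC t _ _ (hY.mem p hp t ⟨ht.1, ht.2.le⟩)
        (hY.mem p' hp' t ⟨ht.1, ht.2.le⟩)) ht
  refine h1.trans ?_
  simp only [zero_mul, add_zero, sub_zero]
  gcongr
  exact ht.2

/-- Away from time zero, `f` is uniformly differentiable in `y` along a solution. -/
theorem exists_uniform_tube (hY : IsFlow T W f Q Y) (hW : IsOpen W) (hf : ContDiffOn ℝ 1 f W)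
    {p : P} (hp : p ∈ Q) {ε κ : ℝ} (hε : 0 < ε) (hκ : 0 < κ) :
    ∃ ρ > 0, ∀ t ∈ Icc ε T, ∀ y', ‖y' - Y t p‖ < ρ →
      ‖spaceDeriv f (t, y') - spaceDeriv f (t, Y t p)‖ ≤ κ ∧
      ‖f (t, y') - f (t, Y t p) - spaceDeriv f (t, Y t p) (y' - Y t p)‖ ≤ κ * ‖y' - Y t p‖ := by
  set k : Set (ℝ × E) := (fun t => (t, Y t p)) '' Icc ε T with hk
  have hsub : Icc ε T ⊆ Icc 0 T := Icc_subset_Icc hε.le le_rfl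
  have hkc : IsCompact k :=
    isCompact_Icc.image_of_continuousOn (continuousOn_id.prodMk ((hY.cont p hp).mono hsub))
  have hkW : k ⊆ W := by
    rintro _ ⟨t, ht, rfl⟩
    exact hY.mem p hp t ⟨hε.trans_le ht.1, ht.2⟩
  have hcont : ∀ q ∈ W, ContinuousAt (fderiv ℝ f) q := fun q hq =>
    (hf.continuousOn_fderiv_of_isOpen hW le_rfl).continuousAt (hW.mem_nhds hq)
  obtain ⟨ρ₁, hρ₁, h1⟩ := Metric.mem_uniformity_dist.1
    (hkc.uniformContinuousAt_of_continuousAt (fderiv ℝ f) (fun q hq => hcont q (hkW hq))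
      (Metric.dist_mem_uniformity hκ))
  obtain ⟨ρ₂, hρ₂, h2⟩ := hkc.exists_thickening_subset_open hW hkW
  have hdist : ∀ t y, dist (t, Y t p) (t, y) = ‖y - Y t p‖ := fun t y => by
    simp [dist_eq_norm, norm_sub_rev]
  refine ⟨min ρ₁ ρ₂, lt_min hρ₁ hρ₂, fun t ht y' hy' => ?_⟩
  have hmem : (t, Y t p) ∈ k := ⟨t, ht, rfl⟩
  have h3 : ∀ y ∈ Metric.ball (Y t p) (min ρ₁ ρ₂), (t, y) ∈ W := fun y hy => by
    refine h2 (Metric.mem_thickening_iff.2 ⟨_, hmem, ?_⟩)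
    rw [dist_comm, hdist]
    exact (mem_ball_iff_norm.1 hy).trans_le (min_le_right _ _)
  have h4 : ∀ y ∈ Metric.ball (Y t p) (min ρ₁ ρ₂),
      ‖spaceDeriv f (t, y) - spaceDeriv f (t, Y t p)‖ ≤ κ := fun y hy => by
    have h5 : dist (fderiv ℝ f (t, Y t p)) (fderiv ℝ f (t, y)) < κ := by
      refine h1 ?_ hmem
      rw [hdist]
      exact (mem_ball_iff_norm.1 hy).trans_le (min_le_left _ _)
    rw [dist_comm, dist_eq_norm] at h5
    simp only [spaceDeriv]
    rw [← ContinuousLinearMap.sub_comp]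
    exact (ContinuousLinearMap.opNorm_comp_le _ _).trans
      ((mul_le_of_le_one_right (norm_nonneg _) norm_inr_le).trans h5.le)
  have hy'' : y' ∈ Metric.ball (Y t p) (min ρ₁ ρ₂) := mem_ball_iff_norm.2 hy'
  refine ⟨h4 y' hy'', ?_⟩
  exact (convex_ball (Y t p) (min ρ₁ ρ₂)).norm_image_sub_le_of_norm_hasFDerivWithin_le'
    (f := fun y => f (t, y))
    (fun y hy => (hasFDerivAt_slice ((hf.differentiableOn (by simp)).differentiableAt
      (hW.mem_nhds (h3 y hy)))).hasFDerivWithinAt) h4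
    (Metric.mem_ball_self (lt_min hρ₁ hρ₂)) hy''

theorem exists_isResolvent [CompleteSpace E] (hY : IsFlow T W f Q Y) (hT : 0 < T)
    (hW : IsOpen W) (hf : ContDiffOn ℝ 1 f W)
    (hC : 0 ≤ C) (hfC : ∀ p ∈ W, ‖fderiv ℝ f p‖ ≤ C) : ∃ S, IsResolvent T C f Q Y S := by
  have h1 : ∀ p ∈ Q, ∃ S : ℝ → E →L[ℝ] E, S 0 = 1 ∧ ContinuousOn S (Icc 0 T) ∧
      (∀ t ∈ Ioo 0 T, HasDerivAt S (spaceDeriv f (t, Y t p) ∘L S t) t) ∧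
      ∀ t ∈ Icc 0 T, ‖S t‖ ≤ Real.exp (C * T) := by
    intro p hp
    refine exists_resolvent (B := fun t => spaceDeriv f (t, Y t p)) hT hC ?_
      fun t ht => norm_spaceDeriv_le (hfC _ (hY.mem p hp t ht))
    have h2 : ContinuousOn (fun t => fderiv ℝ f (t, Y t p)) (Ioc 0 T) :=
      (hf.continuousOn_fderiv_of_isOpen hW le_rfl).comp
        (continuousOn_id.prodMk ((hY.cont p hp).mono Ioc_subset_Icc_self)) (hY.mem p hp)
    exact h2.clm_comp continuousOn_const
  choose! S h1 h2 h3 h4 using h1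
  exact ⟨fun t p => S p t, h1, h2, h3, h4⟩

variable [NormedAddCommGroup P]

/-- The solution is differentiable in the parameter. On a short initial interval `[0, ε]` the
remainder is estimated by the derivative bound only, and on `[ε, T]` by uniform
differentiability. -/
theorem hasFDerivAt_param [NormedSpace ℝ P] (hY : IsFlow T W f Q Y) (hW : IsOpen W)
    (hL : HasLipschitzSlices W c) (hc : 0 ≤ c) (hf : ContDiffOn ℝ 1 f W) (hC : 0 ≤ C)
    (hfC : ∀ p ∈ W, ‖fderiv ℝ f p‖ ≤ C) (hQ : IsOpen Q) {S : ℝ → P → E →L[ℝ] E}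
    (hS : IsResolvent T C f Q Y S) {p : P} (hp : p ∈ Q) {A : P →L[ℝ] E}
    (hA : HasFDerivAt (Y 0) A p) {t : ℝ} (ht : t ∈ Ioc 0 T) :
    HasFDerivAt (Y t) (S t p ∘L A) p := by
  have hfd : ∀ p ∈ W, DifferentiableAt ℝ f p := fun p hp =>
    (hf.differentiableOn (by simp)).differentiableAt (hW.mem_nhds hp)
  have hT : 0 < T := ht.1.trans_le ht.2
  set L : ℝ := (‖A‖ + 1) * Real.exp (c * C * T) with hLdef
  have hL0 : 0 < L := by positivity
  set C₂ : ℝ := c * C * L + C * (Real.exp (C * T) * ‖A‖) with hC₂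
  have hC₂0 : 0 ≤ C₂ := by positivity
  set N : ℝ := (2 + L * T) * Real.exp (C * T) with hN
  have hN0 : 0 < N := by positivity
  rw [hasFDerivAt_iff_isLittleO_nhds_zero, Asymptotics.isLittleO_iff]
  intro κ' hκ'
  set κ : ℝ := κ' / N with hκdef
  have hκ : 0 < κ := by positivity
  obtain ⟨ε, hε0, hεt, hεκ⟩ : ∃ ε, 0 < ε ∧ ε ≤ t ∧ C₂ * ε ≤ κ := by
    refine ⟨min t (κ / (C₂ + 1)), lt_min ht.1 (by positivity), min_le_left _ _, ?_⟩
    calc C₂ * min t (κ / (C₂ + 1)) ≤ (C₂ + 1) * (κ / (C₂ + 1)) := by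
          refine mul_le_mul (by linarith) (min_le_right _ _)
            (le_min ht.1.le (by positivity)) (by positivity)
      _ = κ := by field_simp
  obtain ⟨ρ, hρ, htube⟩ := hY.exists_uniform_tube hW hf hp hε0 hκ
  have hA1 := (Asymptotics.isLittleO_iff.1 (hasFDerivAt_iff_isLittleO_nhds_zero.1 hA))
    (lt_min one_pos hκ)
  have hpc : Tendsto (fun h : P => p + h) (𝓝 0) (𝓝 p) := by
    have : Continuous fun h : P => p + h := by fun_prop
    simpa using this.tendsto 0
  filter_upwards [hA1, hpc (hQ.mem_nhds hp), Metric.ball_mem_nhds (0 : P)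
    (show 0 < ρ / L by positivity)] with h h1 h2 h3
  have h2 : p + h ∈ Q := h2
  have h1κ : ‖Y 0 (p + h) - Y 0 p - A h‖ ≤ κ * ‖h‖ := h1.trans (by gcongr; exact min_le_right _ _)
  have h11 : ‖Y 0 (p + h) - Y 0 p‖ ≤ (‖A‖ + 1) * ‖h‖ := by
    have h5 : ‖Y 0 (p + h) - Y 0 p - A h‖ ≤ 1 * ‖h‖ :=
      h1.trans (by gcongr; exact min_le_left _ _)
    have h6 := norm_le_norm_sub_add (Y 0 (p + h) - Y 0 p) (A h)
    have h7 := A.le_opNorm h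
    linarith
  have hΔ : ∀ τ ∈ Icc 0 T, ‖Y τ (p + h) - Y τ p‖ ≤ L * ‖h‖ := fun τ hτ => by
    refine (hY.norm_apply_sub_le hL hc hC hfd hfC h2 hp hτ).trans ?_
    calc _ ≤ ((‖A‖ + 1) * ‖h‖) * Real.exp (c * C * T) := by gcongr
      _ = L * ‖h‖ := by rw [hLdef]; ring
  have hLh : L * ‖h‖ < ρ := by
    rw [mem_ball_zero_iff, lt_div_iff₀ hL0] at h3
    linarith
  -- the remainder along the solution
  set e : ℝ → E := fun τ => Y τ (p + h) - Y τ p - S τ p (A h) with he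
  have hec : ContinuousOn e (Icc 0 T) :=
    ((hY.cont _ h2).sub (hY.cont _ hp)).sub ((hS.cont p hp).clm_apply continuousOn_const)
  have hed : ∀ τ ∈ Ioo 0 T, HasDerivAt e (f (τ, Y τ (p + h)) - f (τ, Y τ p)
      - spaceDeriv f (τ, Y τ p) (S τ p (A h))) τ := fun τ hτ => by
    refine ((hY.hasDerivAt _ h2 τ hτ).sub (hY.hasDerivAt _ hp τ hτ)).sub ?_
    simpa using (hS.hasDerivAt p hp τ hτ).clm_apply (hasDerivAt_const τ (A h))
  have hmemT : ∀ {τ}, τ ∈ Ioo 0 T → τ ∈ Ioc 0 T := fun h => ⟨h.1, h.2.le⟩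
  have heε : ‖e ε‖ ≤ 2 * κ * ‖h‖ := by
    have h4 := norm_sub_le_of_norm_deriv_le (f := e) (ε := C₂ * ‖h‖) (a := 0) (b := T)
      (by positivity) hec hed (fun τ hτ => by
        have h5 : ‖f (τ, Y τ (p + h)) - f (τ, Y τ p)‖ ≤ c * C * (L * ‖h‖) :=
          (hL E f C hC hfd hfC τ _ _ (hY.mem _ h2 τ (hmemT hτ)) (hY.mem _ hp τ (hmemT hτ))).trans
            (by gcongr; exact hΔ τ (Ioo_subset_Icc_self hτ))
        have h6 : ‖spaceDeriv f (τ, Y τ p) (S τ p (A h))‖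
            ≤ C * (Real.exp (C * T) * (‖A‖ * ‖h‖)) := by
          refine ContinuousLinearMap.le_of_opNorm_le_of_le _
            (norm_spaceDeriv_le (hfC _ (hY.mem _ hp τ (hmemT hτ)))) ?_
          exact ContinuousLinearMap.le_of_opNorm_le_of_le _
            (hS.norm_le p hp τ (Ioo_subset_Icc_self hτ)) (A.le_opNorm h)
        refine (norm_sub_le _ _).trans ((add_le_add h5 h6).trans (le_of_eq ?_))
        rw [hC₂]; ring) (x := ε) (y := 0) ⟨hε0.le, hεt.trans ht.2⟩ ⟨le_rfl, hT.le⟩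
    rw [sub_zero, abs_of_pos hε0] at h4
    have h5 : ‖e 0‖ ≤ κ * ‖h‖ := by simpa [he, hS.zero p hp] using h1κ
    have h6 : C₂ * ‖h‖ * ε ≤ κ * ‖h‖ := by
      calc C₂ * ‖h‖ * ε = C₂ * ε * ‖h‖ := by ring
        _ ≤ κ * ‖h‖ := by gcongr
    have h7 := norm_le_norm_sub_add (e ε) (e 0)
    linarith
  have hsub : Icc ε T ⊆ Icc 0 T := Icc_subset_Icc hε0.le le_rfl
  have hfin := norm_le_exp_of_norm_deriv_le (f := e) (K := C) (ε := κ * (L * ‖h‖)) (a := ε)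
    (b := T) hC (by positivity) (hec.mono hsub) (fun τ hτ => hed τ ⟨hε0.trans hτ.1, hτ.2⟩)
    (fun τ hτ => by
      have hτ' : τ ∈ Ioo 0 T := ⟨hε0.trans hτ.1, hτ.2⟩
      have h4 := (htube τ (Ioo_subset_Icc_self hτ) (Y τ (p + h))
        ((hΔ τ (Ioo_subset_Icc_self hτ')).trans_lt hLh)).2
      have h5 : ‖spaceDeriv f (τ, Y τ p) (e τ)‖ ≤ C * ‖e τ‖ :=
        ContinuousLinearMap.le_of_opNorm_le _
          (norm_spaceDeriv_le (hfC _ (hY.mem _ hp τ (hmemT hτ')))) _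
      have h6 : f (τ, Y τ (p + h)) - f (τ, Y τ p) - spaceDeriv f (τ, Y τ p) (S τ p (A h))
          = spaceDeriv f (τ, Y τ p) (e τ) + (f (τ, Y τ (p + h)) - f (τ, Y τ p)
            - spaceDeriv f (τ, Y τ p) (Y τ (p + h) - Y τ p)) := by
        simp only [he, map_sub]; abel
      rw [h6]
      refine (norm_add_le _ _).trans (add_le_add h5 (h4.trans ?_))
      gcongr
      exact hΔ τ (Ioo_subset_Icc_self hτ')) (x := t) ⟨hεt, ht.2⟩
  calc ‖Y t (p + h) - Y t p - (S t p ∘L A) h‖ = ‖e t‖ := by simp [he]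
    _ ≤ (2 * κ * ‖h‖ + κ * (L * ‖h‖) * T) * Real.exp (C * T) := by
        refine hfin.trans ?_
        have h8 : 0 ≤ t - ε := sub_nonneg.2 hεt
        have h9 : t - ε ≤ T := by linarith [ht.2]
        gcongr
    _ = κ * N * ‖h‖ := by rw [hN]; ring
    _ = κ' * ‖h‖ := by rw [hκdef]; field_simp

/-- The resolvent depends continuously on the parameter, uniformly in time. -/
theorem eventually_norm_resolvent_sub_le (hY : IsFlow T W f Q Y) (hT : 0 < T) (hW : IsOpen W)
    (hL : HasLipschitzSlices W c) (hc : 0 ≤ c) (hf : ContDiffOn ℝ 1 f W) (hC : 0 ≤ C)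
    (hfC : ∀ p ∈ W, ‖fderiv ℝ f p‖ ≤ C) (hQ : IsOpen Q) (hY0 : ContinuousOn (Y 0) Q)
    {S : ℝ → P → E →L[ℝ] E} (hS : IsResolvent T C f Q Y S) {p : P} (hp : p ∈ Q)
    {κ' : ℝ} (hκ' : 0 < κ') :
    ∀ᶠ p' in 𝓝 p, ∀ t ∈ Icc 0 T, ‖S t p' - S t p‖ ≤ κ' := by
  have hfd : ∀ p ∈ W, DifferentiableAt ℝ f p := fun p hp =>
    (hf.differentiableOn (by simp)).differentiableAt (hW.mem_nhds hp)
  set M : ℝ := Real.exp (C * T) with hM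
  have hM0 : 0 < M := Real.exp_pos _
  set N : ℝ := (1 + M * T) * M with hN
  have hN0 : 0 < N := by positivity
  set κ : ℝ := κ' / N with hκdef
  have hκ : 0 < κ := by positivity
  obtain ⟨ε, hε0, hεT, hεκ⟩ : ∃ ε, 0 < ε ∧ ε ≤ T ∧ 2 * C * M * ε ≤ κ := by
    refine ⟨min T (κ / (2 * C * M + 1)), lt_min hT (by positivity), min_le_left _ _, ?_⟩
    calc 2 * C * M * min T (κ / (2 * C * M + 1))
        ≤ (2 * C * M + 1) * (κ / (2 * C * M + 1)) := by
          refine mul_le_mul (by linarith) (min_le_right _ _)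
            (le_min hT.le (by positivity)) (by positivity)
      _ = κ := by field_simp
  obtain ⟨ρ, hρ, htube⟩ := hY.exists_uniform_tube hW hf hp hε0 hκ
  have hY0p := Metric.continuousAt_iff'.1 (hY0.continuousAt (hQ.mem_nhds hp))
    (ρ / Real.exp (c * C * T)) (by positivity)
  filter_upwards [hQ.mem_nhds hp, hY0p] with p' hp' hd t ht
  have hΔ : ∀ τ ∈ Icc 0 T, ‖Y τ p' - Y τ p‖ < ρ := fun τ hτ => by
    refine (hY.norm_apply_sub_le hL hc hC hfd hfC hp' hp hτ).trans_lt ?_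
    rwa [dist_eq_norm, lt_div_iff₀ (Real.exp_pos _)] at hd
  set e : ℝ → E →L[ℝ] E := fun τ => S τ p' - S τ p with he
  have hec : ContinuousOn e (Icc 0 T) := (hS.cont p' hp').sub (hS.cont p hp)
  have hed : ∀ τ ∈ Ioo 0 T, HasDerivAt e (spaceDeriv f (τ, Y τ p') ∘L S τ p'
      - spaceDeriv f (τ, Y τ p) ∘L S τ p) τ := fun τ hτ =>
    (hS.hasDerivAt p' hp' τ hτ).sub (hS.hasDerivAt p hp τ hτ)
  have hB : ∀ q ∈ Q, ∀ τ ∈ Ioo 0 T, ‖spaceDeriv f (τ, Y τ q)‖ ≤ C := fun q hq τ hτ =>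
    norm_spaceDeriv_le (hfC _ (hY.mem q hq τ ⟨hτ.1, hτ.2.le⟩))
  have hBS : ∀ q ∈ Q, ∀ τ ∈ Ioo 0 T, ‖spaceDeriv f (τ, Y τ q) ∘L S τ q‖ ≤ C * M :=
    fun q hq τ hτ => (ContinuousLinearMap.opNorm_comp_le _ _).trans
      (mul_le_mul (hB q hq τ hτ) (hS.norm_le q hq τ (Ioo_subset_Icc_self hτ)) (norm_nonneg _) hC)
  have he0 : e 0 = 0 := by simp [he, hS.zero p hp, hS.zero p' hp']
  have hsmall : ∀ τ ∈ Icc 0 ε, ‖e τ‖ ≤ κ := fun τ hτ => by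
    have h4 := norm_sub_le_of_norm_deriv_le (f := e) (ε := 2 * C * M) (a := 0) (b := T)
      (by positivity) hec hed (fun τ hτ => (norm_sub_le _ _).trans (by
        have := hBS p hp τ hτ
        have := hBS p' hp' τ hτ
        linarith)) (x := τ) (y := 0) ⟨hτ.1, hτ.2.trans hεT⟩ ⟨le_rfl, hT.le⟩
    rw [he0, sub_zero, sub_zero, abs_of_nonneg hτ.1] at h4
    refine h4.trans (le_trans ?_ hεκ)
    gcongr
    exact hτ.2
  have hκκ' : κ ≤ κ' := by
    have h1 : 1 ≤ M := Real.one_le_exp (by positivity)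
    have h2 : 1 ≤ N := by
      have : 0 ≤ M * T := by positivity
      rw [hN]; nlinarith
    exact div_le_self hκ'.le h2
  rcases le_total t ε with htε | htε
  · exact (hsmall t ⟨ht.1, htε⟩).trans hκκ'
  have hfin := norm_le_exp_of_norm_deriv_le (f := e) (K := C) (ε := κ * M) (a := ε)
    (b := T) hC (by positivity) (hec.mono (Icc_subset_Icc hε0.le le_rfl))
    (fun τ hτ => hed τ ⟨hε0.trans hτ.1, hτ.2⟩)
    (fun τ hτ => by
      have hτ' : τ ∈ Ioo 0 T := ⟨hε0.trans hτ.1, hτ.2⟩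
      have h4 := (htube τ (Ioo_subset_Icc_self hτ) (Y τ p') (hΔ τ (Ioo_subset_Icc_self hτ'))).1
      have h6 : spaceDeriv f (τ, Y τ p') ∘L S τ p' - spaceDeriv f (τ, Y τ p) ∘L S τ p
          = spaceDeriv f (τ, Y τ p) ∘L e τ
            + (spaceDeriv f (τ, Y τ p') - spaceDeriv f (τ, Y τ p)) ∘L S τ p' := by
        simp only [he, ContinuousLinearMap.comp_sub, ContinuousLinearMap.sub_comp]; abel
      rw [h6]
      refine (norm_add_le _ _).trans (add_le_add ?_ ?_)
      · exact (ContinuousLinearMap.opNorm_comp_le _ _).trans (by gcongr; exact hB p hp τ hτ')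
      · exact (ContinuousLinearMap.opNorm_comp_le _ _).trans
          (mul_le_mul h4 (hS.norm_le p' hp' τ (Ioo_subset_Icc_self hτ')) (norm_nonneg _) hκ.le))
    (x := t) ⟨htε, ht.2⟩
  calc ‖e t‖ ≤ (κ + κ * M * T) * M := by
        refine hfin.trans ?_
        have h8 : 0 ≤ t - ε := sub_nonneg.2 htε
        have h9 : t - ε ≤ T := by linarith [ht.2]
        have h10 := hsmall ε ⟨hε0.le, le_rfl⟩
        rw [hM]
        gcongr
    _ = κ * N := by rw [hN]; ring
    _ = κ' := by rw [hκdef]; field_simp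

end IsFlow

end Flow

section Flow

variable {E : Type} [NormedAddCommGroup E] [NormedSpace ℝ E]
  {P : Type} [NormedAddCommGroup P]

/-- The vector field `(y, a) ↦ (f(t, y), ∂_y f(t, y) ∘ a)`, whose flow consists of the flow of `f`
and its resolvent. -/
noncomputable def variationalField (f : ℝ × E → E) (q : ℝ × E × (E →L[ℝ] E)) :
    E × (E →L[ℝ] E) :=
  (f (q.1, q.2.1), spaceDeriv f (q.1, q.2.1) ∘L q.2.2)

/-- The domain `{(t, y, a) : (t, y) ∈ W, ‖a‖ < R}`. -/
def variationalDomain (W : Set (ℝ × E)) (R : ℝ) : Set (ℝ × E × (E →L[ℝ] E)) :=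
  {q | (q.1, q.2.1) ∈ W ∧ ‖q.2.2‖ < R}

theorem isOpen_variationalDomain {W : Set (ℝ × E)} (hW : IsOpen W) (R : ℝ) :
    IsOpen (variationalDomain W R) :=
  (hW.preimage (continuous_fst.prodMk (continuous_fst.comp continuous_snd))).inter
    (isOpen_lt (continuous_snd.comp continuous_snd).norm continuous_const)

theorem HasBddDerivs.variationalField {W : Set (ℝ × E)} (hW : IsOpen W) {f : ℝ × E → E} {n : ℕ}
    (hf : HasBddDerivs W (n + 1) f) (R : ℝ) :
    HasBddDerivs (variationalDomain W R) n (variationalField f) := by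
  have hV := isOpen_variationalDomain hW R
  let π : ℝ × E × (E →L[ℝ] E) →L[ℝ] ℝ × E :=
    (ContinuousLinearMap.fst ℝ ℝ _).prod
      ((ContinuousLinearMap.fst ℝ E _).comp (ContinuousLinearMap.snd ℝ ℝ _))
  let σ : ℝ × E × (E →L[ℝ] E) →L[ℝ] (E →L[ℝ] E) :=
    (ContinuousLinearMap.snd ℝ E _).comp (ContinuousLinearMap.snd ℝ ℝ _)
  have h1 : HasBddDerivs (variationalDomain W R) n (fun q => f (π q)) :=
    (hf.of_succ.comp_clm hW π).mono fun q hq => hq.1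
  have h2 : HasBddDerivs (variationalDomain W R) n (fun q => spaceDeriv f (π q)) :=
    ((hf.2.2.clm_apply hW ((ContinuousLinearMap.compL ℝ E (ℝ × E) E).flip
      (.inr ℝ ℝ E))).comp_clm hW π).mono fun q hq => hq.1
  have h3 : HasBddDerivs (variationalDomain W R) n (fun q => σ q) :=
    HasBddDerivs.clm hV σ (C := R) fun q hq => hq.2.le
  exact h1.prodMk hV (h2.bilin hV (ContinuousLinearMap.compL ℝ E E E) h3)

theorem HasLipschitzSlices.variationalDomain {W : Set (ℝ × E)} {c : ℝ} (hc : 0 ≤ c)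
    (hL : HasLipschitzSlices W c) (R : ℝ) :
    HasLipschitzSlices (variationalDomain W R) (c + 1) := by
  intro G _ _ g C hC hd hgC t y y' hy hy'
  have hmid : (t, y'.1, y.2) ∈ HydroEuler.variationalDomain W R := ⟨hy'.1, hy.2⟩
  have hfst : ‖y.1 - y'.1‖ ≤ ‖y - y'‖ := norm_fst_le (y - y')
  have hsnd : ‖y.2 - y'.2‖ ≤ ‖y - y'‖ := norm_snd_le (y - y')
  -- first move `y` with `a` fixed, then `a` with `y` fixed
  have h1 : ‖g (t, y.1, y.2) - g (t, y'.1, y.2)‖ ≤ c * C * ‖y.1 - y'.1‖ := by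
    let ι : ℝ × E → ℝ × E × (E →L[ℝ] E) := fun p => (p.1, p.2, y.2)
    let ι' : ℝ × E →L[ℝ] ℝ × E × (E →L[ℝ] E) :=
      (ContinuousLinearMap.fst ℝ ℝ E).prod ((ContinuousLinearMap.snd ℝ ℝ E).prod 0)
    have hι : ∀ p, HasFDerivAt ι ι' p := fun p =>
      hasFDerivAt_fst.prodMk (hasFDerivAt_snd.prodMk (hasFDerivAt_const _ _))
    have hι' : ‖ι'‖ ≤ 1 := ContinuousLinearMap.opNorm_le_bound _ zero_le_one fun p => by
      simp [ι', Prod.norm_def]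
    have hm : ∀ p ∈ W, ι p ∈ HydroEuler.variationalDomain W R := fun p hp => ⟨hp, hy.2⟩
    refine hL G (fun p => g (ι p)) C hC
      (fun p hp => (hd _ (hm p hp)).comp p (hι p).differentiableAt) (fun p hp => ?_) t _ _
      hy.1 hy'.1
    have h5 : fderiv ℝ (fun p => g (ι p)) p = fderiv ℝ g (ι p) ∘L ι' :=
      ((hd _ (hm p hp)).hasFDerivAt.comp p (hι p)).fderiv
    rw [h5]
    exact (ContinuousLinearMap.opNorm_comp_le _ _).trans
      ((mul_le_of_le_one_right (norm_nonneg _) hι').trans (hgC _ (hm p hp)))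
  have h2 : ‖g (t, y'.1, y.2) - g (t, y'.1, y'.2)‖ ≤ C * ‖y.2 - y'.2‖ := by
    let ι : (E →L[ℝ] E) → ℝ × E × (E →L[ℝ] E) := fun a => (t, y'.1, a)
    let ι' : (E →L[ℝ] E) →L[ℝ] ℝ × E × (E →L[ℝ] E) :=
      (ContinuousLinearMap.inr ℝ ℝ _).comp (ContinuousLinearMap.inr ℝ E _)
    have hι : ∀ a, HasFDerivAt ι ι' a := fun a =>
      (hasFDerivAt_prodMk_right t _).comp a (hasFDerivAt_prodMk_right y'.1 a)
    have hι' : ‖ι'‖ ≤ 1 := ContinuousLinearMap.opNorm_le_bound _ zero_le_one fun p => by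
      simp [ι', Prod.norm_def]
    have hm : ∀ a ∈ Metric.ball (0 : E →L[ℝ] E) R, ι a ∈ HydroEuler.variationalDomain W R :=
      fun a ha => ⟨hy'.1, mem_ball_zero_iff.1 ha⟩
    refine (convex_ball (0 : E →L[ℝ] E) R).norm_image_sub_le_of_norm_hasFDerivWithin_le
      (f := fun a => g (ι a))
      (fun a ha => ((hd _ (hm a ha)).hasFDerivAt.comp a (hι a)).hasFDerivWithinAt)
      (fun a ha => ?_) (mem_ball_zero_iff.2 hy'.2) (mem_ball_zero_iff.2 hy.2)
    exact (ContinuousLinearMap.opNorm_comp_le _ _).trans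
      ((mul_le_of_le_one_right (norm_nonneg _) hι').trans (hgC _ (hm a ha)))
  have h3 := norm_sub_le_norm_sub_add_norm_sub (g (t, y)) (g (t, y'.1, y.2)) (g (t, y'))
  have h4 : c * C * ‖y.1 - y'.1‖ ≤ c * C * ‖y - y'‖ := by gcongr
  have h5 : C * ‖y.2 - y'.2‖ ≤ C * ‖y - y'‖ := by gcongr
  calc ‖g (t, y) - g (t, y')‖ ≤ c * C * ‖y - y'‖ + C * ‖y - y'‖ := by
        refine h3.trans (add_le_add (h1.trans h4) (h2.trans h5))
    _ = (c + 1) * C * ‖y - y'‖ := by ring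

/-- The derivative of the solution jointly in time and parameter. -/
noncomputable def flowDeriv [NormedSpace ℝ P] (f : ℝ × E → E) (Y : ℝ → P → E)
    (S : ℝ → P → E →L[ℝ] E) (q : ℝ × P) : ℝ × P →L[ℝ] E :=
  (ContinuousLinearMap.toSpanSingleton ℝ (f (q.1, Y q.1 q.2))).coprod
    (S q.1 q.2 ∘L fderiv ℝ (Y 0) q.2)

namespace IsFlow

variable {T c : ℝ} {W : Set (ℝ × E)} {f : ℝ × E → E} {Q : Set P} {Y : ℝ → P → E}

theorem continuousOn_uncurry {C : ℝ} (hY : IsFlow T W f Q Y) (hL : HasLipschitzSlices W c)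
    (hc : 0 ≤ c) (hC : 0 ≤ C) (hfd : ∀ p ∈ W, DifferentiableAt ℝ f p)
    (hfC : ∀ p ∈ W, ‖fderiv ℝ f p‖ ≤ C) (hQ : IsOpen Q) (hY0 : ContinuousOn (Y 0) Q) :
    ContinuousOn (fun q : ℝ × P => Y q.1 q.2) (Icc 0 T ×ˢ Q) := by
  refine continuousOn_uncurry_of_eventually hY.cont fun p hp κ hκ => ?_
  have hY0p := Metric.continuousAt_iff'.1 (hY0.continuousAt (hQ.mem_nhds hp))
    (κ / Real.exp (c * C * T)) (by positivity)
  filter_upwards [hQ.mem_nhds hp, hY0p] with p' hp' hd t ht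
  refine (hY.norm_apply_sub_le hL hc hC hfd hfC hp' hp ht).trans ?_
  rw [dist_eq_norm, lt_div_iff₀ (Real.exp_pos _)] at hd
  exact hd.le

variable [NormedSpace ℝ P]

theorem hasFDerivAt_uncurry [CompleteSpace E] {C : ℝ} (hY : IsFlow T W f Q Y) (hT : 0 < T)
    (hW : IsOpen W) (hc : 0 ≤ c) (hL : HasLipschitzSlices W c) (hf : ContDiffOn ℝ 1 f W)
    (hC : 0 ≤ C) (hfC : ∀ p ∈ W, ‖fderiv ℝ f p‖ ≤ C) (hQ : IsOpen Q)
    (hY0 : ContDiffOn ℝ 1 (Y 0) Q) {S : ℝ → P → E →L[ℝ] E} (hS : IsResolvent T C f Q Y S) :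
    (∀ q ∈ Ioo 0 T ×ˢ Q, HasFDerivAt (fun q : ℝ × P => Y q.1 q.2) (flowDeriv f Y S q) q) ∧
      ContinuousOn (flowDeriv f Y S) (Ioo 0 T ×ˢ Q) := by
  have hfd : ∀ p ∈ W, DifferentiableAt ℝ f p := fun p hp =>
    (hf.differentiableOn (by simp)).differentiableAt (hW.mem_nhds hp)
  have hO : IsOpen (Ioo 0 T ×ˢ Q) := isOpen_Ioo.prod hQ
  have hsub : Ioo 0 T ×ˢ Q ⊆ Icc 0 T ×ˢ Q := prod_mono Ioo_subset_Icc_self le_rfl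
  have hYc := (hY.continuousOn_uncurry hL hc hC hfd hfC hQ hY0.continuousOn).mono hsub
  have hSc : ContinuousOn (fun q : ℝ × P => S q.1 q.2) (Ioo 0 T ×ˢ Q) :=
    (continuousOn_uncurry_of_eventually hS.cont fun p hp κ hκ =>
      hY.eventually_norm_resolvent_sub_le hT hW hL hc hf hC hfC hQ hY0.continuousOn hS hp
        hκ).mono hsub
  have hfc : ContinuousOn (fun q : ℝ × P => f (q.1, Y q.1 q.2)) (Ioo 0 T ×ˢ Q) :=
    hf.continuousOn.comp (continuousOn_fst.prodMk hYc)
      fun q hq => hY.mem _ hq.2 _ ⟨hq.1.1, hq.1.2.le⟩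
  have h1 : ContinuousOn (fun q : ℝ × P => ContinuousLinearMap.toSpanSingleton ℝ
      (f (q.1, Y q.1 q.2))) (Ioo 0 T ×ˢ Q) :=
    (ContinuousLinearMap.smulRightL ℝ ℝ E 1).continuous.comp_continuousOn hfc |>.congr
      fun q _ => by ext; simp
  have h2 : ContinuousOn (fun q : ℝ × P => S q.1 q.2 ∘L fderiv ℝ (Y 0) q.2) (Ioo 0 T ×ˢ Q) :=
    hSc.clm_comp ((hY0.continuousOn_fderiv_of_isOpen hQ le_rfl).comp continuousOn_snd
      fun q hq => hq.2)
  refine ⟨fun q hq => ?_, ?_⟩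
  · have hev : ∀ᶠ v in 𝓝 q, v ∈ Ioo 0 T ×ˢ Q := hO.mem_nhds hq
    exact (hasStrictFDerivAt_uncurry_coprod (f := Y)
      (f₁ := fun t p => ContinuousLinearMap.toSpanSingleton ℝ (f (t, Y t p)))
      (f₂ := fun t p => S t p ∘L fderiv ℝ (Y 0) p)
      (hev.mono fun v hv => (hY.hasDerivAt v.2 hv.2 v.1 hv.1).hasFDerivAt)
      (hev.mono fun v hv => hY.hasFDerivAt_param hW hL hc hf hC hfC hQ hS hv.2
        ((hY0.differentiableOn (by simp)).differentiableAt (hQ.mem_nhds hv.2)).hasFDerivAt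
        ⟨hv.1.1, hv.1.2.le⟩)
      (h1.continuousAt (hO.mem_nhds hq)) (h2.continuousAt (hO.mem_nhds hq))).hasFDerivAt
  · refine ((h1.clm_comp (continuousOn_const (c := ContinuousLinearMap.fst ℝ ℝ P))).add
      (h2.clm_comp (continuousOn_const (c := ContinuousLinearMap.snd ℝ ℝ P)))).congr
      fun q _ => ?_
    ext <;> simp [flowDeriv]

/-- **Smooth dependence on parameters.** If the vector field is of class `C_b^n` for positive
times and the initial values are `C^n` in the parameter, `n ≥ 1`, then the solutions are `C^n`
jointly in time and parameter. No continuity of the derivatives of the field at time zero is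
needed. The proof is by induction on `n`: the derivative of the flow is given by the field and the
resolvent, and the pair of flow and resolvent is again a flow. -/
theorem contDiffOn [CompleteSpace E] (n : ℕ) (hY : IsFlow T W f Q Y) (hT : 0 < T)
    (hW : IsOpen W) (hc : 0 ≤ c) (hL : HasLipschitzSlices W c) (hf : HasBddDerivs W (n + 1) f)
    (hQ : IsOpen Q) (hY0 : ContDiffOn ℝ (n + 1 : ℕ) (Y 0) Q) :
    ContDiffOn ℝ (n + 1 : ℕ) (fun q : ℝ × P => Y q.1 q.2) (Ioo 0 T ×ˢ Q) := by
  have hO : IsOpen (Ioo 0 T ×ˢ Q) := isOpen_Ioo.prod hQ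
  induction n generalizing E c with
  | zero =>
    obtain ⟨C, hC⟩ := hf.2.2.bounded
    have hf1 : ContDiffOn ℝ 1 f W := by simpa using hf.contDiffOn hW
    have hY01 : ContDiffOn ℝ 1 (Y 0) Q := by simpa using hY0
    have hC' : ∀ p ∈ W, ‖fderiv ℝ f p‖ ≤ max C 0 := fun p hp => (hC p hp).trans (le_max_left _ _)
    obtain ⟨S, hS⟩ := hY.exists_isResolvent hT hW hf1 (le_max_right C 0) hC'
    obtain ⟨h1, h2⟩ := hY.hasFDerivAt_uncurry hT hW hc hL hf1 (le_max_right C 0) hC' hQ hY01 hS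
    rw [Nat.cast_succ, contDiffOn_succ_iff_fderiv_of_isOpen hO]
    exact ⟨fun q hq => (h1 q hq).differentiableAt.differentiableWithinAt, by simp,
      contDiffOn_zero.2 (h2.congr fun q hq => (h1 q hq).fderiv)⟩
  | succ n ih =>
    obtain ⟨C₀, hC₀⟩ := hf.2.2.bounded
    set C : ℝ := max C₀ 0 with hCdef
    have hC : 0 ≤ C := le_max_right _ _
    have hfn : ContDiffOn ℝ (n + 1 : ℕ) f W := hf.of_succ.contDiffOn hW
    have hf1 : ContDiffOn ℝ 1 f W := hfn.of_le (by norm_cast; omega)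
    have hY01 : ContDiffOn ℝ 1 (Y 0) Q := hY0.of_le (by norm_cast; omega)
    have hC' : ∀ p ∈ W, ‖fderiv ℝ f p‖ ≤ C := fun p hp => (hC₀ p hp).trans (le_max_left _ _)
    obtain ⟨S, hS⟩ := hY.exists_isResolvent hT hW hf1 hC hC'
    obtain ⟨h1, -⟩ := hY.hasFDerivAt_uncurry hT hW hc hL hf1 hC hC' hQ hY01 hS
    set R : ℝ := Real.exp (C * T) + 1 with hR
    have hpair : IsFlow T (variationalDomain W R) (variationalField f) Q
        (fun t p => (Y t p, S t p)) :=
      ⟨fun p hp => (hY.cont p hp).prodMk (hS.cont p hp),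
        fun p hp t ht => ⟨hY.mem p hp t ht,
          (hS.norm_le p hp t (Ioc_subset_Icc_self ht)).trans_lt (lt_add_one _)⟩,
        fun p hp t ht => (hY.hasDerivAt p hp t ht).prodMk (hS.hasDerivAt p hp t ht)⟩
    have hpair0 : ContDiffOn ℝ (n + 1 : ℕ) (fun p => (Y 0 p, S 0 p)) Q :=
      (hY0.of_le (by norm_cast; omega)).prodMk
        ((contDiffOn_const (c := (1 : E →L[ℝ] E))).congr fun p hp => hS.zero p hp)
    have h2 := ih hpair (isOpen_variationalDomain hW R) (by positivity)
      (hL.variationalDomain hc R) (hf.variationalField hW R) hpair0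
    have hYn : ContDiffOn ℝ (n + 1 : ℕ) (fun q : ℝ × P => Y q.1 q.2) (Ioo 0 T ×ˢ Q) := h2.fst
    have hSn : ContDiffOn ℝ (n + 1 : ℕ) (fun q : ℝ × P => S q.1 q.2) (Ioo 0 T ×ˢ Q) := h2.snd
    have hfY : ContDiffOn ℝ (n + 1 : ℕ) (fun q : ℝ × P => f (q.1, Y q.1 q.2)) (Ioo 0 T ×ˢ Q) :=
      hfn.comp (contDiffOn_fst.prodMk hYn) fun q hq => hY.mem _ hq.2 _ ⟨hq.1.1, hq.1.2.le⟩
    have hDY0 : ContDiffOn ℝ (n + 1 : ℕ) (fun q : ℝ × P => fderiv ℝ (Y 0) q.2)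
        (Ioo 0 T ×ˢ Q) := by
      rw [Nat.cast_succ, contDiffOn_succ_iff_fderiv_of_isOpen hQ] at hY0
      exact hY0.2.2.comp contDiffOn_snd fun q hq => hq.2
    rw [Nat.cast_succ, contDiffOn_succ_iff_fderiv_of_isOpen hO]
    refine ⟨fun q hq => (h1 q hq).differentiableAt.differentiableWithinAt, by simp, ?_⟩
    have h3 : ContDiffOn ℝ (n + 1 : ℕ) (flowDeriv f Y S) (Ioo 0 T ×ˢ Q) := by
      refine ((((ContinuousLinearMap.smulRightL ℝ ℝ E 1).contDiff.comp_contDiffOn hfY).clm_comp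
        (contDiffOn_const (c := ContinuousLinearMap.fst ℝ ℝ P))).add
        ((hSn.clm_comp hDY0).clm_comp
          (contDiffOn_const (c := ContinuousLinearMap.snd ℝ ℝ P)))).congr fun q _ => ?_
      ext <;> simp [flowDeriv]
    exact h3.congr fun q hq => (h1 q hq).fderiv

end IsFlow

end Flow

/-! ### Geometry of the fluid domain and particle trajectories -/

section

variable {d : ℕ} {T T' L : ℝ} {zb : Space d → ℝ} {η : ℝ → Space d → ℝ}
  {f : ℝ × Space d × ℝ → Space d × ℝ}

/-- What the study of the particle trajectories uses of a solution of the hydrostatic Euler system: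
`f = (u, w)` and the boundary functions `zb` and `η` have derivatives bounded by `L`, and the
bottom and the free surface are impermeable. -/
structure IsFluid (T L : ℝ) (zb : Space d → ℝ) (η : ℝ → Space d → ℝ)
    (f : ℝ × Space d × ℝ → Space d × ℝ) : Prop where
  nonneg : 0 ≤ L
  zb_diff : Differentiable ℝ zb
  zb_le : ∀ x, ‖fderiv ℝ zb x‖ ≤ L
  eta_diff : ∀ t ∈ Ioo 0 T, ∀ x, DifferentiableAt ℝ (fun p : ℝ × Space d => η p.1 p.2) (t, x)
  eta_le : ∀ t ∈ Ioo 0 T, ∀ x, ‖fderiv ℝ (fun p : ℝ × Space d => η p.1 p.2) (t, x)‖ ≤ L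
  eta_cont : ContinuousOn (fun p : ℝ × Space d => η p.1 p.2) {p | 0 ≤ p.1 ∧ p.1 < T}
  diff : ∀ p ∈ fluidDomain T zb η, DifferentiableAt ℝ f p
  le : ∀ p ∈ fluidDomain T zb η, ‖f p‖ ≤ L
  fderiv_le : ∀ p ∈ fluidDomain T zb η, ‖fderiv ℝ f p‖ ≤ L
  cont : ContinuousOn f (fluidDomainBar T zb η)
  surface : ∀ t ∈ Ioo 0 T, ∀ x, fderiv ℝ (fun p : ℝ × Space d => η p.1 p.2) (t, x)
    (1, (f (t, x, η t x)).1) = (f (t, x, η t x)).2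
  bottom : ∀ t ∈ Ioo 0 T, ∀ x, fderiv ℝ zb x (f (t, x, zb x)).1 = (f (t, x, zb x)).2

/-- The field `f`, extended to all heights by its values at the bottom and at the surface. -/
def clampField (zb : Space d → ℝ) (η : ℝ → Space d → ℝ) (f : ℝ × Space d × ℝ → Space d × ℝ)
    (t : ℝ) (y : Space d × ℝ) : Space d × ℝ :=
  f (t, y.1, max (zb y.1) (min y.2 (η t y.1)))

/-- A trajectory of the extended field on `[0, T']`. -/
structure IsTrajectory (T' : ℝ) (zb : Space d → ℝ) (η : ℝ → Space d → ℝ)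
    (f : ℝ × Space d × ℝ → Space d × ℝ) (Y : ℝ → Space d × ℝ) : Prop where
  cont : ContinuousOn Y (Icc 0 T')
  hasDerivAt : ∀ t ∈ Ioo 0 T', HasDerivAt Y (clampField zb η f t (Y t)) t

/-- A Lipschitz constant of the extended field in space. -/
def lipConst (L : ℝ) : ℝ := (2 + 2 * L) * L * (1 + L)

/-- The growth rate of the distance of a trajectory to the bottom or to the surface. -/
def gapConst (L : ℝ) : ℝ := (1 + L) * ((2 + 2 * L) * L)

theorem isOpen_fluidDomain_of_continuous (hzb : Continuous zb)
    (hη : ∀ t ∈ Ioo 0 T, ∀ x, ContinuousAt (fun p : ℝ × Space d => η p.1 p.2) (t, x)) :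
    IsOpen (fluidDomain T zb η) := by
  rw [isOpen_iff_mem_nhds]
  rintro ⟨t, x, z⟩ ⟨h1, h2, h3, h4⟩
  have hη' : ContinuousAt (fun p : ℝ × Space d × ℝ => η p.1 p.2.1) (t, x, z) :=
    ContinuousAt.comp (x := (t, x, z)) (f := fun p : ℝ × Space d × ℝ => (p.1, p.2.1))
      (g := fun p : ℝ × Space d => η p.1 p.2) (hη t ⟨h1, h2⟩ x) (by fun_prop)
  have hzb' : Continuous fun p : ℝ × Space d × ℝ => zb p.2.1 := hzb.comp (by fun_prop)
  have hz : Continuous fun p : ℝ × Space d × ℝ => p.2.2 := by fun_prop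
  filter_upwards [(continuous_fst.continuousAt (x := (t, x, z))).eventually (Ioo_mem_nhds h1 h2),
    hzb'.continuousAt.eventually_lt hz.continuousAt h3, hz.continuousAt.eventually_lt hη' h4]
    with p h5 h6 h7 using ⟨h5.1, h5.2, h6, h7⟩

namespace IsFluid

theorem isOpen_fluidDomain (h : IsFluid T L zb η f) (hT' : T' ≤ T) :
    IsOpen (fluidDomain T' zb η) :=
  isOpen_fluidDomain_of_continuous h.zb_diff.continuous fun t ht x =>
    (h.eta_diff t ⟨ht.1, ht.2.trans_le hT'⟩ x).continuousAt

theorem hasFDerivAt_eta (h : IsFluid T L zb η f) {t : ℝ} (ht : t ∈ Ioo 0 T) (x : Space d) :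
    HasFDerivAt (η t) (fderiv ℝ (fun p : ℝ × Space d => η p.1 p.2) (t, x) ∘L .inr ℝ ℝ _) x :=
  (h.eta_diff t ht x).hasFDerivAt.comp x (hasFDerivAt_prodMk_right t x)

theorem norm_fderiv_eta_le (h : IsFluid T L zb η f) {t : ℝ} (ht : t ∈ Ioo 0 T) (x : Space d) :
    ‖fderiv ℝ (fun p : ℝ × Space d => η p.1 p.2) (t, x) ∘L .inr ℝ ℝ _‖ ≤ L :=
  (ContinuousLinearMap.opNorm_comp_le _ _).trans
    ((mul_le_of_le_one_right (norm_nonneg _) norm_inr_le).trans (h.eta_le t ht x))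

theorem abs_zb_sub_le (h : IsFluid T L zb η f) (x x' : Space d) :
    |zb x - zb x'| ≤ L * ‖x - x'‖ :=
  convex_univ.norm_image_sub_le_of_norm_fderiv_le (fun x _ => h.zb_diff x)
    (fun x _ => h.zb_le x) (mem_univ x') (mem_univ x)

theorem abs_eta_sub_le (h : IsFluid T L zb η f) {t : ℝ} (ht : t ∈ Ioo 0 T) (x x' : Space d) :
    |η t x - η t x'| ≤ L * ‖x - x'‖ :=
  convex_univ.norm_image_sub_le_of_norm_hasFDerivWithin_le
    (fun x _ => (h.hasFDerivAt_eta ht x).hasFDerivWithinAt)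
    (fun x _ => h.norm_fderiv_eta_le ht x) (mem_univ x') (mem_univ x)

/-- Two points of a time slice are joined by a path that first follows the horizontal segment at
constant relative height `σ = (z - zb) / (η - zb)`, and then is vertical. Its length is controlled
independently of the depth. -/
theorem hasLipschitzSlices (h : IsFluid T L zb η f) (hT' : T' ≤ T)
    (hpos : ∀ t ∈ Ioo 0 T', ∀ x, zb x < η t x) :
    HasLipschitzSlices (fluidDomain T' zb η) (2 + 2 * L) := by
  intro G _ _ g C hC hd hgC t y y' hy hy'
  have hL := h.nonneg
  obtain ⟨x, z⟩ := y
  obtain ⟨x', z'⟩ := y'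
  obtain ⟨h1, h2, h3, h4⟩ := hy
  obtain ⟨-, -, h3', h4'⟩ := hy'
  simp only at h1 h2 h3 h4 h3' h4'
  have ht : t ∈ Ioo 0 T' := ⟨h1, h2⟩
  have htT : t ∈ Ioo 0 T := ⟨h1, lt_of_lt_of_le h2 hT'⟩
  have hdep := hpos t ht
  -- the estimate along a differentiable path in the slice
  have path : ∀ (γ γ' : ℝ → Space d × ℝ) (D : ℝ), (∀ θ, HasDerivAt γ (γ' θ) θ) →
      (∀ θ ∈ Icc (0 : ℝ) 1, (t, γ θ) ∈ fluidDomain T' zb η) → (∀ θ, ‖γ' θ‖ ≤ D) →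
      ‖g (t, γ 1) - g (t, γ 0)‖ ≤ C * D := by
    intro γ γ' D hγ hm hD
    refine norm_image_sub_le_of_norm_deriv_le_segment_01' (f := fun θ => g (t, γ θ))
      (f' := fun θ => fderiv ℝ g (t, γ θ) (0, γ' θ)) (fun θ hθ => ?_) fun θ hθ => ?_
    · exact ((hd _ (hm θ hθ)).hasFDerivAt.comp_hasDerivAt θ
        ((hasDerivAt_const θ t).prodMk (hγ θ))).hasDerivWithinAt
    · refine (ContinuousLinearMap.le_opNorm _ _).trans ?_
      have : ‖((0 : ℝ), γ' θ)‖ = ‖γ' θ‖ := by simp [Prod.norm_def]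
      rw [this]
      have hD0 := (norm_nonneg _).trans (hD θ)
      exact mul_le_mul (hgC _ (hm θ ⟨hθ.1, hθ.2.le⟩)) (hD θ) (norm_nonneg _) hC
  set σ : ℝ := (z - zb x) / (η t x - zb x) with hσ
  have hden : 0 < η t x - zb x := sub_pos.2 (hdep x)
  have hσ0 : 0 < σ := div_pos (sub_pos.2 h3) hden
  have hσ1 : σ < 1 := (div_lt_one hden).2 (by linarith)
  have hσz : (1 - σ) * zb x + σ * η t x = z := by
    rw [hσ]; field_simp; ring
  set r : ℝ := ‖x - x'‖ with hr
  let X : ℝ → Space d := fun θ => x + θ • (x' - x)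
  have hX : ∀ θ, HasDerivAt X (x' - x) θ := fun θ => by
    simpa [X] using ((hasDerivAt_id θ).smul_const (x' - x)).const_add x
  let z'' : ℝ := (1 - σ) * zb x' + σ * η t x'
  have hm'' : zb x' < z'' ∧ z'' < η t x' := by
    have := hdep x'
    constructor <;> simp only [z''] <;> nlinarith
  have hhor : ‖g (t, x', z'') - g (t, x, z)‖ ≤ C * ((1 + L) * r) := by
    have h5 := path (fun θ => (X θ, (1 - σ) * zb (X θ) + σ * η t (X θ)))
      (fun θ => (x' - x, (1 - σ) * fderiv ℝ zb (X θ) (x' - x) + σ * (fderiv ℝ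
        (fun p : ℝ × Space d => η p.1 p.2) (t, X θ) ∘L .inr ℝ ℝ _) (x' - x)))
      ((1 + L) * r)
      (fun θ => (hX θ).prodMk ((((h.zb_diff (X θ)).hasFDerivAt.comp_hasDerivAt θ (hX θ)).const_mul
        (1 - σ)).add (((h.hasFDerivAt_eta htT (X θ)).comp_hasDerivAt θ (hX θ)).const_mul σ)))
      (fun θ _ => by
        have := hdep (X θ)
        refine ⟨h1, h2, ?_, ?_⟩ <;> simp only <;> nlinarith)
      (fun θ => by
        have h6 : ‖x' - x‖ = r := norm_sub_rev _ _
        have hr0 : 0 ≤ r := norm_nonneg _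
        refine norm_prod_le_iff.2 ⟨?_, ?_⟩
        · simp only [h6]; nlinarith
        · have h7 := ContinuousLinearMap.le_of_opNorm_le _ (h.zb_le (X θ)) (x' - x)
          have h8 := ContinuousLinearMap.le_of_opNorm_le _ (h.norm_fderiv_eta_le htT (X θ))
            (x' - x)
          rw [h6] at h7 h8
          refine (norm_add_le _ _).trans ?_
          rw [norm_mul, norm_mul, Real.norm_of_nonneg hσ0.le,
            Real.norm_of_nonneg (sub_pos.2 hσ1).le]
          have h9 := mul_le_mul_of_nonneg_left h7 (sub_pos.2 hσ1).le
          have h10 := mul_le_mul_of_nonneg_left h8 hσ0.le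
          nlinarith)
    simpa [X, z'', hσz] using h5
  have hver : ‖g (t, x', z'') - g (t, x', z')‖ ≤ C * |z'' - z'| := by
    have h5 := path (fun θ => (x', z' + θ * (z'' - z'))) (fun θ => (0, z'' - z')) |z'' - z'|
      (fun θ => (hasDerivAt_const θ x').prodMk
        (by simpa using ((hasDerivAt_id θ).mul_const (z'' - z')).const_add z'))
      (fun θ hθ => by
        have h5 : z' + θ * (z'' - z') ∈ Ioo (zb x') (η t x') := by
          have h6 := (convex_Ioo (zb x') (η t x')) ⟨h3', h4'⟩ hm'' (sub_nonneg.2 hθ.2) hθ.1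
            (by ring)
          convert h6 using 1
          simp only [smul_eq_mul]; ring
        exact ⟨h1, h2, h5.1, h5.2⟩)
      (fun θ => by simp [Prod.norm_def])
    simpa using h5
  have hz'' : |z'' - z'| ≤ L * r + |z - z'| := by
    have h5 : |z'' - z| ≤ L * r := by
      have h6 : z'' - z = (1 - σ) * (zb x' - zb x) + σ * (η t x' - η t x) := by
        rw [← hσz]; simp only [z'']; ring
      have h7 := h.abs_zb_sub_le x' x
      have h8 := h.abs_eta_sub_le htT x' x
      rw [norm_sub_rev, ← hr] at h7 h8
      rw [h6]
      refine (abs_add_le _ _).trans ?_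
      rw [abs_mul, abs_mul, abs_of_pos hσ0, abs_of_pos (sub_pos.2 hσ1)]
      nlinarith [sub_pos.2 hσ1]
    have := abs_sub_le z'' z z'
    linarith
  have hn1 : r ≤ ‖(x, z) - (x', z')‖ := norm_fst_le ((x, z) - (x', z'))
  have hn2 : |z - z'| ≤ ‖(x, z) - (x', z')‖ := norm_snd_le ((x, z) - (x', z'))
  have h11 : ‖g (t, x, z) - g (t, x', z')‖
      ≤ ‖g (t, x', z'') - g (t, x, z)‖ + ‖g (t, x', z'') - g (t, x', z')‖ := by
    rw [norm_sub_rev (g (t, x', z'')) (g (t, x, z))]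
    exact norm_sub_le_norm_sub_add_norm_sub _ _ _
  calc ‖g (t, x, z) - g (t, x', z')‖ ≤ C * ((1 + L) * r) + C * (L * r + |z - z'|) :=
        h11.trans (add_le_add hhor (hver.trans (by gcongr)))
    _ ≤ C * ((1 + L) * ‖(x, z) - (x', z')‖)
        + C * (L * ‖(x, z) - (x', z')‖ + ‖(x, z) - (x', z')‖) := by gcongr
    _ = (2 + 2 * L) * C * ‖(x, z) - (x', z')‖ := by ring

/-- A point of the closed vertical segment is approached from the open one. -/
theorem tendsto_interior (h : IsFluid T L zb η f) {t : ℝ} (ht : t ∈ Ioo 0 T) {x : Space d}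
    (hpos : zb x < η t x) {z : ℝ} (hz : z ∈ Icc (zb x) (η t x)) :
    ∃ ζ : ℝ → ℝ, (∀ᶠ ε in 𝓝[>] 0, (t, x, ζ ε) ∈ fluidDomain T zb η) ∧
      Tendsto ζ (𝓝[>] 0) (𝓝 z) ∧ Tendsto (fun ε => f (t, x, ζ ε)) (𝓝[>] 0) (𝓝 (f (t, x, z))) := by
  let ζ : ℝ → ℝ := fun ε => z + ε * ((zb x + η t x) / 2 - z)
  have h1 : ∀ᶠ ε : ℝ in 𝓝[>] 0, (t, x, ζ ε) ∈ fluidDomain T zb η := by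
    filter_upwards [Ioo_mem_nhdsGT (zero_lt_one' ℝ)] with ε hε
    refine ⟨ht.1, ht.2, ?_, ?_⟩ <;> simp only [ζ] <;> nlinarith [hε.1, hε.2, hz.1, hz.2]
  have h2 : Tendsto ζ (𝓝[>] 0) (𝓝 z) := by
    have : Continuous ζ := by fun_prop
    simpa [ζ] using (this.tendsto 0).mono_left (nhdsWithin_le_nhds (s := Ioi 0))
  refine ⟨ζ, h1, h2, ?_⟩
  have h3 := h.cont (t, x, z) ⟨ht.1.le, ht.2, hz.1, hz.2⟩
  refine h3.tendsto.comp (tendsto_nhdsWithin_iff.2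
    ⟨tendsto_const_nhds.prodMk_nhds (tendsto_const_nhds.prodMk_nhds h2), ?_⟩)
  filter_upwards [h1] with ε hε using ⟨hε.1.le, hε.2.1, hε.2.2.1.le, hε.2.2.2.le⟩

theorem norm_sub_le_of_mem_closed (h : IsFluid T L zb η f) (hT' : T' ≤ T)
    (hpos : ∀ t ∈ Ioo 0 T', ∀ x, zb x < η t x) {t : ℝ} (ht : t ∈ Ioo 0 T') {x x' : Space d}
    {z z' : ℝ} (hz : z ∈ Icc (zb x) (η t x)) (hz' : z' ∈ Icc (zb x') (η t x')) :
    ‖f (t, x, z) - f (t, x', z')‖ ≤ (2 + 2 * L) * L * ‖(x, z) - (x', z')‖ := by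
  have htT : t ∈ Ioo 0 T := ⟨ht.1, lt_of_lt_of_le ht.2 hT'⟩
  obtain ⟨ζ, h1, h2, h3⟩ := h.tendsto_interior htT (hpos t ht x) hz
  obtain ⟨ζ', h1', h2', h3'⟩ := h.tendsto_interior htT (hpos t ht x') hz'
  have hsub : ∀ p ∈ fluidDomain T' zb η, p ∈ fluidDomain T zb η := fun p hp =>
    ⟨hp.1, lt_of_lt_of_le hp.2.1 hT', hp.2.2⟩
  refine le_of_tendsto_of_tendsto (h3.sub h3').norm
    ((((tendsto_const_nhds (x := x)).prodMk_nhds h2).sub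
      ((tendsto_const_nhds (x := x')).prodMk_nhds h2')).norm.const_mul _) ?_
  filter_upwards [h1, h1'] with ε hε hε'
  exact h.hasLipschitzSlices hT' hpos _ f L h.nonneg (fun p hp => h.diff p (hsub p hp))
    (fun p hp => h.fderiv_le p (hsub p hp)) t _ _ ⟨ht.1, ht.2, hε.2.2⟩ ⟨ht.1, ht.2, hε'.2.2⟩

theorem clamp_mem {t : ℝ} {x : Space d} (hpos : zb x < η t x) (z : ℝ) :
    max (zb x) (min z (η t x)) ∈ Icc (zb x) (η t x) :=
  ⟨le_max_left _ _, max_le hpos.le (min_le_right _ _)⟩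

/-- A bound on the open time interval extends to its end points. -/
theorem le_of_le_Ioo {E : Type*} [NormedAddCommGroup E] {g : ℝ → E} {C : ℝ} (hT : 0 < T')
    (hg : ContinuousOn g (Icc 0 T')) (hC : ∀ t ∈ Ioo 0 T', ‖g t‖ ≤ C) {t : ℝ}
    (ht : t ∈ Icc 0 T') : ‖g t‖ ≤ C := by
  have h1 : t ∈ closure (Ioo 0 T') := by rwa [closure_Ioo hT.ne]
  have : (𝓝[Ioo 0 T'] t).NeBot := mem_closure_iff_nhdsWithin_neBot.1 h1
  exact le_of_tendsto ((hg t ht).mono Ioo_subset_Icc_self).norm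
    (eventually_mem_nhdsWithin.mono hC)

/-- A continuous function that is positive somewhere on an interval and vanishes nowhere is
positive. -/
theorem pos_of_ne_zero {D : ℝ → ℝ} (hD : ContinuousOn D (Icc 0 T')) {t₀ : ℝ}
    (ht₀ : t₀ ∈ Icc 0 T') (h0 : 0 < D t₀) (hne : ∀ t ∈ Icc 0 T', D t ≠ 0) {t : ℝ}
    (ht : t ∈ Icc 0 T') : 0 < D t := by
  by_contra! hneg
  obtain ⟨r, hr, hr0⟩ := isPreconnected_Icc.intermediate_value ht ht₀ hD ⟨hneg, h0.le⟩
  exact hne r hr hr0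

variable (hT' : T' < T) (hpos : ∀ t ∈ Icc 0 T', ∀ x, zb x < η t x)

theorem clampField_eq {t : ℝ} {y : Space d × ℝ} (hy : y.2 ∈ Icc (zb y.1) (η t y.1)) :
    clampField zb η f t y = f (t, y) := by
  rw [clampField, min_eq_left hy.2, max_eq_right hy.1]

include hT' hpos

theorem continuousOn_clampField (h : IsFluid T L zb η f) :
    ContinuousOn (fun p : ℝ × Space d × ℝ => clampField zb η f p.1 p.2) (Icc 0 T' ×ˢ univ) := by
  refine h.cont.comp (continuousOn_fst.prodMk (continuousOn_snd.fst.prodMk ?_)) ?_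
  · have h1 : ContinuousOn (fun p : ℝ × Space d × ℝ => η p.1 p.2.1) (Icc 0 T' ×ˢ univ) :=
      h.eta_cont.comp (continuousOn_fst.prodMk continuousOn_snd.fst)
        fun p hp => ⟨hp.1.1, hp.1.2.trans_lt hT'⟩
    have h2 : ContinuousOn (fun p : ℝ × Space d × ℝ => zb p.2.1) (Icc 0 T' ×ˢ univ) :=
      h.zb_diff.continuous.comp_continuousOn continuousOn_snd.fst
    exact (continuous_fst.max continuous_snd).comp_continuousOn (h2.prodMk
      ((continuous_fst.min continuous_snd).comp_continuousOn (continuousOn_snd.snd.prodMk h1)))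
  · rintro ⟨t, x, z⟩ ⟨ht, -⟩
    exact ⟨ht.1, ht.2.trans_lt hT', clamp_mem (hpos t ht x) z⟩

theorem continuousOn_clampField_time (h : IsFluid T L zb η f) (y : Space d × ℝ) :
    ContinuousOn (fun t => clampField zb η f t y) (Icc 0 T') :=
  (h.continuousOn_clampField hT' hpos).comp (continuousOn_id.prodMk continuousOn_const)
    fun _ ht => ⟨ht, mem_univ _⟩

theorem norm_clampField_le (h : IsFluid T L zb η f) (hT0 : 0 < T') {t : ℝ} (ht : t ∈ Icc 0 T')
    (y : Space d × ℝ) : ‖clampField zb η f t y‖ ≤ L := by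
  refine le_of_le_Ioo hT0 (h.continuousOn_clampField_time hT' hpos y) (fun t ht => ?_) ht
  have ht' : t ∈ Icc 0 T' := Ioo_subset_Icc_self ht
  obtain ⟨ζ, h1, -, h3⟩ := h.tendsto_interior ⟨ht.1, ht.2.trans hT'⟩ (hpos t ht' y.1)
    (clamp_mem (hpos t ht' y.1) y.2)
  exact le_of_tendsto h3.norm (h1.mono fun ε hε => h.le _ hε)

theorem norm_clampField_sub_le (h : IsFluid T L zb η f) (hT0 : 0 < T') {t : ℝ}
    (ht : t ∈ Icc 0 T') (y y' : Space d × ℝ) :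
    ‖clampField zb η f t y - clampField zb η f t y'‖ ≤ lipConst L * ‖y - y'‖ := by
  have hL := h.nonneg
  refine le_of_le_Ioo hT0 ((h.continuousOn_clampField_time hT' hpos y).sub
    (h.continuousOn_clampField_time hT' hpos y')) (fun t ht => ?_) ht
  have ht' : t ∈ Icc 0 T' := Ioo_subset_Icc_self ht
  refine (h.norm_sub_le_of_mem_closed hT'.le (fun t ht => hpos t (Ioo_subset_Icc_self ht)) ht
    (clamp_mem (hpos t ht' y.1) y.2) (clamp_mem (hpos t ht' y'.1) y'.2)).trans ?_
  rw [lipConst, mul_assoc ((2 + 2 * L) * L)]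
  gcongr
  have h1 : ‖y.1 - y'.1‖ ≤ ‖y - y'‖ := norm_fst_le (y - y')
  have h2 : |y.2 - y'.2| ≤ ‖y - y'‖ := norm_snd_le (y - y')
  have h3 : L * ‖y.1 - y'.1‖ ≤ L * ‖y - y'‖ := by gcongr
  have h4 : 0 ≤ ‖y - y'‖ := norm_nonneg _
  refine norm_prod_le_iff.2 ⟨?_, ?_⟩
  · simp only [Prod.fst_sub]; nlinarith
  · refine (abs_max_sub_max_le_max _ _ _ _).trans (max_le ?_ ?_)
    · exact (h.abs_zb_sub_le _ _).trans (by nlinarith)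
    · refine (abs_min_sub_min_le_max _ _ _ _).trans (max_le ?_ ?_)
      · nlinarith
      · exact (h.abs_eta_sub_le ⟨ht.1, ht.2.trans hT'⟩ _ _).trans (by nlinarith)

theorem exists_isTrajectory (h : IsFluid T L zb η f) (hT0 : 0 < T') {t₀ : ℝ}
    (ht₀ : t₀ ∈ Icc 0 T') (y₀ : Space d × ℝ) :
    ∃ Y, IsTrajectory T' zb η f Y ∧ Y t₀ = y₀ := by
  have hL := h.nonneg
  obtain ⟨Y, h1, h2, h3⟩ := exists_solution_of_bounded_lipschitz (f := clampField zb η f)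
    (T := T') (M := L) (K := lipConst L) hL (by rw [lipConst]; positivity)
    (h.continuousOn_clampField_time hT' hpos)
    (fun _ ht y => h.norm_clampField_le hT' hpos hT0 ht y)
    (fun _ ht y y' => h.norm_clampField_sub_le hT' hpos hT0 ht y y') ht₀ y₀
  exact ⟨Y, ⟨h2, h3⟩, h1⟩

/-- The distance of a trajectory to the surface grows or decays at most exponentially, as the
surface is impermeable. -/
theorem abs_surface_gap_le (h : IsFluid T L zb η f) {Y : ℝ → Space d × ℝ}
    (hY : IsTrajectory T' zb η f Y) {t t' : ℝ} (ht : t ∈ Icc 0 T') (ht' : t' ∈ Icc 0 T') :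
    |η t (Y t).1 - (Y t).2| ≤ |η t' (Y t').1 - (Y t').2| * Real.exp (gapConst L * |t - t'|) := by
  have hL := h.nonneg
  refine norm_le_exp_abs_of_norm_deriv_le (f := fun t => η t (Y t).1 - (Y t).2)
    (f' := fun t => fderiv ℝ (fun p : ℝ × Space d => η p.1 p.2) (t, (Y t).1)
      (1, (clampField zb η f t (Y t)).1) - (clampField zb η f t (Y t)).2)
    (a := 0) (b := T') (by rw [gapConst]; positivity) ?_ (fun t ht => ?_) (fun t ht => ?_) ht ht'
  · exact (h.eta_cont.comp (continuousOn_id.prodMk hY.cont.fst)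
      fun t ht => ⟨ht.1, ht.2.trans_lt hT'⟩).sub hY.cont.snd
  · have h1 := hY.hasDerivAt t ht
    have h2 := ((h.eta_diff t ⟨ht.1, ht.2.trans hT'⟩ (Y t).1).hasFDerivAt.comp_hasDerivAt t
      ((hasDerivAt_id t).prodMk h1.fst))
    exact h2.sub h1.snd
  · have ht1 : t ∈ Ioo 0 T := ⟨ht.1, ht.2.trans hT'⟩
    have hp := hpos t (Ioo_subset_Icc_self ht) (Y t).1
    have h1 := h.norm_sub_le_of_mem_closed hT'.le (fun t ht => hpos t (Ioo_subset_Icc_self ht)) ht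
      (clamp_mem hp (Y t).2) (right_mem_Icc.2 hp.le)
    set a := f (t, (Y t).1, max (zb (Y t).1) (min (Y t).2 (η t (Y t).1))) with ha
    set b := f (t, (Y t).1, η t (Y t).1) with hb
    set D := fderiv ℝ (fun p : ℝ × Space d => η p.1 p.2) (t, (Y t).1) with hD
    have h2 : D (1, a.1) - a.2 = D (0, (a - b).1) - (a - b).2 := by
      have h3 : D (1, b.1) = b.2 := h.surface t ht1 _
      have h4 : ((1 : ℝ), a.1) = (1, b.1) + (0, (a - b).1) := by simp
      rw [h4, map_add, h3, Prod.snd_sub]; ring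
    have h5 : ‖D (0, (a - b).1)‖ ≤ L * ‖a - b‖ := by
      refine ContinuousLinearMap.le_of_opNorm_le_of_le _ (h.eta_le t ht1 _) ?_
      simp [Prod.norm_def]
    have h6 : ‖(a - b).2‖ ≤ ‖a - b‖ := norm_snd_le _
    have h7 : ‖((Y t).1, max (zb (Y t).1) (min (Y t).2 (η t (Y t).1)))
        - ((Y t).1, η t (Y t).1)‖ ≤ |η t (Y t).1 - (Y t).2| := by
      refine norm_prod_le_iff.2 ⟨by simp, ?_⟩
      simp only [Prod.snd_sub, Real.norm_eq_abs]
      rcases le_total (Y t).2 (η t (Y t).1) with h8 | h8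
      · rw [min_eq_left h8, abs_sub_comm, abs_of_nonneg (sub_nonneg.2 (max_le hp.le h8)),
          abs_of_nonneg (sub_nonneg.2 h8)]
        linarith [le_max_right (zb (Y t).1) (Y t).2]
      · rw [min_eq_right h8, max_eq_right hp.le]; simp
    change ‖D (1, a.1) - a.2‖ ≤ _
    rw [h2]
    refine (norm_sub_le _ _).trans ((add_le_add h5 h6).trans ?_)
    calc L * ‖a - b‖ + ‖a - b‖ = (1 + L) * ‖a - b‖ := by ring
      _ ≤ (1 + L) * ((2 + 2 * L) * L * |η t (Y t).1 - (Y t).2|) := by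
          gcongr
          exact h1.trans (by gcongr)
      _ = _ := by rw [gapConst, Real.norm_eq_abs]; ring

/-- The distance of a trajectory to the bottom grows or decays at most exponentially, as the
bottom is impermeable. -/
theorem abs_bottom_gap_le (h : IsFluid T L zb η f) {Y : ℝ → Space d × ℝ}
    (hY : IsTrajectory T' zb η f Y) {t t' : ℝ} (ht : t ∈ Icc 0 T') (ht' : t' ∈ Icc 0 T') :
    |(Y t).2 - zb (Y t).1| ≤ |(Y t').2 - zb (Y t').1| * Real.exp (gapConst L * |t - t'|) := by
  have hL := h.nonneg
  refine norm_le_exp_abs_of_norm_deriv_le (f := fun t => (Y t).2 - zb (Y t).1)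
    (f' := fun t => (clampField zb η f t (Y t)).2
      - fderiv ℝ zb (Y t).1 (clampField zb η f t (Y t)).1)
    (a := 0) (b := T') (by rw [gapConst]; positivity) ?_ (fun t ht => ?_) (fun t ht => ?_) ht ht'
  · exact hY.cont.snd.sub (h.zb_diff.continuous.comp_continuousOn hY.cont.fst)
  · have h1 := hY.hasDerivAt t ht
    have h2 := (h.zb_diff (Y t).1).hasFDerivAt.comp_hasDerivAt t h1.fst
    exact HasDerivAt.sub h1.snd h2
  · have ht1 : t ∈ Ioo 0 T := ⟨ht.1, ht.2.trans hT'⟩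
    have hp := hpos t (Ioo_subset_Icc_self ht) (Y t).1
    have h1 := h.norm_sub_le_of_mem_closed hT'.le (fun t ht => hpos t (Ioo_subset_Icc_self ht)) ht
      (clamp_mem hp (Y t).2) (left_mem_Icc.2 hp.le)
    set a := f (t, (Y t).1, max (zb (Y t).1) (min (Y t).2 (η t (Y t).1))) with ha
    set b := f (t, (Y t).1, zb (Y t).1) with hb
    set D := fderiv ℝ zb (Y t).1 with hD
    have h2 : a.2 - D a.1 = (a - b).2 - D (a - b).1 := by
      have h3 : D b.1 = b.2 := h.bottom t ht1 _
      rw [Prod.fst_sub, map_sub, h3, Prod.snd_sub]; ring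
    have h5 : ‖D (a - b).1‖ ≤ L * ‖a - b‖ :=
      ContinuousLinearMap.le_of_opNorm_le_of_le _ (h.zb_le _) (norm_fst_le (a - b))
    have h6 : ‖(a - b).2‖ ≤ ‖a - b‖ := norm_snd_le _
    have h7 : ‖((Y t).1, max (zb (Y t).1) (min (Y t).2 (η t (Y t).1)))
        - ((Y t).1, zb (Y t).1)‖ ≤ |(Y t).2 - zb (Y t).1| := by
      refine norm_prod_le_iff.2 ⟨by simp, ?_⟩
      simp only [Prod.snd_sub, Real.norm_eq_abs]
      rw [abs_of_nonneg (sub_nonneg.2 (le_max_left _ _))]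
      rcases le_total (Y t).2 (zb (Y t).1) with h8 | h8
      · rw [max_eq_left ((min_le_left _ _).trans h8)]; simp
      · rw [abs_of_nonneg (sub_nonneg.2 h8)]
        gcongr
        exact max_le h8 (min_le_left _ _)
    change ‖a.2 - D a.1‖ ≤ _
    rw [h2]
    refine (norm_sub_le _ _).trans ((add_le_add h6 h5).trans ?_)
    calc ‖a - b‖ + L * ‖a - b‖ = (1 + L) * ‖a - b‖ := by ring
      _ ≤ (1 + L) * ((2 + 2 * L) * L * |(Y t).2 - zb (Y t).1|) := by
          gcongr
          exact h1.trans (by gcongr)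
      _ = _ := by rw [gapConst, Real.norm_eq_abs]; ring

theorem mem_of_mem (h : IsFluid T L zb η f) {Y : ℝ → Space d × ℝ}
    (hY : IsTrajectory T' zb η f Y) {t₀ : ℝ} (ht₀ : t₀ ∈ Icc 0 T')
    (hm : (Y t₀).2 ∈ Ioo (zb (Y t₀).1) (η t₀ (Y t₀).1)) {t : ℝ} (ht : t ∈ Icc 0 T') :
    (Y t).2 ∈ Ioo (zb (Y t).1) (η t (Y t).1) := by
  constructor
  · refine sub_pos.1 (pos_of_ne_zero (D := fun t => (Y t).2 - zb (Y t).1)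
      (hY.cont.snd.sub (h.zb_diff.continuous.comp_continuousOn hY.cont.fst)) ht₀
      (sub_pos.2 hm.1) (fun t ht h0 => ?_) ht)
    have h1 := h.abs_bottom_gap_le hT' hpos hY ht₀ ht
    rw [h0, abs_zero, zero_mul] at h1
    exact (sub_pos.2 hm.1).ne' (abs_nonpos_iff.1 h1)
  · refine sub_pos.1 (pos_of_ne_zero (D := fun t => η t (Y t).1 - (Y t).2)
      ((h.eta_cont.comp (continuousOn_id.prodMk hY.cont.fst)
        fun t ht => ⟨ht.1, ht.2.trans_lt hT'⟩).sub hY.cont.snd) ht₀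
      (sub_pos.2 hm.2) (fun t ht h0 => ?_) ht)
    have h1 := h.abs_surface_gap_le hT' hpos hY ht₀ ht
    rw [h0, abs_zero, zero_mul] at h1
    exact (sub_pos.2 hm.2).ne' (abs_nonpos_iff.1 h1)

end IsFluid

end

/-! ### The initial change of variable -/

section

variable {d : ℕ} {T T' L c M : ℝ} {zb : Space d → ℝ} {η : ℝ → Space d → ℝ}
  {f : ℝ × Space d × ℝ → Space d × ℝ} {φ₀ : Space d → ℝ → ℝ}

/-- What is used of the initial change of variable: it maps `(0, 1)` increasingly onto the initial
vertical segments, with derivative bounded by `M` and vertical derivative at least `c`. -/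
structure IsInitialHeight (c M : ℝ) (zb : Space d → ℝ) (η : ℝ → Space d → ℝ)
    (φ₀ : Space d → ℝ → ℝ) : Prop where
  pos : 0 < c
  nonneg : 0 ≤ M
  diff : ∀ x, ∀ l ∈ Ioo (0 : ℝ) 1, DifferentiableAt ℝ (fun p : Space d × ℝ => φ₀ p.1 p.2) (x, l)
  le : ∀ x, ∀ l ∈ Ioo (0 : ℝ) 1, ‖fderiv ℝ (fun p : Space d × ℝ => φ₀ p.1 p.2) (x, l)‖ ≤ M
  le_deriv : ∀ x, ∀ l ∈ Ioo (0 : ℝ) 1, c ≤ deriv (fun l' => φ₀ x l') l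
  cont : ContinuousOn (fun p : Space d × ℝ => φ₀ p.1 p.2) {p | 0 ≤ p.2 ∧ p.2 ≤ 1}
  bot : ∀ x, φ₀ x 0 = zb x
  top : ∀ x, φ₀ x 1 = η 0 x

/-- The set of parameters `(x, λ)`. -/
def params (d : ℕ) : Set (Space d × ℝ) := {p | 0 < p.2 ∧ p.2 < 1}

theorem isOpen_params : IsOpen (params d) :=
  (isOpen_lt continuous_const continuous_snd).inter (isOpen_lt continuous_snd continuous_const)

theorem convex_params : Convex ℝ (params d) := by
  intro p hp q hq a b ha hb hab
  exact (convex_Ioo (0 : ℝ) 1) hp hq ha hb hab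

namespace IsInitialHeight

theorem hasDerivAt (h : IsInitialHeight c M zb η φ₀) (x : Space d) {l : ℝ}
    (hl : l ∈ Ioo (0 : ℝ) 1) :
    HasDerivAt (fun l' => φ₀ x l')
      (fderiv ℝ (fun p : Space d × ℝ => φ₀ p.1 p.2) (x, l) (0, 1)) l :=
  (h.diff x l hl).hasFDerivAt.comp_hasDerivAt l ((hasDerivAt_const l x).prodMk (hasDerivAt_id l))

theorem continuousOn_slice (h : IsInitialHeight c M zb η φ₀) (x : Space d) :
    ContinuousOn (φ₀ x) (Icc 0 1) :=
  h.cont.comp (continuousOn_const.prodMk continuousOn_id) fun _ hl => hl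

theorem strictMonoOn (h : IsInitialHeight c M zb η φ₀) (x : Space d) :
    StrictMonoOn (φ₀ x) (Icc 0 1) :=
  strictMonoOn_of_deriv_pos (convex_Icc 0 1) (h.continuousOn_slice x) fun l hl => by
    rw [interior_Icc] at hl
    exact h.pos.trans_le (h.le_deriv x l hl)

theorem mem (h : IsInitialHeight c M zb η φ₀) (x : Space d) {l : ℝ} (hl : l ∈ Ioo (0 : ℝ) 1) :
    φ₀ x l ∈ Ioo (zb x) (η 0 x) := by
  rw [← h.bot x, ← h.top x]
  exact ⟨h.strictMonoOn x (left_mem_Icc.2 zero_le_one) (Ioo_subset_Icc_self hl) hl.1,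
    h.strictMonoOn x (Ioo_subset_Icc_self hl) (right_mem_Icc.2 zero_le_one) hl.2⟩

theorem le_depth (h : IsInitialHeight c M zb η φ₀) (x : Space d) : c ≤ η 0 x - zb x := by
  have h1 := (convex_Icc (0 : ℝ) 1).mul_sub_le_image_sub_of_le_deriv (f := φ₀ x) (C := c)
    (h.continuousOn_slice x) (fun l hl => by
      rw [interior_Icc] at hl
      exact (h.hasDerivAt x hl).differentiableAt.differentiableWithinAt)
    (fun l hl => by
      rw [interior_Icc] at hl
      exact h.le_deriv x l hl) 0 (left_mem_Icc.2 zero_le_one) 1 (right_mem_Icc.2 zero_le_one)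
    zero_le_one
  simpa [h.bot, h.top] using h1

theorem abs_sub_le (h : IsInitialHeight c M zb η φ₀) (x : Space d) {l l' : ℝ}
    (hl : l ∈ Icc (0 : ℝ) 1) (hl' : l' ∈ Icc (0 : ℝ) 1) : |φ₀ x l - φ₀ x l'| ≤ M * |l - l'| :=
  norm_sub_le_of_norm_deriv_le h.nonneg (h.continuousOn_slice x) (fun _ hl => h.hasDerivAt x hl)
    (fun l hl => by
      have := ContinuousLinearMap.le_of_opNorm_le _ (h.le x l hl) ((0 : Space d), (1 : ℝ))
      simpa [Prod.norm_def] using this) hl hl'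

theorem abs_sub_le_norm (h : IsInitialHeight c M zb η φ₀) {p p' : Space d × ℝ}
    (hp : p ∈ params d) (hp' : p' ∈ params d) :
    |φ₀ p.1 p.2 - φ₀ p'.1 p'.2| ≤ M * ‖p - p'‖ :=
  convex_params.norm_image_sub_le_of_norm_fderiv_le (f := fun p : Space d × ℝ => φ₀ p.1 p.2)
    (fun p hp => h.diff p.1 p.2 hp) (fun p hp => h.le p.1 p.2 hp) hp' hp

end IsInitialHeight

/-! ### Small-time estimates -/

namespace IsTrajectory

variable {Y Y' : ℝ → Space d × ℝ} (hT' : T' < T) (hpos : ∀ t ∈ Icc 0 T', ∀ x, zb x < η t x)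

include hT' hpos

theorem norm_sub_le (h : IsFluid T L zb η f) (hY : IsTrajectory T' zb η f Y)
    (hY' : IsTrajectory T' zb η f Y') {t : ℝ} (ht : t ∈ Icc 0 T') :
    ‖Y t - Y' t‖ ≤ ‖Y 0 - Y' 0‖ * Real.exp (lipConst L * T) := by
  have hL := h.nonneg
  have hK : 0 ≤ lipConst L := by rw [lipConst]; positivity
  rcases (ht.1.trans ht.2).eq_or_lt with h0 | h0
  · have h1 : t = 0 := le_antisymm (ht.2.trans h0.ge) ht.1
    rw [h1]
    have : 0 ≤ lipConst L * T := mul_nonneg hK (h0.le.trans hT'.le)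
    exact le_mul_of_one_le_right (norm_nonneg _) (Real.one_le_exp this)
  have h1 := norm_le_exp_of_norm_deriv_le (f := fun t => Y t - Y' t) (K := lipConst L) (ε := 0)
    hK le_rfl (hY.cont.sub hY'.cont) (fun t ht => (hY.hasDerivAt t ht).sub (hY'.hasDerivAt t ht))
    (fun t ht => by
      rw [add_zero]
      exact h.norm_clampField_sub_le hT' hpos h0 (Ioo_subset_Icc_self ht) _ _) ht
  refine h1.trans ?_
  simp only [zero_mul, add_zero, sub_zero]
  gcongr
  exact ht.2.trans hT'.le

/-- Trajectories are unique, forward and backward in time. -/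
theorem eq_of_eq (h : IsFluid T L zb η f) (hY : IsTrajectory T' zb η f Y)
    (hY' : IsTrajectory T' zb η f Y') (hT0 : 0 < T') {t₀ : ℝ} (ht₀ : t₀ ∈ Icc 0 T')
    (h0 : Y t₀ = Y' t₀) {t : ℝ} (ht : t ∈ Icc 0 T') : Y t = Y' t := by
  have hL := h.nonneg
  have h1 := norm_le_exp_abs_of_norm_deriv_le (f := fun t => Y t - Y' t) (K := lipConst L)
    (by rw [lipConst]; positivity) (hY.cont.sub hY'.cont)
    (fun t ht => (hY.hasDerivAt t ht).sub (hY'.hasDerivAt t ht))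
    (fun t ht => h.norm_clampField_sub_le hT' hpos hT0 (Ioo_subset_Icc_self ht) _ _) ht ht₀
  rw [h0, sub_self, norm_zero, zero_mul] at h1
  exact sub_eq_zero.1 (norm_le_zero_iff.1 h1)

/-- For small times the relative displacement of two particles has hardly changed. -/
theorem norm_sub_sub_le (h : IsFluid T L zb η f) (hY : IsTrajectory T' zb η f Y)
    (hY' : IsTrajectory T' zb η f Y') {t : ℝ} (ht : t ∈ Icc 0 T') :
    ‖(Y t - Y' t) - (Y 0 - Y' 0)‖
      ≤ lipConst L * Real.exp (lipConst L * T) * t * ‖Y 0 - Y' 0‖ := by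
  have hL := h.nonneg
  have hK : 0 ≤ lipConst L := by rw [lipConst]; positivity
  rcases (ht.1.trans ht.2).eq_or_lt with h0 | h0
  · have h1 : t = 0 := le_antisymm (ht.2.trans h0.ge) ht.1
    rw [h1]; simp
  have h1 := norm_sub_le_of_norm_deriv_le (f := fun t => Y t - Y' t)
    (ε := lipConst L * (‖Y 0 - Y' 0‖ * Real.exp (lipConst L * T))) (by positivity)
    (hY.cont.sub hY'.cont) (fun t ht => (hY.hasDerivAt t ht).sub (hY'.hasDerivAt t ht))
    (fun t ht => (h.norm_clampField_sub_le hT' hpos h0 (Ioo_subset_Icc_self ht) _ _).trans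
      (by gcongr; exact norm_sub_le hT' hpos h hY hY' (Ioo_subset_Icc_self ht)))
    ht (left_mem_Icc.2 h0.le)
  rw [sub_zero, abs_of_nonneg ht.1] at h1
  refine h1.trans (le_of_eq ?_)
  ring

theorem norm_sub_zero_le (h : IsFluid T L zb η f) (hY : IsTrajectory T' zb η f Y) {t : ℝ}
    (ht : t ∈ Icc 0 T') : ‖Y t - Y 0‖ ≤ L * t := by
  rcases (ht.1.trans ht.2).eq_or_lt with h0 | h0
  · have h1 : t = 0 := le_antisymm (ht.2.trans h0.ge) ht.1
    rw [h1]; simp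
  have h1 := norm_sub_le_of_norm_deriv_le h.nonneg hY.cont hY.hasDerivAt
    (fun t ht => h.norm_clampField_le hT' hpos h0 (Ioo_subset_Icc_self ht) _) ht
    (left_mem_Icc.2 h0.le)
  rwa [sub_zero, abs_of_nonneg ht.1] at h1

end IsTrajectory

/-- The initial position of the particle with parameter `(x, λ)`. -/
def initialPosition (φ₀ : Space d → ℝ → ℝ) (p : Space d × ℝ) : Space d × ℝ := (p.1, φ₀ p.1 p.2)

theorem IsInitialHeight.norm_initialPosition_sub_le (h : IsInitialHeight c M zb η φ₀)
    {p p' : Space d × ℝ} (hp : p ∈ params d) (hp' : p' ∈ params d) :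
    ‖initialPosition φ₀ p - initialPosition φ₀ p'‖ ≤ (1 + M) * ‖p - p'‖ := by
  have h1 := h.abs_sub_le_norm hp hp'
  have h2 : ‖p.1 - p'.1‖ ≤ ‖p - p'‖ := norm_fst_le (p - p')
  have h3 := mul_nonneg h.nonneg (norm_nonneg (p - p'))
  have h4 := norm_nonneg (p - p')
  refine norm_prod_le_iff.2 ⟨?_, ?_⟩
  · simp only [initialPosition, Prod.fst_sub]; linarith
  · simp only [initialPosition, Prod.snd_sub, Real.norm_eq_abs]; linarith

/-- The rate in the small-time estimates. -/
noncomputable def rateConst (T L M : ℝ) : ℝ :=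
  lipConst L * Real.exp (lipConst L * T) * (1 + M)

theorem rateConst_nonneg (hL : 0 ≤ L) (hM : 0 ≤ M) : 0 ≤ rateConst T L M := by
  rw [rateConst, lipConst]; positivity

theorem IsInitialHeight.norm_sub_sub_le (h0 : IsInitialHeight c M zb η φ₀)
    (h : IsFluid T L zb η f) (hT' : T' < T) (hpos : ∀ t ∈ Icc 0 T', ∀ x, zb x < η t x)
    {Y Y' : ℝ → Space d × ℝ} (hY : IsTrajectory T' zb η f Y) (hY' : IsTrajectory T' zb η f Y')
    {p p' : Space d × ℝ} (hp : p ∈ params d) (hp' : p' ∈ params d)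
    (hYp : Y 0 = initialPosition φ₀ p) (hYp' : Y' 0 = initialPosition φ₀ p') {t : ℝ}
    (ht : t ∈ Icc 0 T') :
    ‖(Y t - Y' t) - (initialPosition φ₀ p - initialPosition φ₀ p')‖
      ≤ rateConst T L M * t * ‖p - p'‖ := by
  have hL := h.nonneg
  have hK : 0 ≤ lipConst L := by rw [lipConst]; positivity
  have h1 := IsTrajectory.norm_sub_sub_le hT' hpos h hY hY' ht
  have h2 := h0.norm_initialPosition_sub_le hp hp'
  rw [hYp, hYp'] at h1
  refine h1.trans ?_
  have := ht.1
  calc _ ≤ lipConst L * Real.exp (lipConst L * T) * t * ((1 + M) * ‖p - p'‖) := by gcongr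
    _ = _ := by rw [rateConst]; ring

theorem IsFluid.abs_eta_sub_zero_le (h : IsFluid T L zb η f) {t : ℝ} (ht : t ∈ Ico 0 T)
    (x : Space d) : |η t x - η 0 x| ≤ L * t := by
  have h1 := norm_sub_le_of_norm_deriv_le (f := fun τ => η τ x)
    (f' := fun τ => fderiv ℝ (fun p : ℝ × Space d => η p.1 p.2) (τ, x) (1, 0)) (a := 0) (b := t)
    h.nonneg
    (h.eta_cont.comp (continuousOn_id.prodMk continuousOn_const)
      fun τ hτ => ⟨hτ.1, hτ.2.trans_lt ht.2⟩)
    (fun τ hτ => HasFDerivAt.comp_hasDerivAt (l := fun p : ℝ × Space d => η p.1 p.2)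
      (f := fun τ => (τ, x)) τ (h.eta_diff τ ⟨hτ.1, hτ.2.trans ht.2⟩ x).hasFDerivAt
      ((hasDerivAt_id τ).prodMk (hasDerivAt_const τ x)))
    (fun τ hτ => by
      have := ContinuousLinearMap.le_of_opNorm_le _ (h.eta_le τ ⟨hτ.1, hτ.2.trans ht.2⟩ x)
        ((1 : ℝ), (0 : Space d))
      simpa [Prod.norm_def] using this)
    (right_mem_Icc.2 ht.1) (left_mem_Icc.2 ht.1)
  rwa [sub_zero, abs_of_nonneg ht.1] at h1

/-- There is a time interval on which the depth stays positive and on which the horizontal motion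
is, uniformly, close to the identity. -/
theorem exists_small_time (hT : 0 < T) (h : IsFluid T L zb η f)
    (h0 : IsInitialHeight c M zb η φ₀) :
    ∃ T₁, 0 < T₁ ∧ T₁ < T ∧ (∀ t ∈ Icc 0 T₁, ∀ x, zb x < η t x) ∧
      rateConst T L M * T₁ ≤ 1 / 2 := by
  have hL := h.nonneg
  have hc := h0.pos
  have hN := rateConst_nonneg (T := T) hL h0.nonneg
  set N := rateConst T L M
  refine ⟨min (T / 2) (min (c / (2 * (L + 1))) (1 / (2 * (N + 1)))), by positivity,
    (min_le_left _ _).trans_lt (by linarith), fun t ht x => ?_, ?_⟩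
  · have h1 := h.abs_eta_sub_zero_le (t := t)
      ⟨ht.1, (ht.2.trans (min_le_left _ _)).trans_lt (by linarith)⟩ x
    have h2 : L * t ≤ (L + 1) * (c / (2 * (L + 1))) := by
      have := ht.1
      have h3 : t ≤ c / (2 * (L + 1)) :=
        ht.2.trans ((min_le_right _ _).trans (min_le_left _ _))
      gcongr
      linarith
    have h3 : (L + 1) * (c / (2 * (L + 1))) = c / 2 := by field_simp
    have h4 := h0.le_depth x
    have h5 := (abs_le.1 h1).1
    linarith
  · calc N * min (T / 2) (min (c / (2 * (L + 1))) (1 / (2 * (N + 1))))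
        ≤ (N + 1) * (1 / (2 * (N + 1))) := by
          refine mul_le_mul (by linarith) ((min_le_right _ _).trans (min_le_right _ _))
            (by positivity) (by positivity)
      _ = 1 / 2 := by field_simp

/-- A self-map whose difference with the identity is `1/2`-Lipschitz is surjective. -/
theorem surjective_of_norm_sub_sub_le {V : Type*} [NormedAddCommGroup V] [NormedSpace ℝ V]
    [CompleteSpace V] {F : V → V}
    (hF : ∀ x x', ‖(F x - F x') - (x - x')‖ ≤ 1 / 2 * ‖x - x'‖) : Function.Surjective F := by
  have h1 : ApproximatesLinearOn F (ContinuousLinearEquiv.refl ℝ V : V →L[ℝ] V) univ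
      (1 / 2 : NNReal) := fun x _ y _ => by simpa using hF x y
  refine h1.surjective ?_
  rcases subsingleton_or_nontrivial V with hV | hV
  · exact Or.inl hV
  · right
    have : ‖((ContinuousLinearEquiv.refl ℝ V).symm : V →L[ℝ] V)‖₊ = 1 := by
      ext; simp
    rw [this]
    simpa using NNReal.half_lt_self one_ne_zero

theorem norm_sub_le_two_mul {V : Type*} [NormedAddCommGroup V] {a b : V}
    (h : ‖a - b‖ ≤ 1 / 2 * ‖b‖) : ‖b‖ ≤ 2 * ‖a‖ := by
  have h1 : ‖b‖ - ‖a‖ ≤ ‖a - b‖ := by rw [norm_sub_rev]; exact norm_sub_norm_le _ _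
  linarith

/-- A right inverse of an injective `C^n` map with invertible derivative is `C^n`. -/
theorem contDiffAt_of_injOn {A : Type*} [NormedAddCommGroup A] [NormedSpace ℝ A] [CompleteSpace A]
    {G g : A → A} {S : Set A} (hS : IsOpen S) (hinj : InjOn G S) {n : ℕ} (hn : n ≠ 0) {b : A}
    (hg : ∀ᶠ b' in 𝓝 b, g b' ∈ S ∧ G (g b') = b') (hG : ContDiffAt ℝ n G (g b))
    {D : A ≃L[ℝ] A} (hD : HasFDerivAt G (D : A →L[ℝ] A) (g b)) : ContDiffAt ℝ n g b := by
  have hn' : (n : WithTop ℕ∞) ≠ 0 := by exact_mod_cast hn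
  have hb := hg.self_of_nhds
  set ψ := hG.localInverse hD hn' with hψ
  have h1 : ContDiffAt ℝ n ψ b := by
    have := hG.to_localInverse hD hn'
    rwa [hb.2] at this
  have h2 : ψ b = g b := by
    have := hG.localInverse_apply_image hD hn'
    rwa [hb.2] at this
  have h3 : ∀ᶠ b' in 𝓝 b, G (ψ b') = b' := by
    have := (hG.hasStrictFDerivAt' hD hn').eventually_right_inverse
    rwa [hb.2] at this
  have h4 : ∀ᶠ b' in 𝓝 b, ψ b' ∈ S :=
    h1.continuousAt.eventually (by rw [h2]; exact hS.mem_nhds hb.1)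
  refine h1.congr_of_eventuallyEq ?_
  filter_upwards [hg, h3, h4] with b' h5 h6 h7
  exact hinj h5.1 h7 (h5.2.trans h6.symm)

end

/-! ### Existence of the change of variable -/

section

variable {d : ℕ} {T T' T₁ L c M : ℝ} {zb : Space d → ℝ} {η : ℝ → Space d → ℝ}
  {f : ℝ × Space d × ℝ → Space d × ℝ} {φ₀ : Space d → ℝ → ℝ}

/-- The trajectories `Y(·, p)` on `[0, T']` starting from the initial positions with parameters
`p = (x, λ)`. -/
structure IsParticleFlow (T' : ℝ) (zb : Space d → ℝ) (η : ℝ → Space d → ℝ)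
    (f : ℝ × Space d × ℝ → Space d × ℝ) (φ₀ : Space d → ℝ → ℝ)
    (Y : ℝ → Space d × ℝ → Space d × ℝ) : Prop where
  trajectory : ∀ p ∈ params d, IsTrajectory T' zb η f (fun t => Y t p)
  zero : ∀ p ∈ params d, Y 0 p = initialPosition φ₀ p

theorem strip_eq : strip d T' = Ioo 0 T' ×ˢ params d := by
  ext p; simp only [strip, params, mem_prod, mem_Ioo, mem_ofPred_eq]; tauto

theorem mem_stripBar_iff {p : ℝ × Space d × ℝ} :
    p ∈ stripBar d T' ↔ p.1 ∈ Ico 0 T' ∧ p.2 ∈ params d := by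
  simp only [stripBar, params, mem_Ico, mem_ofPred_eq]; tauto

theorem isOpen_strip : IsOpen (strip d T') := by
  rw [strip_eq]; exact isOpen_Ioo.prod isOpen_params

section

variable (hT' : T' < T) (hpos : ∀ t ∈ Icc 0 T', ∀ x, zb x < η t x)
  {Y : ℝ → Space d × ℝ → Space d × ℝ}

include hT' hpos

theorem IsFluid.exists_isParticleFlow (h : IsFluid T L zb η f) (hT0 : 0 < T') :
    ∃ Y, IsParticleFlow T' zb η f φ₀ Y := by
  choose Y hY hY0 using fun p : Space d × ℝ =>
    h.exists_isTrajectory hT' hpos hT0 (left_mem_Icc.2 hT0.le) (initialPosition φ₀ p)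
  exact ⟨fun t p => Y p t, fun p _ => hY p, fun p _ => hY0 p⟩

theorem IsParticleFlow.mem (hY : IsParticleFlow T' zb η f φ₀ Y) (h : IsFluid T L zb η f)
    (h0 : IsInitialHeight c M zb η φ₀) {p : Space d × ℝ} (hp : p ∈ params d) {t : ℝ}
    (ht : t ∈ Icc 0 T') : (Y t p).2 ∈ Ioo (zb (Y t p).1) (η t (Y t p).1) := by
  refine h.mem_of_mem hT' hpos (hY.trajectory p hp) (left_mem_Icc.2 (ht.1.trans ht.2)) ?_ ht
  rw [hY.zero p hp]
  exact h0.mem p.1 hp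

theorem IsParticleFlow.hasDerivAt (hY : IsParticleFlow T' zb η f φ₀ Y) (h : IsFluid T L zb η f)
    (h0 : IsInitialHeight c M zb η φ₀) {p : Space d × ℝ} (hp : p ∈ params d) {t : ℝ}
    (ht : t ∈ Ioo 0 T') : HasDerivAt (fun t => Y t p) (f (t, Y t p)) t := by
  have h1 := (hY.trajectory p hp).hasDerivAt t ht
  rwa [IsFluid.clampField_eq (Ioo_subset_Icc_self
    (hY.mem hT' hpos h h0 hp (Ioo_subset_Icc_self ht)))] at h1

/-- The horizontal positions of particles with the same `λ`. -/
theorem IsParticleFlow.norm_fst_sub_sub_le (hY : IsParticleFlow T' zb η f φ₀ Y)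
    (h : IsFluid T L zb η f) (h0 : IsInitialHeight c M zb η φ₀)
    (hN : rateConst T L M * T' ≤ 1 / 2) {t l : ℝ} (ht : t ∈ Icc 0 T') (hl : l ∈ Ioo (0 : ℝ) 1)
    (x x' : Space d) :
    ‖((Y t (x, l)).1 - (Y t (x', l)).1) - (x - x')‖ ≤ 1 / 2 * ‖x - x'‖ := by
  have h1 := h0.norm_sub_sub_le h hT' hpos (hY.trajectory (x, l) hl) (hY.trajectory (x', l) hl)
    hl hl (hY.zero _ hl) (hY.zero _ hl) ht
  have h2 : ‖(x, l) - (x', l)‖ = ‖x - x'‖ := by simp [Prod.norm_def]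
  rw [h2] at h1
  refine (norm_fst_le _).trans (h1.trans ?_)
  have h3 : rateConst T L M * t ≤ 1 / 2 :=
    (mul_le_mul_of_nonneg_left ht.2 (rateConst_nonneg h.nonneg h0.nonneg)).trans hN
  gcongr

end

theorem IsParticleFlow.isFlow {Y : ℝ → Space d × ℝ → Space d × ℝ}
    (hY : IsParticleFlow T' zb η f φ₀ Y) (h : IsFluid T L zb η f)
    (h0 : IsInitialHeight c M zb η φ₀) (hT' : T' < T₁) (hT₁ : T₁ < T)
    (hpos : ∀ t ∈ Icc 0 T₁, ∀ x, zb x < η t x) :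
    IsFlow T' (fluidDomain T₁ zb η) f (params d) Y := by
  have hpos' : ∀ t ∈ Icc 0 T', ∀ x, zb x < η t x := fun t ht => hpos t ⟨ht.1, ht.2.trans hT'.le⟩
  exact ⟨fun p hp => (hY.trajectory p hp).cont,
    fun p hp t ht => ⟨ht.1, ht.2.trans_lt hT',
      hY.mem (hT'.trans hT₁) hpos' h h0 hp (Ioc_subset_Icc_self ht)⟩,
    fun p hp t ht => hY.hasDerivAt (hT'.trans hT₁) hpos' h h0 hp ht⟩

/-- The particle flow is continuous up to time zero, and as smooth as the velocity and the initial
change of variable for positive times. -/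
theorem IsParticleFlow.contDiffOn {Y : ℝ → Space d × ℝ → Space d × ℝ} {n : ℕ}
    (hY : IsParticleFlow T' zb η f φ₀ Y) (h : IsFluid T L zb η f)
    (h0 : IsInitialHeight c M zb η φ₀) (hT'0 : 0 < T') (hT' : T' < T₁) (hT₁ : T₁ < T)
    (hpos : ∀ t ∈ Icc 0 T₁, ∀ x, zb x < η t x)
    (hf : HasBddDerivs (fluidDomain T zb η) (n + 1) f)
    (hφ₀ : ContDiffOn ℝ (n + 1 : ℕ) (fun p : Space d × ℝ => φ₀ p.1 p.2) (params d)) :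
    ContinuousOn (fun q : ℝ × Space d × ℝ => Y q.1 q.2) (stripBar d T') ∧
      ContDiffOn ℝ (n + 1 : ℕ) (fun q : ℝ × Space d × ℝ => Y q.1 q.2) (strip d T') := by
  have hL := h.nonneg
  have hflow := hY.isFlow h h0 hT' hT₁ hpos
  have hsub : ∀ p ∈ fluidDomain T₁ zb η, p ∈ fluidDomain T zb η := fun p hp =>
    ⟨hp.1, hp.2.1.trans hT₁, hp.2.2⟩
  have hslice := h.hasLipschitzSlices hT₁.le fun t ht => hpos t (Ioo_subset_Icc_self ht)
  have hY0 : ContDiffOn ℝ (n + 1 : ℕ) (Y 0) (params d) :=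
    (contDiffOn_fst.prodMk hφ₀).congr fun p hp => hY.zero p hp
  constructor
  · refine (hflow.continuousOn_uncurry hslice (by positivity) hL
      (fun p hp => h.diff p (hsub p hp)) (fun p hp => h.fderiv_le p (hsub p hp)) isOpen_params
      hY0.continuousOn).mono fun p hp => ?_
    rw [mem_stripBar_iff] at hp
    exact ⟨Ico_subset_Icc_self hp.1, hp.2⟩
  · rw [strip_eq]
    exact hflow.contDiffOn n hT'0 (h.isOpen_fluidDomain hT₁.le) (by positivity) hslice
      (hf.mono hsub) isOpen_params hY0

/-- If the horizontal motion at fixed time and `λ` is close to the identity, then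
`(t, x, λ) ↦ (t, X(t, x, λ), λ)` has an inverse that is continuous up to time zero, and smooth for
positive times. The component `ξ` of the inverse is the initial position of the particle. -/
theorem IsParticleFlow.exists_inverse {Y : ℝ → Space d × ℝ → Space d × ℝ} {n : ℕ}
    (hclose : ∀ t ∈ Icc 0 T', ∀ l ∈ Ioo (0 : ℝ) 1, ∀ x x' : Space d,
      ‖((Y t (x, l)).1 - (Y t (x', l)).1) - (x - x')‖ ≤ 1 / 2 * ‖x - x'‖)
    (hcont : ContinuousOn (fun q : ℝ × Space d × ℝ => Y q.1 q.2) (stripBar d T'))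
    (hsmooth : ContDiffOn ℝ (n + 1 : ℕ) (fun q : ℝ × Space d × ℝ => Y q.1 q.2) (strip d T')) :
    ∃ ξ : ℝ × Space d × ℝ → Space d,
      (∀ q ∈ stripBar d T', (Y q.1 (ξ q, q.2.2)).1 = q.2.1) ∧
      (∀ q ∈ stripBar d T', ξ (q.1, (Y q.1 q.2).1, q.2.2) = q.2.1) ∧
      ContinuousOn ξ (stripBar d T') ∧ ContDiffOn ℝ (n + 1 : ℕ) ξ (strip d T') := by
  have hexp : ∀ t ∈ Icc 0 T', ∀ l ∈ Ioo (0 : ℝ) 1, ∀ x x' : Space d,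
      ‖x - x'‖ ≤ 2 * ‖(Y t (x, l)).1 - (Y t (x', l)).1‖ := fun t ht l hl x x' =>
    norm_sub_le_two_mul (hclose t ht l hl x x')
  have hsurj : ∀ q : ℝ × Space d × ℝ, ∃ x : Space d, q ∈ stripBar d T' →
      (Y q.1 (x, q.2.2)).1 = q.2.1 := by
    intro q
    by_cases hq : q ∈ stripBar d T'
    · obtain ⟨x, hx⟩ := surjective_of_norm_sub_sub_le
        (hclose q.1 ⟨hq.1, hq.2.1.le⟩ q.2.2 hq.2.2) q.2.1
      exact ⟨x, fun _ => hx⟩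
    · exact ⟨0, fun h => absurd h hq⟩
  choose ξ hξ using hsurj
  have hsub : strip d T' ⊆ stripBar d T' := fun p hp => ⟨hp.1.le, hp.2⟩
  have hξ' : ∀ q ∈ stripBar d T', ξ (q.1, (Y q.1 q.2).1, q.2.2) = q.2.1 := by
    intro q hq
    have h1 := hexp q.1 ⟨hq.1, hq.2.1.le⟩ q.2.2 hq.2.2 (ξ (q.1, (Y q.1 q.2).1, q.2.2)) q.2.1
    rw [hξ (q.1, (Y q.1 q.2).1, q.2.2) hq, sub_self, norm_zero, mul_zero] at h1
    exact sub_eq_zero.1 (norm_le_zero_iff.1 h1)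
  refine ⟨ξ, fun q hq => hξ q hq, hξ', ?_, ?_⟩
  · intro q hq
    have hmaps : MapsTo (fun q' : ℝ × Space d × ℝ => (q'.1, ξ q, q'.2.2)) (stripBar d T')
        (stripBar d T') := fun q' hq' => hq'
    have h1 : ContinuousWithinAt (fun q' : ℝ × Space d × ℝ => (Y q'.1 (ξ q, q'.2.2)).1)
        (stripBar d T') q :=
      ((hcont.comp (t := stripBar d T')
        (f := fun q' : ℝ × Space d × ℝ => (q'.1, ξ q, q'.2.2)) (by fun_prop) hmaps) q hq).fst
    have h2 : Tendsto (fun q' : ℝ × Space d × ℝ => 2 * ‖q'.2.1 - (Y q'.1 (ξ q, q'.2.2)).1‖)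
        (𝓝[stripBar d T'] q) (𝓝 0) := by
      have h3 : ContinuousWithinAt (fun q' : ℝ × Space d × ℝ =>
          2 * ‖q'.2.1 - (Y q'.1 (ξ q, q'.2.2)).1‖) (stripBar d T') q :=
        continuousWithinAt_const.mul
          ((continuous_fst.comp continuous_snd).continuousWithinAt.sub h1).norm
      have h4 := h3.tendsto
      rwa [hξ q hq, sub_self, norm_zero, mul_zero] at h4
    rw [ContinuousWithinAt, tendsto_iff_norm_sub_tendsto_zero]
    refine squeeze_zero' (Eventually.of_forall fun _ => norm_nonneg _) ?_ h2
    filter_upwards [self_mem_nhdsWithin] with q' hq'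
    have h5 := hexp q'.1 ⟨hq'.1, hq'.2.1.le⟩ q'.2.2 hq'.2.2 (ξ q') (ξ q)
    rwa [hξ q' hq'] at h5
  · intro b hb
    set G : ℝ × Space d × ℝ → ℝ × Space d × ℝ := fun q => (q.1, (Y q.1 q.2).1, q.2.2) with hG
    set g : ℝ × Space d × ℝ → ℝ × Space d × ℝ := fun q => (q.1, ξ q, q.2.2) with hg
    have hgb : g b ∈ strip d T' := hb
    have hinj : InjOn G (strip d T') := by
      intro q hq q' hq' he
      have h1 := hξ' q (hsub hq)
      have h2 := hξ' q' (hsub hq')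
      have h3 : (q.1, (Y q.1 q.2).1, q.2.2) = (q'.1, (Y q'.1 q'.2).1, q'.2.2) := he
      rw [h3, h2] at h1
      simp only [Prod.mk.injEq] at h3
      exact Prod.ext h3.1 (Prod.ext h1.symm h3.2.2)
    have hYd : ContDiffAt ℝ (n + 1 : ℕ) (fun q : ℝ × Space d × ℝ => Y q.1 q.2) (g b) :=
      hsmooth.contDiffAt (isOpen_strip.mem_nhds hgb)
    set A := fderiv ℝ (fun q : ℝ × Space d × ℝ => Y q.1 q.2) (g b) with hA
    have hYA : HasFDerivAt (fun q : ℝ × Space d × ℝ => Y q.1 q.2) A (g b) :=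
      (hYd.differentiableAt (by simp)).hasFDerivAt
    -- the derivative of `G`, which is injective because `∂ₓ X` is close to the identity
    let D : ℝ × Space d × ℝ →L[ℝ] ℝ × Space d × ℝ :=
      (ContinuousLinearMap.fst ℝ ℝ _).prod (((ContinuousLinearMap.fst ℝ _ ℝ).comp A).prod
        ((ContinuousLinearMap.snd ℝ _ ℝ).comp (ContinuousLinearMap.snd ℝ ℝ _)))
    have hGD : HasFDerivAt G D (g b) :=
      hasFDerivAt_fst.prodMk (hYA.fst.prodMk hasFDerivAt_snd.snd)
    have hDinj : Function.Injective D := by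
      rw [injective_iff_map_eq_zero]
      rintro ⟨τ, v, ℓ⟩ h0
      have h1 : τ = 0 ∧ (A (τ, v, ℓ)).1 = 0 ∧ ℓ = 0 := by
        simpa [D, Prod.ext_iff] using h0
      obtain ⟨rfl, h2, rfl⟩ := h1
      have h3 : HasFDerivAt (fun x => (Y b.1 (x, b.2.2)).1 - x)
          (((ContinuousLinearMap.fst ℝ _ ℝ).comp A).comp ((ContinuousLinearMap.inr ℝ ℝ _).comp
            (ContinuousLinearMap.inl ℝ _ ℝ)) - ContinuousLinearMap.id ℝ _) (ξ b) :=
        (HasFDerivAt.comp (g := fun q : ℝ × Space d × ℝ => (Y q.1 q.2).1)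
          (f := fun x : Space d => (b.1, x, b.2.2)) (ξ b) hYA.fst
          ((hasFDerivAt_prodMk_right b.1 (ξ b, b.2.2)).comp (ξ b)
            (hasFDerivAt_prodMk_left (ξ b) b.2.2))).sub (hasFDerivAt_id _)
      have h4 := h3.le_of_lip' (C := 1 / 2) (by norm_num) (Eventually.of_forall fun x => by
        have := hclose b.1 ⟨hb.1.le, hb.2.1.le⟩ b.2.2 hb.2.2 x (ξ b)
        rwa [sub_sub_sub_comm])
      have h5 := ContinuousLinearMap.le_of_opNorm_le _ h4 v
      have h6 : ‖(A (0, v, 0)).1 - v‖ ≤ 1 / 2 * ‖v‖ := by simpa using h5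
      rw [h2, zero_sub, norm_neg] at h6
      have h7 : ‖v‖ ≤ 0 := by linarith [norm_nonneg v]
      rw [norm_le_zero_iff.1 h7]
      rfl
    let e : (ℝ × Space d × ℝ) ≃L[ℝ] (ℝ × Space d × ℝ) :=
      (LinearEquiv.ofInjectiveEndo (D : ℝ × Space d × ℝ →ₗ[ℝ] ℝ × Space d × ℝ)
        hDinj).toContinuousLinearEquiv
    have he : (e : ℝ × Space d × ℝ →L[ℝ] ℝ × Space d × ℝ) = D := by ext q <;> rfl
    have h8 : ContDiffAt ℝ (n + 1 : ℕ) g b := by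
      refine contDiffAt_of_injOn (G := G) isOpen_strip hinj (by omega) ?_
        (contDiffAt_fst.prodMk (hYd.fst.prodMk contDiffAt_snd.snd)) (D := e) (by rwa [he])
      filter_upwards [isOpen_strip.mem_nhds hb] with b' hb'
      refine ⟨hb', ?_⟩
      simp only [hG, hg]
      rw [hξ b' (hsub hb')]
    exact (h8.snd.fst).contDiffWithinAt

/-- Local existence of the change of variable: `φ = Z ∘ G⁻¹`, where `(X, Z)` is the particle flow
and `G = (t, X, λ)`. -/
theorem exists_isChangeOfVariable {u : ℝ → Space d → ℝ → Space d} {w : ℝ → Space d → ℝ → ℝ} {n : ℕ}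
    (hT : 0 < T) (hf : f = fun p => (u p.1 p.2.1 p.2.2, w p.1 p.2.1 p.2.2))
    (h : IsFluid T L zb η f) (h0 : IsInitialHeight c M zb η φ₀)
    (hfs : HasBddDerivs (fluidDomain T zb η) (n + 1) f)
    (hφ₀ : ContDiffOn ℝ (n + 1 : ℕ) (fun p : Space d × ℝ => φ₀ p.1 p.2) (params d)) :
    ∃ Tstar : ℝ, 0 < Tstar ∧ Tstar ≤ T ∧ ∃ φ : ℝ → Space d → ℝ → ℝ,
      IsChangeOfVariable (n + 1) Tstar zb η u w φ₀ φ := by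
  obtain ⟨T₁, hT₁0, hT₁, hpos, hrate⟩ := exists_small_time hT h h0
  set T' := T₁ / 2 with hT'def
  have hT'0 : 0 < T' := half_pos hT₁0
  have hT'₁ : T' < T₁ := half_lt_self hT₁0
  have hT' : T' < T := hT'₁.trans hT₁
  have hpos' : ∀ t ∈ Icc 0 T', ∀ x, zb x < η t x := fun t ht => hpos t ⟨ht.1, ht.2.trans hT'₁.le⟩
  have hrate' : rateConst T L M * T' ≤ 1 / 2 :=
    (mul_le_mul_of_nonneg_left hT'₁.le (rateConst_nonneg h.nonneg h0.nonneg)).trans hrate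
  obtain ⟨Y, hY⟩ := h.exists_isParticleFlow (φ₀ := φ₀) hT' hpos' hT'0
  obtain ⟨hYc, hYs⟩ := hY.contDiffOn h h0 hT'0 hT'₁ hT₁ hpos hfs hφ₀
  obtain ⟨ξ, hξ, hξ', hξc, hξs⟩ := IsParticleFlow.exists_inverse (n := n)
    (fun t ht l hl x x' => hY.norm_fst_sub_sub_le hT' hpos' h h0 hrate' ht hl x x') hYc hYs
  have hsub : strip d T' ⊆ stripBar d T' := fun p hp => ⟨hp.1.le, hp.2⟩
  have hφs : ContDiffOn ℝ (n + 1 : ℕ)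
      (fun q : ℝ × Space d × ℝ => (Y q.1 (ξ q, q.2.2)).2) (strip d T') :=
    (hYs.comp (contDiffOn_fst.prodMk (hξs.prodMk contDiffOn_snd.snd))
      (fun q hq => hq : MapsTo (fun q : ℝ × Space d × ℝ => (q.1, ξ q, q.2.2)) _ (strip d T'))).snd
  refine ⟨T', hT'0, hT'.le, fun t x l => (Y t (ξ (t, x, l), l)).2, hφs, ?_, ?_, ?_, ?_⟩
  · exact (hYc.comp (continuousOn_fst.prodMk (hξc.prodMk continuousOn_snd.snd))
      (fun q hq => hq :
        MapsTo (fun q : ℝ × Space d × ℝ => (q.1, ξ q, q.2.2)) _ (stripBar d T'))).snd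
  · intro t x l hq
    have h1 := hY.mem hT' hpos' h h0 (p := (ξ (t, x, l), l)) hq.2.2 (t := t)
      ⟨hq.1.le, hq.2.1.le⟩
    rw [hξ (t, x, l) (hsub hq)] at h1
    exact ⟨hq.1, hq.2.1, h1.1, h1.2⟩
  · intro t x l hq
    set Φ : ℝ × Space d × ℝ → ℝ := fun q => (Y q.1 (ξ q, q.2.2)).2 with hΦ
    set p : Space d × ℝ := (ξ (t, x, l), l) with hp
    have hpm : p ∈ params d := hq.2.2
    have hx : (Y t p).1 = x := hξ (t, x, l) (hsub hq)
    have hd : HasFDerivAt Φ (fderiv ℝ Φ (t, x, l)) (t, x, l) :=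
      ((hφs.contDiffAt (isOpen_strip.mem_nhds hq)).differentiableAt (by simp)).hasFDerivAt
    set D := fderiv ℝ Φ (t, x, l) with hD
    have hYd := hY.hasDerivAt hT' hpos' h h0 hpm (t := t) ⟨hq.1, hq.2.1⟩
    have hXd : HasDerivAt (fun τ => (Y τ p).1) (f (t, Y t p)).1 t :=
      (ContinuousLinearMap.fst ℝ (Space d) ℝ).hasFDerivAt.comp_hasDerivAt t hYd
    have hZd : HasDerivAt (fun τ => (Y τ p).2) (f (t, Y t p)).2 t :=
      (ContinuousLinearMap.snd ℝ (Space d) ℝ).hasFDerivAt.comp_hasDerivAt t hYd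
    -- `φ(τ, X(τ, p), λ) = Z(τ, p)` along the trajectory of the particle
    have h1 : (fun τ => Φ (τ, (Y τ p).1, l)) =ᶠ[𝓝 t] fun τ => (Y τ p).2 := by
      filter_upwards [Ioo_mem_nhds hq.1 hq.2.1] with τ hτ
      simp only [hΦ]
      rw [hξ' (τ, p) ⟨hτ.1.le, hτ.2, hpm⟩]
    have h2 : HasDerivAt (fun τ => Φ (τ, (Y τ p).1, l)) (D (1, (f (t, Y t p)).1, 0)) t := by
      refine HasFDerivAt.comp_hasDerivAt (l := Φ) (l' := D) (f := fun τ => (τ, (Y τ p).1, l)) t ?_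
        ((hasDerivAt_id t).prodMk (hXd.prodMk (hasDerivAt_const t l)))
      rw [hx]; exact hd
    have h3 : D (1, (f (t, Y t p)).1, 0) = (f (t, Y t p)).2 :=
      h2.unique (hZd.congr_of_eventuallyEq h1)
    have h4 : deriv (fun τ => (Y τ (ξ (τ, x, l), l)).2) t = D (1, 0, 0) :=
      (HasFDerivAt.comp_hasDerivAt (l := Φ) (f := fun τ => (τ, x, l)) t hd ((hasDerivAt_id t).prodMk
        ((hasDerivAt_const t x).prodMk (hasDerivAt_const t l)))).deriv
    have h5 : ∀ v, fderiv ℝ (fun y => (Y t (ξ (t, y, l), l)).2) x v = D (0, v, 0) := by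
      intro v
      have h6 : HasFDerivAt (fun y => Φ (t, y, l)) _ x :=
        HasFDerivAt.comp (f := fun y : Space d => (t, y, l)) x hd
          ((hasFDerivAt_prodMk_right t (x, l)).comp x (hasFDerivAt_prodMk_left x l))
      rw [show (fun y => (Y t (ξ (t, y, l), l)).2) = fun y => Φ (t, y, l) from rfl, h6.fderiv]
      simp
    have h7 : f (t, Y t p) = (u t x (Y t p).2, w t x (Y t p).2) := by
      rw [hf]; simp only [hx]
    rw [h4, h5, ← map_add]
    rw [h7] at h3
    simpa using h3
  · intro x l hl
    have h1 : (0, x, l) ∈ stripBar d T' := ⟨le_rfl, hT'0, hl⟩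
    have h2 := hξ (0, x, l) h1
    have hz := hY.zero (ξ (0, x, l), l) hl
    simp only at h2
    rw [hz] at h2
    have h3 : ξ (0, x, l) = x := h2
    rw [hz, h3]
    rfl

end

/-! ### Partial derivatives and divergence -/

section

section Partial

variable {d : ℕ} {F : Type*} [NormedAddCommGroup F] [NormedSpace ℝ F]

theorem hasDerivAt_time {f : ℝ × Space d × ℝ → F} {t z : ℝ} {x : Space d}
    (hf : DifferentiableAt ℝ f (t, x, z)) :
    HasDerivAt (fun τ => f (τ, x, z)) (fderiv ℝ f (t, x, z) (1, 0, 0)) t :=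
  HasFDerivAt.comp_hasDerivAt (l := f) (f := fun τ => (τ, x, z)) t hf.hasFDerivAt
    ((hasDerivAt_id t).prodMk ((hasDerivAt_const t x).prodMk (hasDerivAt_const t z)))

theorem hasDerivAt_vertical {f : ℝ × Space d × ℝ → F} {t z : ℝ} {x : Space d}
    (hf : DifferentiableAt ℝ f (t, x, z)) :
    HasDerivAt (fun ζ => f (t, x, ζ)) (fderiv ℝ f (t, x, z) (0, 0, 1)) z :=
  HasFDerivAt.comp_hasDerivAt (l := f) (f := fun ζ => (t, x, ζ)) z hf.hasFDerivAt
    ((hasDerivAt_const z t).prodMk ((hasDerivAt_const z x).prodMk (hasDerivAt_id z)))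

theorem hasFDerivAt_horizontal {f : ℝ × Space d × ℝ → F} {t z : ℝ} {x : Space d}
    (hf : DifferentiableAt ℝ f (t, x, z)) :
    HasFDerivAt (fun y => f (t, y, z)) ((fderiv ℝ f (t, x, z)).comp
      ((ContinuousLinearMap.inr ℝ ℝ (Space d × ℝ)).comp
        (ContinuousLinearMap.inl ℝ (Space d) ℝ))) x :=
  HasFDerivAt.comp (f := fun y : Space d => (t, y, z)) x hf.hasFDerivAt
    ((hasFDerivAt_prodMk_right t (x, z)).comp x (hasFDerivAt_prodMk_left x z))

theorem fderiv_horizontal {f : ℝ × Space d × ℝ → F} {t z : ℝ} {x : Space d}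
    (hf : DifferentiableAt ℝ f (t, x, z)) (v : Space d) :
    fderiv ℝ (fun y => f (t, y, z)) x v = fderiv ℝ f (t, x, z) (0, v, 0) := by
  rw [(hasFDerivAt_horizontal hf).fderiv]
  simp

theorem sum_apply_single_mul (A : Space d →L[ℝ] ℝ) (c : Space d) :
    ∑ i, A (EuclideanSpace.single i 1) * c i = A c := by
  conv_rhs => rw [← (EuclideanSpace.basisFun (Fin d) ℝ).sum_repr c]
  simp [mul_comm]

theorem div_smul {a : Space d → ℝ} {b : Space d → Space d} {x : Space d}
    (ha : DifferentiableAt ℝ a x) (hb : DifferentiableAt ℝ b x) :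
    div (fun y => a y • b y) x = fderiv ℝ a x (b x) + a x * div b x := by
  rw [← sum_apply_single_mul, div, div, Finset.mul_sum, ← Finset.sum_add_distrib]
  refine Finset.sum_congr rfl fun i _ => ?_
  have h : HasFDerivAt (fun y => a y • b y) _ x := ha.hasFDerivAt.smul hb.hasFDerivAt
  rw [h.fderiv]
  simp
  ring

end Partial

/-! ### Solutions of the Cauchy problem are transported by the particles -/

variable {d n : ℕ} {T T' L c M : ℝ} {zb : Space d → ℝ} {η : ℝ → Space d → ℝ}
  {u : ℝ → Space d → ℝ → Space d} {w : ℝ → Space d → ℝ → ℝ} {φ₀ : Space d → ℝ → ℝ}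
  {φ : ℝ → Space d → ℝ → ℝ}

/-- The velocity field `(u, w)` as a function on space-time. -/
def velocity (u : ℝ → Space d → ℝ → Space d) (w : ℝ → Space d → ℝ → ℝ) (p : ℝ × Space d × ℝ) :
    Space d × ℝ :=
  (u p.1 p.2.1 p.2.2, w p.1 p.2.1 p.2.2)

namespace IsChangeOfVariable

theorem hasFDerivAt (hφ : IsChangeOfVariable (n + 1) T' zb η u w φ₀ φ) {q : ℝ × Space d × ℝ}
    (hq : q ∈ strip d T') : HasFDerivAt (fun p : ℝ × Space d × ℝ => φ p.1 p.2.1 p.2.2)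
      (fderiv ℝ (fun p : ℝ × Space d × ℝ => φ p.1 p.2.1 p.2.2) q) q :=
  ((hφ.contDiffOn.contDiffAt (isOpen_strip.mem_nhds hq)).differentiableAt
    (by simp)).hasFDerivAt

theorem hasDerivAt_height (hφ : IsChangeOfVariable (n + 1) T' zb η u w φ₀ φ) {t l : ℝ}
    {x : Space d} (hq : (t, x, l) ∈ strip d T') : HasDerivAt (fun l' => φ t x l')
      (fderiv ℝ (fun p : ℝ × Space d × ℝ => φ p.1 p.2.1 p.2.2) (t, x, l) (0, 0, 1)) l :=
  hasDerivAt_vertical (f := fun p : ℝ × Space d × ℝ => φ p.1 p.2.1 p.2.2)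
    (hφ.hasFDerivAt hq).differentiableAt

/-- The equation in terms of the joint derivative. -/
theorem fderiv_apply (hφ : IsChangeOfVariable (n + 1) T' zb η u w φ₀ φ) {t l : ℝ}
    {x : Space d} (hq : (t, x, l) ∈ strip d T') :
    fderiv ℝ (fun p : ℝ × Space d × ℝ => φ p.1 p.2.1 p.2.2) (t, x, l) (1, u t x (φ t x l), 0)
      = w t x (φ t x l) := by
  have hd := (hφ.hasFDerivAt hq).differentiableAt
  have h1 := (hasDerivAt_time hd).deriv
  have h2 := fderiv_horizontal hd (u t x (φ t x l))
  have h3 := hφ.equation t x l hq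
  simp only at h1 h2
  rw [h1, h2, ← map_add] at h3
  simpa using h3

theorem depth_pos (hφ : IsChangeOfVariable (n + 1) T' zb η u w φ₀ φ)
    (h0 : IsInitialHeight c M zb η φ₀) {t : ℝ} (ht : t ∈ Ico 0 T') (x : Space d) :
    zb x < η t x := by
  rcases ht.1.eq_or_lt with rfl | h1
  · linarith [h0.le_depth x, h0.pos]
  · have := hφ.mem_fluid t x (1 / 2) ⟨h1, ht.2, by norm_num, by norm_num⟩
    exact this.2.2.1.trans this.2.2.2

theorem mem_Ioo (hφ : IsChangeOfVariable (n + 1) T' zb η u w φ₀ φ)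
    (h0 : IsInitialHeight c M zb η φ₀) {t l : ℝ} (ht : t ∈ Ico 0 T') (x : Space d)
    (hl : l ∈ Ioo (0 : ℝ) 1) : φ t x l ∈ Ioo (zb x) (η t x) := by
  rcases ht.1.eq_or_lt with rfl | h1
  · rw [hφ.init x l hl]; exact h0.mem x hl
  · have := hφ.mem_fluid t x l ⟨h1, ht.2, hl⟩
    exact this.2.2

/-- Backward trajectories: a particle that is at height `φ(t₁, x₁, λ)` at time `t₁` was at height
`φ(t, X(t), λ)` at all earlier times. The Lipschitz bound on `φ` along the trajectory may degenerate
at time zero, which is reached by continuity. -/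
theorem exists_trajectory (hφ : IsChangeOfVariable (n + 1) T' zb η u w φ₀ φ)
    (h : IsFluid T L zb η (velocity u w)) (h0 : IsInitialHeight c M zb η φ₀) (hT' : T' ≤ T)
    {t₁ l : ℝ} (ht₁ : t₁ ∈ Ioo 0 T') (x₁ : Space d) (hl : l ∈ Ioo (0 : ℝ) 1) :
    ∃ Y, IsTrajectory t₁ zb η (velocity u w) Y ∧ Y t₁ = (x₁, φ t₁ x₁ l) ∧
      ∀ t ∈ Icc 0 t₁, (Y t).2 = φ t (Y t).1 l := by
  have hL := h.nonneg
  have hpos : ∀ t ∈ Icc 0 t₁, ∀ x, zb x < η t x := fun t ht x =>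
    hφ.depth_pos h0 ⟨ht.1, ht.2.trans_lt ht₁.2⟩ x
  have ht₁T : t₁ < T := ht₁.2.trans_le hT'
  obtain ⟨Y, hY, hYt₁⟩ := h.exists_isTrajectory ht₁T hpos ht₁.1 (right_mem_Icc.2 ht₁.1.le)
    (x₁, φ t₁ x₁ l)
  refine ⟨Y, hY, hYt₁, fun t ht => sub_eq_zero.1 (norm_le_zero_iff.1 ?_)⟩
  set Φ : ℝ × Space d × ℝ → ℝ := fun p => φ p.1 p.2.1 p.2.2 with hΦ
  have hec : ContinuousOn (fun t => (Y t).2 - φ t (Y t).1 l) (Icc 0 t₁) := by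
    refine hY.cont.snd.sub (hφ.continuousOn.comp (f := fun t => (t, (Y t).1, l))
      (continuousOn_id.prodMk (hY.cont.fst.prodMk continuousOn_const)) ?_)
    exact fun t ht => ⟨ht.1, ht.2.trans_lt ht₁.2, hl⟩
  refine IsFluid.le_of_le_Ioo ht₁.1 hec (fun δ hδ => ?_) ht
  have hmem : ∀ t ∈ Icc δ t₁, (t, (Y t).1, l) ∈ strip d T' := fun t ht =>
    ⟨hδ.1.trans_le ht.1, ht.2.trans_lt ht₁.2, hl⟩
  have hsub : Icc δ t₁ ⊆ Icc 0 t₁ := Icc_subset_Icc hδ.1.le le_rfl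
  obtain ⟨C, hC⟩ := isCompact_Icc.exists_bound_of_continuousOn
    (f := fun t => fderiv ℝ Φ (t, (Y t).1, l)) (s := Icc δ t₁)
    ((hφ.contDiffOn.continuousOn_fderiv_of_isOpen isOpen_strip (by norm_cast; omega)).comp
      (continuousOn_id.prodMk ((hY.cont.mono hsub).fst.prodMk continuousOn_const)) hmem)
  have hC0 : 0 ≤ C := (norm_nonneg _).trans (hC t₁ (right_mem_Icc.2 hδ.2.le))
  have h1 := norm_le_exp_abs_of_norm_deriv_le (f := fun t => (Y t).2 - φ t (Y t).1 l)
    (f' := fun t => (clampField zb η (velocity u w) t (Y t)).2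
      - fderiv ℝ Φ (t, (Y t).1, l) (1, (clampField zb η (velocity u w) t (Y t)).1, 0))
    (K := (1 + C) * lipConst L) (a := δ) (b := t₁) (by rw [lipConst]; positivity)
    (hec.mono hsub) (fun t ht => ?_) (fun t ht => ?_) (x := δ) (y := t₁)
    (left_mem_Icc.2 hδ.2.le) (right_mem_Icc.2 hδ.2.le)
  · simpa [hYt₁] using h1
  · have h2 := hY.hasDerivAt t ⟨hδ.1.trans ht.1, ht.2⟩
    have h3 : HasDerivAt (fun t => (Y t).1) (clampField zb η (velocity u w) t (Y t)).1 t :=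
      (ContinuousLinearMap.fst ℝ (Space d) ℝ).hasFDerivAt.comp_hasDerivAt t h2
    have h4 : HasDerivAt (fun t => (Y t).2) (clampField zb η (velocity u w) t (Y t)).2 t :=
      (ContinuousLinearMap.snd ℝ (Space d) ℝ).hasFDerivAt.comp_hasDerivAt t h2
    exact h4.sub (HasFDerivAt.comp_hasDerivAt (l := Φ) (f := fun t => (t, (Y t).1, l)) t
      (hφ.hasFDerivAt (hmem t (Ioo_subset_Icc_self ht)))
      ((hasDerivAt_id t).prodMk (h3.prodMk (hasDerivAt_const t l))))
  · have ht' : t ∈ Icc δ t₁ := Ioo_subset_Icc_self ht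
    set D := fderiv ℝ Φ (t, (Y t).1, l) with hD
    set a := clampField zb η (velocity u w) t (Y t) with ha
    set b := clampField zb η (velocity u w) t ((Y t).1, φ t (Y t).1 l) with hb
    have h2 : D (1, b.1, 0) = b.2 := by
      have h3 := hφ.mem_fluid _ _ _ (hmem t ht')
      rw [hb, IsFluid.clampField_eq ⟨h3.2.2.1.le, h3.2.2.2.le⟩]
      exact hφ.fderiv_apply (hmem t ht')
    have h3 : a.2 - D (1, a.1, 0) = (a - b).2 - D (0, (a - b).1, 0) := by
      have h4 : ((1 : ℝ), a.1, (0 : ℝ)) = (1, b.1, 0) + (0, (a - b).1, 0) := by simp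
      rw [h4, map_add, h2, Prod.snd_sub]; ring
    have h5 : ‖D (0, (a - b).1, 0)‖ ≤ C * ‖a - b‖ := by
      refine ContinuousLinearMap.le_of_opNorm_le_of_le _ (hC t ht') ?_
      simp [Prod.norm_def]
    have h6 : ‖(a - b).2‖ ≤ ‖a - b‖ := norm_snd_le _
    have h7 : ‖Y t - ((Y t).1, φ t (Y t).1 l)‖ = ‖(Y t).2 - φ t (Y t).1 l‖ := by
      simp [Prod.norm_def]
    have h8 := h.norm_clampField_sub_le ht₁T hpos ht₁.1 (hsub ht') (Y t)
      ((Y t).1, φ t (Y t).1 l)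
    rw [h7] at h8
    change ‖a.2 - D (1, a.1, 0)‖ ≤ _
    rw [h3]
    calc ‖(a - b).2 - D (0, (a - b).1, 0)‖ ≤ ‖a - b‖ + C * ‖a - b‖ :=
          (norm_sub_le _ _).trans (add_le_add h6 h5)
      _ = (1 + C) * ‖a - b‖ := by ring
      _ ≤ (1 + C) * (lipConst L * ‖(Y t).2 - φ t (Y t).1 l‖) := by gcongr
      _ = _ := by ring

theorem zero_eq (hφ : IsChangeOfVariable (n + 1) T' zb η u w φ₀ φ) {t₁ l : ℝ} (ht₁ : 0 ≤ t₁)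
    (hl : l ∈ Ioo (0 : ℝ) 1) {Y : ℝ → Space d × ℝ}
    (hY : ∀ t ∈ Icc 0 t₁, (Y t).2 = φ t (Y t).1 l) :
    Y 0 = initialPosition φ₀ ((Y 0).1, l) := by
  refine Prod.ext rfl ?_
  rw [hY 0 (left_mem_Icc.2 ht₁), hφ.init _ _ hl]
  rfl

variable (hφ : IsChangeOfVariable (n + 1) T' zb η u w φ₀ φ)
  (h : IsFluid T L zb η (velocity u w)) (h0 : IsInitialHeight c M zb η φ₀) (hT' : T' ≤ T)

include hφ h h0 hT'

theorem abs_eta_sub_le {t l : ℝ} (ht : t ∈ Ioo 0 T') (x : Space d) (hl : l ∈ Ioo (0 : ℝ) 1) :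
    |η t x - φ t x l| ≤ M * Real.exp (gapConst L * t) * (1 - l) := by
  obtain ⟨Y, hY, hYt, hYφ⟩ := hφ.exists_trajectory h h0 hT' ht x hl
  have h1 := h.abs_surface_gap_le (ht.2.trans_le hT')
    (fun τ hτ x => hφ.depth_pos h0 ⟨hτ.1, hτ.2.trans_lt ht.2⟩ x) hY (right_mem_Icc.2 ht.1.le)
    (left_mem_Icc.2 ht.1.le)
  have h2 := h0.abs_sub_le (Y 0).1 (right_mem_Icc.2 zero_le_one) (Ioo_subset_Icc_self hl)
  rw [h0.top, abs_of_pos (sub_pos.2 hl.2)] at h2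
  rw [hYt, hYφ 0 (left_mem_Icc.2 ht.1.le), hφ.init _ _ hl, sub_zero, abs_of_pos ht.1] at h1
  refine h1.trans ?_
  calc _ ≤ M * (1 - l) * Real.exp (gapConst L * t) := by gcongr
    _ = _ := by ring

theorem abs_sub_bottom_le {t l : ℝ} (ht : t ∈ Ioo 0 T') (x : Space d) (hl : l ∈ Ioo (0 : ℝ) 1) :
    |φ t x l - zb x| ≤ M * Real.exp (gapConst L * t) * l := by
  obtain ⟨Y, hY, hYt, hYφ⟩ := hφ.exists_trajectory h h0 hT' ht x hl
  have h1 := h.abs_bottom_gap_le (ht.2.trans_le hT')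
    (fun τ hτ x => hφ.depth_pos h0 ⟨hτ.1, hτ.2.trans_lt ht.2⟩ x) hY (right_mem_Icc.2 ht.1.le)
    (left_mem_Icc.2 ht.1.le)
  have h2 := h0.abs_sub_le (Y 0).1 (Ioo_subset_Icc_self hl) (left_mem_Icc.2 zero_le_one)
  rw [h0.bot, sub_zero, abs_of_pos hl.1] at h2
  rw [hYt, hYφ 0 (left_mem_Icc.2 ht.1.le), hφ.init _ _ hl, sub_zero, abs_of_pos ht.1] at h1
  refine h1.trans ?_
  calc _ ≤ M * l * Real.exp (gapConst L * t) := by gcongr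
    _ = _ := by ring

/-- Distinct `λ` remain at distinct heights, by backward uniqueness of the trajectories. -/
theorem injOn_height {t : ℝ} (ht : t ∈ Ioo 0 T') (x : Space d) :
    InjOn (φ t x) (Ioo 0 1) := by
  intro l hl l' hl' he
  obtain ⟨Y, hY, hYt, hYφ⟩ := hφ.exists_trajectory h h0 hT' ht x hl
  obtain ⟨Y', hY', hYt', hYφ'⟩ := hφ.exists_trajectory h h0 hT' ht x hl'
  have h1 : Y 0 = Y' 0 := IsTrajectory.eq_of_eq (ht.2.trans_le hT')
    (fun τ hτ x => hφ.depth_pos h0 ⟨hτ.1, hτ.2.trans_lt ht.2⟩ x) h hY hY' ht.1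
    (right_mem_Icc.2 ht.1.le) (by rw [hYt, hYt', he]) (left_mem_Icc.2 ht.1.le)
  have h2 := hφ.zero_eq ht.1.le hl hYφ
  have h3 := hφ.zero_eq ht.1.le hl' hYφ'
  rw [← h1] at h3
  exact (h0.strictMonoOn (Y 0).1).injOn (Ioo_subset_Icc_self hl) (Ioo_subset_Icc_self hl')
    (congrArg Prod.snd (h2.symm.trans h3))

omit hφ h h0 hT' in
/-- A function that is continuous and injective on `(0, 1)`, with values in `(a, b)`, and that tends
to `a` at `0` and to `b` at `1`, has a nonnegative and integrable derivative with integral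
`b - a`. -/
theorem integral_deriv_of_injOn {g g' : ℝ → ℝ} {a b K : ℝ}
    (hg : ∀ l ∈ Ioo (0 : ℝ) 1, HasDerivAt g (g' l) l) (hinj : InjOn g (Ioo 0 1))
    (hmem : ∀ l ∈ Ioo (0 : ℝ) 1, g l ∈ Ioo a b) (h0 : ∀ l ∈ Ioo (0 : ℝ) 1, |g l - a| ≤ K * l)
    (h1 : ∀ l ∈ Ioo (0 : ℝ) 1, |b - g l| ≤ K * (1 - l)) :
    MeasureTheory.IntegrableOn g' (Ioo 0 1) ∧ ∫ l in (0 : ℝ)..1, g' l = b - a := by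
  classical
  set G : ℝ → ℝ := fun l => if l ≤ 0 then a else if 1 ≤ l then b else g l with hG
  have hG0 : G 0 = a := by simp [hG]
  have hG1 : G 1 = b := by simp [hG]
  have hGg : ∀ l ∈ Ioo (0 : ℝ) 1, G l = g l := fun l hl => by
    simp [hG, not_le.2 hl.1, not_le.2 hl.2]
  have hGd : ∀ l ∈ Ioo (0 : ℝ) 1, HasDerivAt G (g' l) l := fun l hl =>
    (hg l hl).congr_of_eventuallyEq
      (by filter_upwards [Ioo_mem_nhds hl.1 hl.2] with l' hl' using hGg l' hl')
  have hab : a < b := by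
    have := hmem (1 / 2) (by norm_num)
    exact this.1.trans this.2
  have hcases : ∀ l ∈ Icc (0 : ℝ) 1, l = 0 ∨ l = 1 ∨ l ∈ Ioo (0 : ℝ) 1 := fun l hl => by
    rcases hl.1.eq_or_lt with h | h
    · exact Or.inl h.symm
    · rcases hl.2.eq_or_lt with h' | h'
      · exact Or.inr (Or.inl h')
      · exact Or.inr (Or.inr ⟨h, h'⟩)
  have hGc : ContinuousOn G (Icc 0 1) := by
    intro l hl
    rcases hcases l hl with rfl | rfl | hl
    · rw [ContinuousWithinAt, hG0, tendsto_iff_norm_sub_tendsto_zero]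
      refine squeeze_zero' (g := fun l => |K| * l) (Eventually.of_forall fun _ => norm_nonneg _)
        ?_ ?_
      · filter_upwards [self_mem_nhdsWithin, mem_nhdsWithin_of_mem_nhds (Iio_mem_nhds one_pos)]
          with l hl hl1
        rcases hcases l hl with rfl | rfl | hl
        · simp [hG0]
        · exact absurd hl1 (lt_irrefl (1:ℝ))
        · rw [hGg l hl]
          exact (h0 l hl).trans (mul_le_mul_of_nonneg_right (le_abs_self K) hl.1.le)
      · have : Continuous fun l : ℝ => |K| * l := by fun_prop
        simpa using (this.tendsto 0).mono_left (nhdsWithin_le_nhds (s := Icc 0 1))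
    · rw [ContinuousWithinAt, hG1, tendsto_iff_norm_sub_tendsto_zero]
      refine squeeze_zero' (g := fun l => |K| * (1 - l))
        (Eventually.of_forall fun _ => norm_nonneg _) ?_ ?_
      · filter_upwards [self_mem_nhdsWithin, mem_nhdsWithin_of_mem_nhds (Ioi_mem_nhds one_pos)]
          with l hl hl1
        rcases hcases l hl with rfl | rfl | hl
        · exact absurd hl1 (lt_irrefl (0:ℝ))
        · simp [hG1]
        · rw [hGg l hl, norm_sub_rev]
          exact (h1 l hl).trans
            (mul_le_mul_of_nonneg_right (le_abs_self K) (sub_pos.2 hl.2).le)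
      · have : Continuous fun l : ℝ => |K| * (1 - l) := by fun_prop
        simpa using (this.tendsto 1).mono_left (nhdsWithin_le_nhds (s := Icc 0 1))
    · exact (hGd l hl).continuousAt.continuousWithinAt
  have hGi : InjOn G (Icc 0 1) := by
    intro l hl l' hl' he
    rcases hcases l hl with rfl | rfl | hl <;> rcases hcases l' hl' with rfl | rfl | hl'
    · rfl
    · rw [hG0, hG1] at he; exact absurd he hab.ne
    · rw [hG0, hGg l' hl'] at he; exact absurd he (hmem l' hl').1.ne
    · rw [hG0, hG1] at he; exact absurd he hab.ne'
    · rfl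
    · rw [hG1, hGg l' hl'] at he; exact absurd he (hmem l' hl').2.ne'
    · rw [hG0, hGg l hl] at he; exact absurd he (hmem l hl).1.ne'
    · rw [hG1, hGg l hl] at he; exact absurd he (hmem l hl).2.ne
    · rw [hGg l hl, hGg l' hl'] at he; exact hinj hl hl' he
  have hmono : StrictMonoOn G (Icc 0 1) :=
    hGc.strictMonoOn_of_injOn_Icc zero_le_one (by rw [hG0, hG1]; exact hab.le) hGi
  have hg'0 : ∀ l ∈ Ioo (0 : ℝ) 1, 0 ≤ g' l := fun l hl => by
    rw [← (hGd l hl).deriv, ← derivWithin_of_mem_nhds (Icc_mem_nhds hl.1 hl.2)]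
    exact hmono.monotoneOn.derivWithin_nonneg
  have hint := intervalIntegral.integrableOn_deriv_of_nonneg hGc hGd hg'0
  refine ⟨hint.mono_set Ioo_subset_Ioc_self, ?_⟩
  rw [intervalIntegral.integral_eq_sub_of_hasDerivAt_of_le zero_le_one hGc hGd
    ((intervalIntegrable_iff_integrableOn_Ioc_of_le zero_le_one).2 hint), hG0, hG1]

/-- The vertical derivative of `φ` is integrable, and its integral is the depth. -/
theorem integral_deriv {t : ℝ} (ht : t ∈ Ioo 0 T') (x : Space d) :
    MeasureTheory.IntegrableOn (fun l => deriv (fun l' => φ t x l') l) (Ioo (0 : ℝ) 1) ∧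
      ∫ l in (0 : ℝ)..1, deriv (fun l' => φ t x l') l = η t x - zb x :=
  integral_deriv_of_injOn
    (fun _ hl => (hφ.hasDerivAt_height ⟨ht.1, ht.2, hl⟩).differentiableAt.hasDerivAt)
    (hφ.injOn_height h h0 hT' ht x) (fun _ hl => hφ.mem_Ioo h0 ⟨ht.1.le, ht.2⟩ x hl)
    (fun _ hl => hφ.abs_sub_bottom_le h h0 hT' ht x hl)
    (fun _ hl => hφ.abs_eta_sub_le h h0 hT' ht x hl)

/-- For small times, `∂_λ φ` is close to `∂_λ φ₀` at the initial position of the particle. This is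
read off from the difference quotients, without differentiating the particle flow. -/
theorem abs_deriv_sub_le {t l : ℝ} (ht : t ∈ Ioo 0 T') (hN : rateConst T L M * t ≤ 1 / 2)
    (x : Space d) (hl : l ∈ Ioo (0 : ℝ) 1) :
    ∃ x₀, ‖x₀ - x‖ ≤ L * t ∧
      |deriv (fun l' => φ t x l') l - deriv (fun l' => φ₀ x₀ l') l|
        ≤ (1 + M) * rateConst T L M * t := by
  have hM := h0.nonneg
  set N := rateConst T L M with hNdef
  have hN0 : 0 ≤ N := rateConst_nonneg h.nonneg hM
  have htT := ht.2.trans_le hT'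
  have ht' : t ∈ Icc 0 t := right_mem_Icc.2 ht.1.le
  have hpos : ∀ τ ∈ Icc 0 t, ∀ x, zb x < η τ x := fun τ hτ x =>
    hφ.depth_pos h0 ⟨hτ.1, hτ.2.trans_lt ht.2⟩ x
  obtain ⟨Y, hY, hYt, hYφ⟩ := hφ.exists_trajectory h h0 hT' ht x hl
  have hY0 := hφ.zero_eq ht.1.le hl hYφ
  set x₀ := (Y 0).1 with hx₀
  refine ⟨x₀, ?_, ?_⟩
  · have h1 := IsTrajectory.norm_sub_zero_le htT hpos h hY ht'
    rw [hYt, norm_sub_rev] at h1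
    exact (norm_fst_le (Y 0 - (x, φ t x l))).trans h1
  · have hd1 := (hφ.hasDerivAt_height (t := t) (x := x)
      ⟨ht.1, ht.2, hl⟩).differentiableAt.hasDerivAt
    have hd2 := (h0.hasDerivAt x₀ hl).differentiableAt.hasDerivAt
    have hd := (hd1.sub hd2).hasFDerivAt
    have h1 := hd.le_of_lip' (C := (1 + M) * N * t) (by have := ht.1; positivity) (by
      filter_upwards [Ioo_mem_nhds hl.1 hl.2] with l' hl'
      obtain ⟨Y', hY', hYt', hYφ'⟩ := hφ.exists_trajectory h h0 hT' ht x hl'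
      have hY0' := hφ.zero_eq ht.1.le hl' hYφ'
      set x₀' := (Y' 0).1 with hx₀'
      have h2 := h0.norm_sub_sub_le h htT hpos hY' hY (p := (x₀', l')) (p' := (x₀, l)) hl' hl
        hY0' hY0 ht'
      rw [hYt, hYt', ← hNdef] at h2
      have hfst : ‖x₀' - x₀‖ ≤ N * t * ‖(x₀', l') - (x₀, l)‖ := by
        have h3 := (norm_fst_le _).trans h2
        simpa [initialPosition, norm_sub_rev] using h3
      have hsnd : |φ t x l' - φ t x l - (φ₀ x₀' l' - φ₀ x₀ l)|
          ≤ N * t * ‖(x₀', l') - (x₀, l)‖ := by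
        have h3 := (norm_snd_le _).trans h2
        simpa [initialPosition] using h3
      have hp : ‖(x₀', l') - (x₀, l)‖ ≤ |l' - l| := by
        refine norm_prod_le_iff.2 ⟨?_, le_rfl⟩
        simp only [Prod.fst_sub]
        rcases le_total ‖x₀' - x₀‖ |l' - l| with h4 | h4
        · exact h4
        · have h5 : ‖(x₀', l') - (x₀, l)‖ = ‖x₀' - x₀‖ := by
            rw [Prod.norm_def]; exact max_eq_left h4
          rw [h5] at hfst
          have h6 : N * t * ‖x₀' - x₀‖ ≤ 1 / 2 * ‖x₀' - x₀‖ := by gcongr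
          linarith [abs_nonneg (l' - l)]
      have hNt : 0 ≤ N * t := mul_nonneg hN0 ht.1.le
      have hfst' := hfst.trans (mul_le_mul_of_nonneg_left hp hNt)
      have hsnd' := hsnd.trans (mul_le_mul_of_nonneg_left hp hNt)
      have h7 : |φ₀ x₀' l' - φ₀ x₀ l'| ≤ M * ‖x₀' - x₀‖ := by
        have h8 := h0.abs_sub_le_norm (p := (x₀', l')) (p' := (x₀, l')) hl' hl'
        simpa [Prod.norm_def] using h8
      have h9 : M * ‖x₀' - x₀‖ ≤ M * (N * t * |l' - l|) := by gcongr
      have h10 : (φ t x l' - φ₀ x₀ l') - (φ t x l - φ₀ x₀ l)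
          = (φ t x l' - φ t x l - (φ₀ x₀' l' - φ₀ x₀ l)) + (φ₀ x₀' l' - φ₀ x₀ l') := by ring
      simp only [Pi.sub_apply, Real.norm_eq_abs]
      rw [h10]
      refine (abs_add_le _ _).trans ((add_le_add hsnd' (h7.trans h9)).trans (le_of_eq ?_))
      ring)
    simpa using h1

end IsChangeOfVariable

end

/-! ### The transformed equations -/

section

variable {d n : ℕ} {g T T' L c M : ℝ} {zb η₀ : Space d → ℝ} {u₀ : Space d → ℝ → Space d}
  {η : ℝ → Space d → ℝ}
  {u : ℝ → Space d → ℝ → Space d} {w : ℝ → Space d → ℝ → ℝ} {φ₀ : Space d → ℝ → ℝ}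
  {φ : ℝ → Space d → ℝ → ℝ}

namespace IsChangeOfVariable

theorem mem_fluidDomain (hφ : IsChangeOfVariable (n + 1) T' zb η u w φ₀ φ) (hT' : T' ≤ T)
    {q : ℝ × Space d × ℝ} (hq : q ∈ strip d T') :
    (q.1, q.2.1, φ q.1 q.2.1 q.2.2) ∈ fluidDomain T zb η := by
  have h := hφ.mem_fluid q.1 q.2.1 q.2.2 hq
  exact ⟨h.1, h.2.1.trans_le hT', h.2.2⟩

theorem contDiffOn_position (hφ : IsChangeOfVariable (n + 1) T' zb η u w φ₀ φ) :
    ContDiffOn ℝ (n + 1 : ℕ)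
      (fun q : ℝ × Space d × ℝ => (q.1, q.2.1, φ q.1 q.2.1 q.2.2)) (strip d T') :=
  contDiff_fst.contDiffOn.prodMk ((contDiff_fst.comp contDiff_snd).contDiffOn.prodMk hφ.contDiffOn)

theorem contDiffOn_velocity (hφ : IsChangeOfVariable (n + 1) T' zb η u w φ₀ φ) (hT' : T' ≤ T)
    (hu : ContDiffOn ℝ (n + 1 : ℕ) (fun p : ℝ × Space d × ℝ => u p.1 p.2.1 p.2.2)
      (fluidDomain T zb η)) :
    ContDiffOn ℝ (n + 1 : ℕ)
      (fun q : ℝ × Space d × ℝ => u q.1 q.2.1 (φ q.1 q.2.1 q.2.2)) (strip d T') :=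
  hu.comp (f := fun q : ℝ × Space d × ℝ => (q.1, q.2.1, φ q.1 q.2.1 q.2.2))
    hφ.contDiffOn_position fun _ hq => hφ.mem_fluidDomain hT' hq

theorem contDiffOn_fderiv (hφ : IsChangeOfVariable (n + 1) T' zb η u w φ₀ φ) :
    ContDiffOn ℝ n (fderiv ℝ (fun p : ℝ × Space d × ℝ => φ p.1 p.2.1 p.2.2)) (strip d T') :=
  hφ.contDiffOn.fderiv_of_isOpen isOpen_strip (by norm_cast)

theorem contDiffOn_thickness (hφ : IsChangeOfVariable (n + 1) T' zb η u w φ₀ φ) :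
    ContDiffOn ℝ n (fun p : ℝ × Space d × ℝ => deriv (fun l' => φ p.1 p.2.1 l') p.2.2)
      (strip d T') :=
  (hφ.contDiffOn_fderiv.clm_apply contDiffOn_const).congr fun _ hp =>
    (hφ.hasDerivAt_height hp).deriv

theorem hasFDerivAt_position (hφ : IsChangeOfVariable (n + 1) T' zb η u w φ₀ φ)
    {q : ℝ × Space d × ℝ} (hq : q ∈ strip d T') :
    HasFDerivAt (fun q : ℝ × Space d × ℝ => (q.1, q.2.1, φ q.1 q.2.1 q.2.2))
      ((ContinuousLinearMap.fst ℝ ℝ (Space d × ℝ)).prod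
        (((ContinuousLinearMap.fst ℝ (Space d) ℝ).comp
          (ContinuousLinearMap.snd ℝ ℝ (Space d × ℝ))).prod
        (fderiv ℝ (fun p : ℝ × Space d × ℝ => φ p.1 p.2.1 p.2.2) q))) q :=
  hasFDerivAt_fst.prodMk ((hasFDerivAt_fst.comp q hasFDerivAt_snd).prodMk (hφ.hasFDerivAt hq))

/-- The chain rule for a field on the fluid domain, in the new variables. -/
theorem hasFDerivAt_comp_position (hφ : IsChangeOfVariable (n + 1) T' zb η u w φ₀ φ)
    {F : Type*} [NormedAddCommGroup F] [NormedSpace ℝ F] {f : ℝ × Space d × ℝ → F}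
    {q : ℝ × Space d × ℝ} (hq : q ∈ strip d T')
    (hf : DifferentiableAt ℝ f (q.1, q.2.1, φ q.1 q.2.1 q.2.2)) :
    HasFDerivAt (fun q : ℝ × Space d × ℝ => f (q.1, q.2.1, φ q.1 q.2.1 q.2.2))
      ((fderiv ℝ f (q.1, q.2.1, φ q.1 q.2.1 q.2.2)).comp
        ((ContinuousLinearMap.fst ℝ ℝ (Space d × ℝ)).prod
        (((ContinuousLinearMap.fst ℝ (Space d) ℝ).comp
          (ContinuousLinearMap.snd ℝ ℝ (Space d × ℝ))).prod
        (fderiv ℝ (fun p : ℝ × Space d × ℝ => φ p.1 p.2.1 p.2.2) q)))) q :=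
  HasFDerivAt.comp q hf.hasFDerivAt (hφ.hasFDerivAt_position hq)

/-- Conservation of mass: differentiating the equation for `φ` in `λ` and exchanging the second
derivatives of `φ` gives `∂_t H + u · ∇H + H (∂_z u · ∇φ - ∂_z w) = 0`, while
`∇ · ũ = ∇ · u + ∂_z u · ∇φ`; incompressibility concludes. -/
theorem mass (hφ : IsChangeOfVariable (n + 1) T' zb η u w φ₀ φ) (hn : 1 ≤ n) {t l : ℝ}
    {x : Space d} (hq : (t, x, l) ∈ strip d T')
    (hu : DifferentiableAt ℝ (fun p : ℝ × Space d × ℝ => u p.1 p.2.1 p.2.2) (t, x, φ t x l))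
    (hw : DifferentiableAt ℝ (fun p : ℝ × Space d × ℝ => w p.1 p.2.1 p.2.2) (t, x, φ t x l))
    (hinc : div (fun y => u t y (φ t x l)) x + deriv (fun ζ => w t x ζ) (φ t x l) = 0) :
    deriv (fun τ => deriv (fun l' => φ τ x l') l) t
      + div (fun y => deriv (fun l' => φ t y l') l • u t y (φ t y l)) x = 0 := by
  set Φ : ℝ × Space d × ℝ → ℝ := fun p => φ p.1 p.2.1 p.2.2 with hΦ
  set U : ℝ × Space d × ℝ → Space d := fun p => u p.1 p.2.1 p.2.2 with hU
  set W : ℝ × Space d × ℝ → ℝ := fun p => w p.1 p.2.1 p.2.2 with hW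
  set q : ℝ × Space d × ℝ := (t, x, l) with hqdef
  set V : ℝ × Space d × ℝ → Space d := fun p => U (p.1, p.2.1, Φ p) with hV
  set J : ℝ × Space d × ℝ → ℝ := fun p => deriv (fun l' => φ p.1 p.2.1 l') p.2.2 with hJ
  have hnhds : ∀ᶠ p in 𝓝 q, p ∈ strip d T' := isOpen_strip.mem_nhds hq
  have hVd := hφ.hasFDerivAt_comp_position (f := U) hq hu
  have hWd := hφ.hasFDerivAt_comp_position (f := W) hq hw
  have hDd : HasFDerivAt (fderiv ℝ Φ) (fderiv ℝ (fderiv ℝ Φ) q) q :=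
    ((hφ.contDiffOn_fderiv.contDiffAt hnhds).differentiableAt
      (by norm_cast; omega)).hasFDerivAt
  have hJe : J =ᶠ[𝓝 q] fun p => fderiv ℝ Φ p (0, 0, 1) := by
    filter_upwards [hnhds] with p hp using (hφ.hasDerivAt_height hp).deriv
  have hJd : HasFDerivAt J ((fderiv ℝ (fderiv ℝ Φ) q).flip (0, 0, 1)) q := by
    refine HasFDerivAt.congr_of_eventuallyEq ?_ hJe
    have h := hDd.clm_apply (hasFDerivAt_const ((0 : ℝ), (0 : Space d), (1 : ℝ)) q)
    rwa [ContinuousLinearMap.comp_zero, zero_add] at h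
  have hJq : J q = fderiv ℝ Φ q (0, 0, 1) := hJe.self_of_nhds
  -- the equation, differentiated in the direction of `λ`
  have hdir : HasFDerivAt (fun p => ((1 : ℝ), V p, (0 : ℝ))) _ q :=
    (hasFDerivAt_const (1 : ℝ) q).prodMk (hVd.prodMk (hasFDerivAt_const (0 : ℝ) q))
  have heq : (fun p => fderiv ℝ Φ p (1, V p, 0)) =ᶠ[𝓝 q] fun p => W (p.1, p.2.1, Φ p) := by
    filter_upwards [hnhds] with p hp using hφ.fderiv_apply hp
  have h1 := (hDd.clm_apply hdir).unique (hWd.congr_of_eventuallyEq heq)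
  have hsymm : fderiv ℝ (fderiv ℝ Φ) q (0, 0, 1) (1, V q, 0)
      = fderiv ℝ (fderiv ℝ Φ) q (1, V q, 0) (0, 0, 1) :=
    ((hφ.contDiffOn.contDiffAt hnhds).isSymmSndFDerivAt
      (by simp only [minSmoothness_of_isRCLikeNormedField]; norm_cast; omega)) _ _
  set A := fderiv ℝ U (t, x, φ t x l) with hA
  set B := fderiv ℝ W (t, x, φ t x l) with hB
  have hA3 : ∀ r : ℝ, A (0, 0, r) = r • A (0, 0, 1) := fun r => by
    rw [← map_smul]; simp
  have hB3 : ∀ r : ℝ, B (0, 0, r) = r * B (0, 0, 1) := fun r => by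
    rw [← smul_eq_mul, ← map_smul]; simp
  have h2 : fderiv ℝ (fderiv ℝ Φ) q (1, V q, 0) (0, 0, 1)
      + J q * fderiv ℝ Φ q (0, A (0, 0, 1), 0) = J q * B (0, 0, 1) := by
    have h3 : ∀ (r : ℝ) (a : Space d), fderiv ℝ Φ q (0, r • a, 0) = r * fderiv ℝ Φ q (0, a, 0) :=
      fun r a => by rw [← smul_eq_mul, ← map_smul]; simp
    have h4 : fderiv ℝ Φ q (0, A (0, 0, fderiv ℝ Φ q (0, 0, 1)), 0)
        + fderiv ℝ (fderiv ℝ Φ) q (0, 0, 1) (1, V q, 0) = B (0, 0, fderiv ℝ Φ q (0, 0, 1)) :=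
      congrArg (fun A => A ((0 : ℝ), (0 : Space d), (1 : ℝ))) h1
    rw [← hsymm, hJq, ← h3, ← hB3, ← hA3, add_comm]
    exact h4
  -- the divergence in the new variables
  have hu1 : div (fun y => u t y (φ t x l)) x = ∑ i, (A (0, EuclideanSpace.single i 1, 0)) i :=
    Finset.sum_congr rfl fun i _ => by rw [fderiv_horizontal (f := U) hu]
  have hw1 : deriv (fun ζ => w t x ζ) (φ t x l) = B (0, 0, 1) :=
    (hasDerivAt_vertical (f := W) hw).deriv
  have hv1 : div (fun y => V (t, y, l)) x = div (fun y => u t y (φ t x l)) x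
      + fderiv ℝ Φ q (0, A (0, 0, 1), 0) := by
    have h3 := sum_apply_single_mul ((fderiv ℝ Φ q).comp
      ((ContinuousLinearMap.inr ℝ ℝ (Space d × ℝ)).comp
        (ContinuousLinearMap.inl ℝ (Space d) ℝ))) (A (0, 0, 1))
    simp only [ContinuousLinearMap.comp_apply, ContinuousLinearMap.inr_apply,
      ContinuousLinearMap.inl_apply] at h3
    rw [hu1, ← h3, ← Finset.sum_add_distrib, div]
    refine Finset.sum_congr rfl fun i _ => ?_
    rw [fderiv_horizontal (f := V) hVd.differentiableAt, hVd.fderiv]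
    have h4 : ((0 : ℝ), (EuclideanSpace.single i (1 : ℝ) : Space d),
        fderiv ℝ Φ q (0, EuclideanSpace.single i 1, 0))
        = (0, EuclideanSpace.single i 1, 0)
          + (0, 0, fderiv ℝ Φ q (0, EuclideanSpace.single i 1, 0)) := by simp
    change (A (0, EuclideanSpace.single i 1, fderiv ℝ Φ q (0, EuclideanSpace.single i 1, 0))) i = _
    rw [h4, map_add, hA3]
    simp
  have hJ1 : deriv (fun τ => J (τ, x, l)) t = fderiv ℝ (fderiv ℝ Φ) q (1, 0, 0) (0, 0, 1) := by
    rw [(hasDerivAt_time (f := J) hJd.differentiableAt).deriv, hJd.fderiv]; rfl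
  have hJ2 : div (fun y => J (t, y, l) • V (t, y, l)) x
      = fderiv ℝ (fderiv ℝ Φ) q (0, V q, 0) (0, 0, 1)
        + J q * div (fun y => V (t, y, l)) x := by
    rw [div_smul (hasFDerivAt_horizontal (f := J) hJd.differentiableAt).differentiableAt
      (hasFDerivAt_horizontal (f := V) hVd.differentiableAt).differentiableAt,
      fderiv_horizontal (f := J) hJd.differentiableAt, hJd.fderiv]
    rfl
  have hsplit : fderiv ℝ (fderiv ℝ Φ) q (1, V q, 0) (0, 0, 1)
      = fderiv ℝ (fderiv ℝ Φ) q (1, 0, 0) (0, 0, 1)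
        + fderiv ℝ (fderiv ℝ Φ) q (0, V q, 0) (0, 0, 1) := by
    rw [← add_apply, ← map_add]; simp
  change deriv (fun τ => J (τ, x, l)) t + div (fun y => J (t, y, l) • V (t, y, l)) x = 0
  rw [hJ1, hJ2, hv1]
  rw [hw1] at hinc
  rw [hsplit] at h2
  linear_combination h2 + J q * hinc

/-- The material derivative of `ũ` is that of `u` at the position of the particle. -/
theorem material_deriv (hφ : IsChangeOfVariable (n + 1) T' zb η u w φ₀ φ) {t l : ℝ}
    {x : Space d} (hq : (t, x, l) ∈ strip d T')
    (hu : DifferentiableAt ℝ (fun p : ℝ × Space d × ℝ => u p.1 p.2.1 p.2.2) (t, x, φ t x l)) :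
    deriv (fun τ => u τ x (φ τ x l)) t
      + fderiv ℝ (fun y => u t y (φ t y l)) x (u t x (φ t x l))
      = deriv (fun τ => u τ x (φ t x l)) t
        + fderiv ℝ (fun y => u t y (φ t x l)) x (u t x (φ t x l))
        + w t x (φ t x l) • deriv (fun ζ => u t x ζ) (φ t x l) := by
  set U : ℝ × Space d × ℝ → Space d := fun p => u p.1 p.2.1 p.2.2 with hU
  have hVd := hφ.hasFDerivAt_comp_position (f := U) hq hu
  have h1 := (hasDerivAt_time (f := fun p => U (p.1, p.2.1, φ p.1 p.2.1 p.2.2))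
    hVd.differentiableAt).deriv
  have h2 := fderiv_horizontal (f := fun p => U (p.1, p.2.1, φ p.1 p.2.1 p.2.2))
    hVd.differentiableAt (u t x (φ t x l))
  have h3 := (hasDerivAt_time (f := U) hu).deriv
  have h4 := fderiv_horizontal (f := U) hu (u t x (φ t x l))
  have h5 := (hasDerivAt_vertical (f := U) hu).deriv
  simp only [hU] at h1 h2 h3 h4 h5
  rw [h1, h2, h3, h4, h5, ← map_add, ← map_add, ← map_smul, ← map_add, hVd.fderiv]
  simp [← hφ.fderiv_apply hq]
  rfl

end IsChangeOfVariable

end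

/-! ### The initial values and the system in the new variables -/

section

variable {d n : ℕ} {g T T' L c M : ℝ} {zb η₀ : Space d → ℝ} {u₀ : Space d → ℝ → Space d}
  {η : ℝ → Space d → ℝ}
  {u : ℝ → Space d → ℝ → Space d} {w : ℝ → Space d → ℝ → ℝ} {φ₀ : Space d → ℝ → ℝ}
  {φ : ℝ → Space d → ℝ → ℝ}

theorem gradient_sub {f h : Space d → ℝ} {x : Space d} (hf : DifferentiableAt ℝ f x)
    (hh : DifferentiableAt ℝ h x) :
    gradient (fun y => f y - h y) x = gradient f x - gradient h x := by
  rw [gradient, gradient, gradient, fderiv_fun_sub hf hh, map_sub]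

theorem continuousOn_deriv_initialHeight
    (hφ₀ : ContDiffOn ℝ (n + 1 : ℕ) (fun p : Space d × ℝ => φ₀ p.1 p.2) (params d)) :
    ContinuousOn (fun p : Space d × ℝ => deriv (fun l' => φ₀ p.1 l') p.2) (params d) := by
  refine ((hφ₀.continuousOn_fderiv_of_isOpen isOpen_params
    (by norm_cast; omega)).clm_apply
    (continuousOn_const (c := ((0 : Space d), (1 : ℝ))))).congr fun p hp => ?_
  have h1 : DifferentiableAt ℝ (fun p : Space d × ℝ => φ₀ p.1 p.2) p :=
    (hφ₀.contDiffAt (isOpen_params.mem_nhds hp)).differentiableAt (by norm_cast)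
  exact (HasFDerivAt.comp_hasDerivAt (l := fun p : Space d × ℝ => φ₀ p.1 p.2)
    (f := fun l' => (p.1, l')) p.2 h1.hasFDerivAt
    ((hasDerivAt_const p.2 p.1).prodMk (hasDerivAt_id p.2))).deriv

namespace IsChangeOfVariable

theorem deriv_zero (hφ : IsChangeOfVariable (n + 1) T' zb η u w φ₀ φ) (x : Space d) {l : ℝ}
    (hl : l ∈ Ioo (0 : ℝ) 1) :
    deriv (fun l' => φ 0 x l') l = deriv (fun l' => φ₀ x l') l := by
  refine Filter.EventuallyEq.deriv_eq ?_
  filter_upwards [Ioo_mem_nhds hl.1 hl.2] with l' hl' using hφ.init x l' hl'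

/-- The derivative `∂_λ φ` attains its initial value continuously. -/
theorem continuousOn_thickness (hφ : IsChangeOfVariable (n + 1) T' zb η u w φ₀ φ)
    (h : IsFluid T L zb η (velocity u w)) (h0 : IsInitialHeight c M zb η φ₀) (hT' : T' ≤ T)
    (hφ₀ : ContDiffOn ℝ (n + 1 : ℕ) (fun p : Space d × ℝ => φ₀ p.1 p.2) (params d)) :
    ContinuousOn (fun p : ℝ × Space d × ℝ => deriv (fun l' => φ p.1 p.2.1 l') p.2.2)
      (stripBar d T') := by
  rintro ⟨t, x, l⟩ ⟨ht0, ht, hl⟩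
  rcases ht0.eq_or_lt with ht0 | ht0
  swap
  · exact (hφ.contDiffOn_thickness.continuousOn.continuousAt
      (isOpen_strip.mem_nhds ⟨ht0, ht, hl⟩)).continuousWithinAt
  change 0 = t at ht0
  subst ht0
  set G : Space d × ℝ → ℝ := fun p => deriv (fun l' => φ₀ p.1 l') p.2 with hG
  set N := rateConst T L M with hN
  -- `ξ` is the initial horizontal position of the particle that is at `(x, φ(t, x, λ))` at time `t`
  have hξ : ∀ q : ℝ × Space d × ℝ, ∃ ξ : Space d, q ∈ stripBar d T' → N * q.1 ≤ 1 / 2 →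
      ‖ξ - q.2.1‖ ≤ L * q.1 ∧
        |deriv (fun l' => φ q.1 q.2.1 l') q.2.2 - G (ξ, q.2.2)| ≤ (1 + M) * N * q.1 := by
    rintro ⟨t, y, m⟩
    by_cases hq : (t, y, m) ∈ stripBar d T' ∧ N * t ≤ 1 / 2
    · rcases hq.1.1.eq_or_lt with h1 | h1
      · change 0 = t at h1
        subst h1
        refine ⟨y, fun _ _ => ⟨by simp, ?_⟩⟩
        have h2 := hφ.deriv_zero y hq.1.2.2
        simp only [hG]
        rw [h2]; simp
      · obtain ⟨ξ, hξ⟩ := hφ.abs_deriv_sub_le h h0 hT' ⟨h1, hq.1.2.1⟩ hq.2 y hq.1.2.2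
        exact ⟨ξ, fun _ _ => hξ⟩
    · exact ⟨y, fun h1 h2 => absurd ⟨h1, h2⟩ hq⟩
  choose ξ hξ using hξ
  set F := 𝓝[stripBar d T'] ((0 : ℝ), x, l) with hF
  have hid : Tendsto (fun q : ℝ × Space d × ℝ => q) F (𝓝 (0, x, l)) :=
    tendsto_id.mono_left nhdsWithin_le_nhds
  have htime : Tendsto (fun q : ℝ × Space d × ℝ => q.1) F (𝓝 0) := hid.fst_nhds
  have hsmall : ∀ᶠ q in F, q ∈ stripBar d T' ∧ N * q.1 ≤ 1 / 2 := by
    have h1 : Tendsto (fun q : ℝ × Space d × ℝ => N * q.1) F (𝓝 (N * 0)) := htime.const_mul N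
    exact Filter.Eventually.and self_mem_nhdsWithin (h1.eventually (Iic_mem_nhds (by norm_num)))
  have hξ0 : Tendsto (fun q => ξ q - q.2.1) F (𝓝 0) := by
    refine squeeze_zero_norm' (a := fun q : ℝ × Space d × ℝ => L * q.1) ?_
      (by simpa using htime.const_mul L)
    filter_upwards [hsmall] with q hq using (hξ q hq.1 hq.2).1
  have hξx : Tendsto ξ F (𝓝 x) := by
    simpa using hξ0.add hid.snd_nhds.fst_nhds
  have hGt : Tendsto (fun q => G (ξ q, q.2.2)) F (𝓝 (G (x, l))) :=
    ((continuousOn_deriv_initialHeight hφ₀).continuousAt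
      (isOpen_params.mem_nhds hl)).tendsto.comp (hξx.prodMk_nhds hid.snd_nhds.snd_nhds)
  have hdiff : Tendsto (fun q : ℝ × Space d × ℝ =>
      deriv (fun l' => φ q.1 q.2.1 l') q.2.2 - G (ξ q, q.2.2)) F (𝓝 0) := by
    refine squeeze_zero_norm' (a := fun q : ℝ × Space d × ℝ => (1 + M) * N * q.1) ?_
      (by simpa using htime.const_mul ((1 + M) * N))
    filter_upwards [hsmall] with q hq using (hξ q hq.1 hq.2).2
  have h1 := hdiff.add hGt
  simp only [sub_add_cancel, zero_add] at h1
  change Tendsto _ F (𝓝 (deriv (fun l' => φ 0 x l') l))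
  rw [hφ.deriv_zero x hl]
  exact h1

theorem continuousOn_velocity (hφ : IsChangeOfVariable (n + 1) T' zb η u w φ₀ φ)
    (h0 : IsInitialHeight c M zb η φ₀) (hT' : T' ≤ T)
    (hu : ContinuousOn (fun p : ℝ × Space d × ℝ => u p.1 p.2.1 p.2.2) (fluidDomainBar T zb η)) :
    ContinuousOn (fun q : ℝ × Space d × ℝ => u q.1 q.2.1 (φ q.1 q.2.1 q.2.2)) (stripBar d T') := by
  refine hu.comp (f := fun q : ℝ × Space d × ℝ => (q.1, q.2.1, φ q.1 q.2.1 q.2.2))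
    (continuousOn_fst.prodMk ((continuous_fst.comp continuous_snd).continuousOn.prodMk
      hφ.continuousOn)) fun q hq => ?_
  have h1 := hφ.mem_Ioo h0 ⟨hq.1, hq.2.1⟩ q.2.1 hq.2.2
  exact ⟨hq.1, hq.2.1.trans_le hT', h1.1.le, h1.2.le⟩

theorem isSemiLagrangianSolution (hφ : IsChangeOfVariable (n + 1) T' zb η u w φ₀ φ)
    (hn : 1 ≤ n) (h : IsFluid T L zb η (velocity u w)) (h0 : IsInitialHeight c M zb η φ₀)
    (hT' : T' ≤ T)
    (hφ₀ : ContDiffOn ℝ (n + 1 : ℕ) (fun p : Space d × ℝ => φ₀ p.1 p.2) (params d))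
    (hsol : IsEulerSolution (n + 1) g T zb η₀ u₀ η u w) :
    IsSemiLagrangianSolution g T' zb (fun x l => deriv (fun l' => φ₀ x l') l)
      (fun x l => u 0 x (φ₀ x l)) (fun t x l => deriv (fun l' => φ t x l') l)
      (fun t x l => u t x (φ t x l)) := by
  have hud : ∀ p ∈ fluidDomain T zb η,
      DifferentiableAt ℝ (fun p : ℝ × Space d × ℝ => u p.1 p.2.1 p.2.2) p :=
    fun p hp => (h.diff p hp).fst
  have hwd : ∀ p ∈ fluidDomain T zb η,
      DifferentiableAt ℝ (fun p : ℝ × Space d × ℝ => w p.1 p.2.1 p.2.2) p :=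
    fun p hp => (h.diff p hp).snd
  have hdepth : ∀ t ∈ Ioo 0 T', (fun y => ∫ l in (0 : ℝ)..1, deriv (fun l' => φ t y l') l)
      = fun y => η t y - zb y := fun t ht => funext fun y => (hφ.integral_deriv h h0 hT' ht y).2
  have hηd : ∀ t ∈ Ioo 0 T', Differentiable ℝ (η t) := fun t ht y =>
    (h.hasFDerivAt_eta ⟨ht.1, ht.2.trans_le hT'⟩ y).differentiableAt
  refine ⟨hφ.continuousOn_thickness h h0 hT' hφ₀, hφ.continuousOn_velocity h0 hT' hsol.u_cont,
    hφ.contDiffOn_thickness.differentiableOn (by norm_cast; omega),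
    (hφ.contDiffOn_velocity hT' hsol.u_Cb.1).differentiableOn (by norm_cast),
    fun t ht x => (hφ.integral_deriv h h0 hT' ht x).1, fun t ht => ?_, fun t x l hq => ?_,
    fun t x l hq => ?_, fun x l hl => hφ.deriv_zero x hl, fun x l hl => ?_⟩
  · rw [hdepth t ht]
    exact (hηd t ht).sub h.zb_diff
  · have hp := hφ.mem_fluidDomain hT' hq
    exact hφ.mass hn hq (hud _ hp) (hwd _ hp) (hsol.incompressible _ _ _ hp)
  · have hp := hφ.mem_fluidDomain hT' hq
    have ht : t ∈ Ioo 0 T' := ⟨hq.1, hq.2.1⟩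
    rw [hdepth t ht, gradient_sub (hηd t ht x) (h.zb_diff x), hφ.material_deriv hq (hud _ hp),
      smul_sub, ← add_sub_assoc]
    have h1 := hsol.momentum _ _ _ hp
    change _ + g • gradient (η t) x = 0 at h1
    change _ + g • gradient (η t) x - _ = _
    rw [h1, zero_sub]
  · rw [hφ.init x l hl]

end IsChangeOfVariable

end

/-! ### Classical solutions of the hydrostatic Euler system -/

section

variable {d n : ℕ} {g T L c : ℝ} {zb η₀ : Space d → ℝ} {u₀ : Space d → ℝ → Space d}
  {η : ℝ → Space d → ℝ}
  {u : ℝ → Space d → ℝ → Space d} {w : ℝ → Space d → ℝ → ℝ} {φ₀ : Space d → ℝ → ℝ}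

namespace IsEulerSolution

theorem isOpen_time : IsOpen {p : ℝ × Space d | 0 < p.1 ∧ p.1 < T} :=
  (isOpen_lt continuous_const continuous_fst).inter (isOpen_lt continuous_fst continuous_const)

theorem isOpen_fluidDomain (hzb : IsCb (n + 1) univ zb)
    (hsol : IsEulerSolution (n + 1) g T zb η₀ u₀ η u w) : IsOpen (fluidDomain T zb η) :=
  isOpen_fluidDomain_of_continuous (continuousOn_univ.1 hzb.1.continuousOn) fun t ht x =>
    hsol.eta_Cb.1.continuousOn.continuousAt (isOpen_time.mem_nhds (x := (t, x)) ht)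

theorem hasBddDerivs_velocity (hzb : IsCb (n + 1) univ zb)
    (hsol : IsEulerSolution (n + 1) g T zb η₀ u₀ η u w) :
    HasBddDerivs (fluidDomain T zb η) (n + 1) (velocity u w) :=
  have hU := hsol.isOpen_fluidDomain hzb
  (HasBddDerivs.of_isCb hU hsol.u_Cb).prodMk hU (.of_isCb hU hsol.w_Cb)

theorem exists_isFluid (hzb : IsCb (n + 1) univ zb)
    (hsol : IsEulerSolution (n + 1) g T zb η₀ u₀ η u w) :
    ∃ L, IsFluid T L zb η (velocity u w) := by
  obtain ⟨-, hz1, hz2⟩ := HasBddDerivs.of_isCb isOpen_univ hzb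
  obtain ⟨-, he1, he2⟩ := HasBddDerivs.of_isCb isOpen_time hsol.eta_Cb
  obtain ⟨⟨C₁, hC₁⟩, hf1, hf2⟩ := hsol.hasBddDerivs_velocity hzb
  obtain ⟨C₂, hC₂⟩ := hf2.bounded
  obtain ⟨C₃, hC₃⟩ := he2.bounded
  obtain ⟨C₄, hC₄⟩ := hz2.bounded
  have hle : ∀ C ∈ [C₁, C₂, C₃, C₄], C ≤ |C₁| + |C₂| + |C₃| + |C₄| := by
    simp only [List.forall_mem_cons]
    refine ⟨?_, ?_, ?_, ?_, by simp⟩ <;>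
    linarith [le_abs_self C₁, le_abs_self C₂, le_abs_self C₃, le_abs_self C₄, abs_nonneg C₁,
      abs_nonneg C₂, abs_nonneg C₃, abs_nonneg C₄]
  refine ⟨|C₁| + |C₂| + |C₃| + |C₄|, by positivity, fun x => hz1 x (mem_univ x),
    fun x => (hC₄ x (mem_univ x)).trans (hle _ (by simp)), fun t ht x => he1 (t, x) ht,
    fun t ht x => (hC₃ (t, x) ht).trans (hle _ (by simp)), hsol.eta_cont, hf1,
    fun p hp => (hC₁ p hp).trans (hle _ (by simp)), fun p hp => (hC₂ p hp).trans (hle _ (by simp)),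
    hsol.u_cont.prodMk hsol.w_cont, fun t ht x => ?_, fun t ht x => ?_⟩
  · have hd := (he1 (t, x) ht).hasFDerivAt
    have h1 : HasDerivAt (fun τ => η τ x) _ t :=
      HasFDerivAt.comp_hasDerivAt (f := fun τ => (τ, x)) t hd
        ((hasDerivAt_id t).prodMk (hasDerivAt_const t x))
    have h2 : HasFDerivAt (fun y => η t y) _ x := hd.comp x (hasFDerivAt_prodMk_right t x)
    have h3 := hsol.surface t ht x
    rw [h1.deriv, h2.fderiv, sub_eq_zero] at h3
    rw [ContinuousLinearMap.comp_apply, ContinuousLinearMap.inr_apply, ← map_add] at h3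
    simpa [velocity] using h3
  · exact sub_eq_zero.1 (hsol.bottom t ht x)

end IsEulerSolution

theorem exists_isInitialHeight (hc : 0 < c)
    (hφ₀ : IsCb (n + 1) (params d) (fun p : Space d × ℝ => φ₀ p.1 p.2))
    (hcont : ContinuousOn (fun p : Space d × ℝ => φ₀ p.1 p.2) {p | 0 ≤ p.2 ∧ p.2 ≤ 1})
    (hbot : ∀ x, φ₀ x 0 = zb x) (htop : ∀ x, φ₀ x 1 = η 0 x)
    (hinf : ∀ x, ∀ l ∈ Ioo (0 : ℝ) 1, c ≤ deriv (fun l' => φ₀ x l') l) :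
    ∃ M, IsInitialHeight c M zb η φ₀ := by
  obtain ⟨-, h1, h2⟩ := HasBddDerivs.of_isCb isOpen_params hφ₀
  obtain ⟨M, hM⟩ := h2.bounded
  exact ⟨|M|, hc, abs_nonneg M, fun x l hl => h1 (x, l) hl,
    fun x l hl => (hM (x, l) hl).trans (le_abs_self M), hinf, hcont, hbot, htop⟩

end

end HydroEuler

theorem mainTheorem8 (d s : ℕ) (hs : 2 ≤ s) (g T : ℝ) (hT : 0 < T)
    (zb η₀ : HydroEuler.Space d → ℝ)
    (u₀ : HydroEuler.Space d → ℝ → HydroEuler.Space d)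
    (η : ℝ → HydroEuler.Space d → ℝ)
    (u : ℝ → HydroEuler.Space d → ℝ → HydroEuler.Space d)
    (w : ℝ → HydroEuler.Space d → ℝ → ℝ)
    (φ₀ : HydroEuler.Space d → ℝ → ℝ)
    (hzb : HydroEuler.IsCb s Set.univ zb)
    (hsol : HydroEuler.IsEulerSolution s g T zb η₀ u₀ η u w)
    (hφ₀ : HydroEuler.IsCb s {p : HydroEuler.Space d × ℝ | 0 < p.2 ∧ p.2 < 1}
      (fun p => φ₀ p.1 p.2))
    (hφ₀_cont : ContinuousOn (fun p : HydroEuler.Space d × ℝ => φ₀ p.1 p.2)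
      {p | 0 ≤ p.2 ∧ p.2 ≤ 1})
    (hφ₀_bot : ∀ x, φ₀ x 0 = zb x)
    (hφ₀_top : ∀ x, φ₀ x 1 = η₀ x)
    (hφ₀_inf : ∃ c : ℝ, 0 < c ∧ ∀ x, ∀ l ∈ Set.Ioo (0 : ℝ) 1, c ≤ deriv (fun l' => φ₀ x l') l) :
    (∃ Tstar : ℝ, 0 < Tstar ∧ Tstar ≤ T ∧
      ∃ φ : ℝ → HydroEuler.Space d → ℝ → ℝ,
        HydroEuler.IsChangeOfVariable s Tstar zb η u w φ₀ φ) ∧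
    ∀ Tstar : ℝ, 0 < Tstar → Tstar ≤ T → ∀ φ : ℝ → HydroEuler.Space d → ℝ → ℝ,
      HydroEuler.IsChangeOfVariable s Tstar zb η u w φ₀ φ →
      ∀ (H : ℝ → HydroEuler.Space d → ℝ → ℝ) (v : ℝ → HydroEuler.Space d → ℝ → HydroEuler.Space d),
        (∀ t x l, H t x l = deriv (fun l' => φ t x l') l) →
        (∀ t x l, v t x l = u t x (φ t x l)) →
        ContDiffOn ℝ ((s - 1 : ℕ) : WithTop ℕ∞)
          (fun p : ℝ × HydroEuler.Space d × ℝ => H p.1 p.2.1 p.2.2) (HydroEuler.strip d Tstar) ∧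
        ContDiffOn ℝ (s : WithTop ℕ∞)
          (fun p : ℝ × HydroEuler.Space d × ℝ => v p.1 p.2.1 p.2.2) (HydroEuler.strip d Tstar) ∧
        HydroEuler.IsSemiLagrangianSolution g Tstar zb
          (fun x l => deriv (fun l' => φ₀ x l') l) (fun x l => u 0 x (φ₀ x l)) H v := by
  obtain ⟨n, rfl⟩ : ∃ n, s = n + 1 := ⟨s - 1, by omega⟩
  have hn : 1 ≤ n := by omega
  obtain ⟨c, hc, hinf⟩ := hφ₀_inf
  obtain ⟨L, hL⟩ := hsol.exists_isFluid hzb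
  obtain ⟨M, hM⟩ := HydroEuler.exists_isInitialHeight (η := η) hc hφ₀ hφ₀_cont hφ₀_bot
    (fun x => (hφ₀_top x).trans (hsol.eta_init x).symm) hinf
  refine ⟨HydroEuler.exists_isChangeOfVariable hT rfl hL hM (hsol.hasBddDerivs_velocity hzb)
    hφ₀.1, fun T' _ hT' φ hφ H v hH hv => ?_⟩
  obtain rfl : H = fun t x l => deriv (fun l' => φ t x l') l := by
    funext t x l; exact hH t x l
  obtain rfl : v = fun t x l => u t x (φ t x l) := by
    funext t x l; exact hv t x l
  exact ⟨hφ.contDiffOn_thickness, hφ.contDiffOn_velocity hT' hsol.u_Cb.1,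
    hφ.isSemiLagrangianSolution hn hL hM hT' hφ₀.1 hsol⟩
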